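/- Let $f,g:\mathbb{R}^3\to\mathbb{R}$ be $C^\infty$ functions of $(u,v,\alpha)$ with $f(0,0,\alpha)=g(0,0,\alpha)=0$ for all $\alpha\in\mathbb{R}$, and consider the planar kinetic system $$\dot u=f(u,v,\alpha),\qquad \dot v=g(u,v,\alpha). \tag{K}$$ Let $J(\alpha)$ be its Jacobian matrix at the origin. Suppose that $J(0)$ has the eigenvalues $\pm\mathrm{i}\mu_0$ with $\mu_0>0$, and for $\alpha$ near $0$ write the eigenvalues of $J(\alpha)$ as $A(\alpha)\pm\mathrm{i}B(\alpha)$. Let $k\ge 1$, and suppose that (K) with $\alpha=0$ has a weak focus of order $k$ at the origin, with Lyapunov coefficients $C_1,\dots,C_k\in\mathbb{C}$; that is, in a suitable smooth local complex coordinate $z$ at the origin, the system (K) with $\alpha=0$ takes the Poincaré–Birkhoff normal form $$\dot z=\mathrm{i}\mu_0 z+C_1z^2\bar z+C_2z^3\bar z^2+\cdots+C_kz^{k+1}\bar z^k+O(|z|^{2k+3}),$$ where $\operatorname{Re}C_1=\cdots=\operatorname{Re}C_{k-1}=0$ and $\operatorname{Re}C_k\neq 0$. Suppose that $\operatorname{Re}C_k<0$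 and $A'(0)\ne 0$. Then there exist a constant $\alpha_0>0$ and functions $\psi(\cdot,\alpha):\mathbb{R}\to\mathbb{R}^2$, for $|\alpha|<\alpha_0$ with $\alpha A'(0)>0$, such that: (i) for every $\alpha$ with $|\alpha|<\alpha_0$ and $\alpha A'(0)>0$, $\psi(\cdot,\alpha)$ is a stable periodic solution of (K), with a minimum period $P>0$ (so it is not constant); it bifurcates from the origin, that is, $\psi(t,\alpha)$ is jointly continuous in $(t,\alpha)$, and $\psi(t,\alpha)\to 0$ uniformly in $t$ as $\alpha\to 0$ with $\alpha A'(0)>0$. Here stable means that $\psi(\cdot,\alpha)$ is Lyapunov stable and that every solution starting sufficiently close to the orbit of $\psi(\cdot,\alpha)$ exists for all positive times and tends to this orbit as $t\to\infty$. (ii) for every $\alpha$ with $|\alpha|<\alpha_0$ and $\alpha A'(0)>0$, every integer $n\ge 2$, every $\delta>0$ and all real $d_{11},d_{12},d_{21},d_{22}$, the $n$-patch model $$\dot u_j=\delta\sum_{i=1}^n\bigl(d_{11}(u_i-u_j)+d_{12}(v_i-v_j)\bigr)+f(u_j,v_j,\alpha),\qquad \dot v_j=\delta\sum_{i=1}^n\bigl(d_{21}(u_i-u_j)+d_{22}(v_i-v_j)\bigr)+g(u_j,v_j,\alpha)\qquad(1\le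 j\le n)$$ has the synchronous periodic solution $(\psi(t,\alpha),\dots,\psi(t,\alpha))\in\mathbb{R}^{2n}$. -/

import Mathlib

open Filter Topology Set
open scoped ContDiff

namespace PatchHopf

/-! ### Planar kinetic systems -/

/-- The planar vector field `(u, v) ↦ (f (u, v, α), g (u, v, α))` of the kinetic system. -/
def kineticField (f g : ℝ → ℝ → ℝ → ℝ) (α : ℝ) : ℝ × ℝ → ℝ × ℝ :=
  fun p => (f p.1 p.2 α, g p.1 p.2 α)

/-- The Jacobian matrix `J(α)` of the kinetic system at the origin. -/
noncomputable def jacobianAtOrigin (f g : ℝ → ℝ → ℝ → ℝ) (α : ℝ) : Matrix (Fin 2) (Fin 2) ℝ :=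
  !![deriv (fun u => f u 0 α) 0, deriv (fun v => f 0 v α) 0;
     deriv (fun u => g u 0 α) 0, deriv (fun v => g 0 v α) 0]

/-- The eigenvalues (with multiplicity) of the real matrix `M` are `a + i b` and `a - i b`. -/
def HasEigenvaluePair (M : Matrix (Fin 2) (Fin 2) ℝ) (a b : ℝ) : Prop :=
  (M.map (algebraMap ℝ ℂ)).charpoly.roots =
    {(a : ℂ) + b * Complex.I, (a : ℂ) - b * Complex.I}

/-! ### Normal form, Lyapunov coefficients, weak foci -/

/-- The truncated Poincaré–Birkhoff normal form
`i μ₀ z + C₁ z² z̄ + C₂ z³ z̄² + ⋯ + C_k z^{k+1} z̄^k`. -/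
noncomputable def normalFormField (μ₀ : ℝ) (k : ℕ) (C : ℕ → ℂ) (z : ℂ) : ℂ :=
  Complex.I * μ₀ * z + ∑ j ∈ Finset.Icc 1 k, C j * z ^ (j + 1) * (starRingEnd ℂ z) ^ j

/-- `C 1, …, C k` are the first `k` Lyapunov coefficients of the planar system `ẋ = F x` at the
origin, an equilibrium with linear part of eigenvalues `± i μ₀`: in some smooth local complex
coordinate `z = Φ x` at the origin, the system reads
`ż = i μ₀ z + C₁ z² z̄ + ⋯ + C_k z^{k+1} z̄^k + O(|z|^{2k+3})`,
where `ż = DΦ(x) F(x)`. -/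
def AreLyapunovCoefficients (F : ℝ × ℝ → ℝ × ℝ) (μ₀ : ℝ) (k : ℕ) (C : ℕ → ℂ) : Prop :=
  ∃ Φ : ℝ × ℝ → ℂ,
    ContDiffAt ℝ ∞ Φ 0 ∧ Φ 0 = 0 ∧ Function.Bijective (fderiv ℝ Φ 0) ∧
    (fun x => fderiv ℝ Φ x (F x) - normalFormField μ₀ k C (Φ x))
      =O[𝓝 0] (fun x => ‖Φ x‖ ^ (2 * k + 3))

/-- The origin is a weak focus of order `k ≥ 1` of `ẋ = F x`, with Lyapunov coefficients
`C 1, …, C k`: the real parts of `C 1, …, C (k - 1)` vanish and that of `C k` does not. -/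
structure IsWeakFocusOfOrder (F : ℝ × ℝ → ℝ × ℝ) (μ₀ : ℝ) (k : ℕ) (C : ℕ → ℂ) : Prop where
  one_le : 1 ≤ k
  coefficients : AreLyapunovCoefficients F μ₀ k C
  re_eq_zero : ∀ j, 1 ≤ j → j < k → (C j).re = 0
  re_ne_zero : (C k).re ≠ 0

/-! ### Periodic solutions and their stability -/

/-- `P > 0` is the minimum period of the function `φ`; in particular `φ` is not constant. -/
def HasMinimumPeriod {E : Type*} (φ : ℝ → E) (P : ℝ) : Prop :=
  0 < P ∧ Function.Periodic φ P ∧ ∀ Q, 0 < Q → Q < P → ¬ Function.Periodic φ Q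

/-- `φ` is a (nonconstant) periodic solution of `ẋ = F x`. -/
def IsPeriodicSolution {E : Type*} [NormedAddCommGroup E] [NormedSpace ℝ E]
    (F : E → E) (φ : ℝ → E) : Prop :=
  IsIntegralCurve φ (fun _ => F) ∧ ∃ P, HasMinimumPeriod φ P

/-- `y` solves `ẋ = F x` on `[0, ∞)` with `y 0 = x₀`. -/
def IsForwardSolution {E : Type*} [NormedAddCommGroup E] [NormedSpace ℝ E]
    (F : E → E) (x₀ : E) (y : ℝ → E) : Prop :=
  IsIntegralCurveOn y (fun _ => F) (Ici 0) ∧ y 0 = x₀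

/-- Lyapunov stability of the solution `φ` of `ẋ = F x`: solutions that start close to `φ 0` exist
for all positive times and stay close to `φ`. -/
def IsLyapunovStable {E : Type*} [NormedAddCommGroup E] [NormedSpace ℝ E]
    (F : E → E) (φ : ℝ → E) : Prop :=
  ∀ ε > 0, ∃ η > 0, ∀ x₀, dist x₀ (φ 0) < η →
    (∃ y, IsForwardSolution F x₀ y) ∧
    ∀ y, IsForwardSolution F x₀ y → ∀ t, 0 ≤ t → dist (y t) (φ t) < ε

/-- The orbit of `φ` attracts all solutions of `ẋ = F x` that start close to it. -/
def IsOrbitallyAttracting {E : Type*} [NormedAddCommGroup E] [NormedSpace ℝ E]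
    (F : E → E) (φ : ℝ → E) : Prop :=
  ∃ η > 0, ∀ x₀, Metric.infDist x₀ (range φ) < η →
    (∃ y, IsForwardSolution F x₀ y) ∧
    ∀ y, IsForwardSolution F x₀ y →
      Tendsto (fun t => Metric.infDist (y t) (range φ)) atTop (𝓝 0)

/-- `φ` is a stable periodic solution (a stable limit cycle) of `ẋ = F x`. -/
structure IsStablePeriodicSolution {E : Type*} [NormedAddCommGroup E] [NormedSpace ℝ E]
    (F : E → E) (φ : ℝ → E) : Prop where
  periodic : IsPeriodicSolution F φ
  lyapunov : IsLyapunovStable F φ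
  attracting : IsOrbitallyAttracting F φ

/-- The functions `ψ α`, for parameters `α ∈ S`, form a continuous branch that emanates from the
origin at `α = 0`: `ψ α t` is jointly continuous in `(α, t)`, and tends to the origin as `α → 0`
in `S`, uniformly in `t`. -/
def BifurcatesFromOrigin {E : Type*} [NormedAddCommGroup E]
    (S : Set ℝ) (ψ : ℝ → ℝ → E) : Prop :=
  ContinuousOn (fun q : ℝ × ℝ => ψ q.1 q.2) (S ×ˢ univ) ∧
  TendstoUniformly ψ (fun _ => 0) (𝓝[S] 0)

/-! ### The patch model -/

/-- The vector field of the `n`-patch model with coupling strength `δ`, diffusion matrix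
`D = (d_{kl})` and kinetics `F`; the state `U j = (u_j, v_j)` describes the `j`-th patch. -/
def patchField {n : ℕ} (δ : ℝ) (D : Matrix (Fin 2) (Fin 2) ℝ) (F : ℝ × ℝ → ℝ × ℝ) :
    (Fin n → ℝ × ℝ) → (Fin n → ℝ × ℝ) :=
  fun U j =>
    (δ * ∑ i, (D 0 0 * ((U i).1 - (U j).1) + D 0 1 * ((U i).2 - (U j).2)) + (F (U j)).1,
     δ * ∑ i, (D 1 0 * ((U i).1 - (U j).1) + D 1 1 * ((U i).2 - (U j).2)) + (F (U j)).2)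

/-- `U` is a synchronous periodic solution of the system `U̇ = G U` of `n` patches: a solution of
the form `(φ, …, φ)` with `φ` periodic of a minimum period `P > 0`. -/
def IsSynchronousPeriodicSolution {n : ℕ} (G : (Fin n → ℝ × ℝ) → (Fin n → ℝ × ℝ))
    (U : ℝ → Fin n → ℝ × ℝ) : Prop :=
  IsIntegralCurve U (fun _ => G) ∧
  ∃ φ : ℝ → ℝ × ℝ, (∀ t j, U t j = φ t) ∧ ∃ P, HasMinimumPeriod φ P

end PatchHopf

open PatchHopf

namespace PatchHopf

/-! ### Global solutions of scalar equations -/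

/-! Near the origin, write the field in the complex coordinate `z` of the normal form. For small α
it is a real-linear part `a(α) z + b(α) z̄` with `Re a(α) = A(α)` and `b(0) = 0`, plus the resonant
terms `C_j z |z|^{2j}`, plus an error `O(|α||z|² + |z|^{2k+3})`. The linear growth `A'(0) α`
balances the damping `Re C_k |z|^{2k}` when `|z|` has order `|α|^{1/(2k)}`. This suggests `α = ±
ε^{2k}`, with the sign of `A'(0)`, and polar coordinates `z = ε exp(σ + iθ)`.

One obstruction remains: `b` is itself `O(ε^{2k})`, so it adds an oscillation `Re(b e^{-2iθ})` of
the same order as the terms that matter. This oscillation has mean zero, so the σ-coordinate is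
sheared by its antiderivative divided by `μ₀` (`shear`), which removes it to leading order. Then,
uniformly in θ and for σ in a compact interval, `dσ/dθ = (ε^{2k}/μ₀)(|A'(0)| + Re C_k e^{2kσ}) +
o(ε^{2k})` (`tendsto_radial`), and the σ-derivative has the corresponding limit
(`tendsto_slopeNumerator`). As `Re C_k < 0`, the limit slope is decreasing in σ and changes sign.
For small ε there is thus a strip `σ₁ ≤ σ ≤ σ₂` whose edges are crossed inward and on which the
equation contracts at a rate of order `ε^{2k}` (`eventually_strip_estimates`,
`eventually_slopeField_sign`).

The remaining argument concerns scalar periodic equations with such a strip (`IsCylinderField`). The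
return map has a fixed point; contraction makes nearby solutions approach it exponentially. The
angular speed is Lipschitz in σ, so the total time lag between two solutions is also controlled by
their initial distance. This gives Lyapunov stability of the solution itself as well as orbital
attraction (`isStablePeriodicSolution`). Contraction also gives continuous dependence on ε
(`exists_continuous_periodic`). The chart carries everything back to the plane (`IsCylinderChart`),
and the orbits shrink with ε. In the patch model the coupling consists of differences between
patches, so it vanishes on synchronous states. -/

/-- A bounded, globally Lipschitz, time-dependent vector field has global solutions. -/
theorem exists_global_solution {E : Type*} [NormedAddCommGroup E] [NormedSpace ℝ E]
    [CompleteSpace E] {f : ℝ → E → E} {K L : NNReal} (hK : ∀ t, LipschitzWith K (f t))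
    (hc : ∀ x, Continuous fun t => f t x) (hL : ∀ t x, ‖f t x‖ ≤ L) (t₀ : ℝ) (x₀ : E) :
    ∃ γ : ℝ → E, γ t₀ = x₀ ∧ ∀ t, HasDerivAt γ (f t (γ t)) t := by
  have key : ∀ n : ℕ, ∃ γ : ℝ → E, γ t₀ = x₀ ∧
      ∀ t ∈ Ioo (t₀ - (n + 1)) (t₀ + (n + 1)), HasDerivAt γ (f t (γ t)) t := by
    intro n
    have hn : (0 : ℝ) ≤ n := n.cast_nonneg
    let s : Icc (t₀ - (n + 1)) (t₀ + (n + 1)) := ⟨t₀, by constructor <;> linarith⟩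
    have hp : IsPicardLindelof f s x₀ (L * (n + 1)) 0 L K :=
      { lipschitzOnWith := fun t _ => (hK t).lipschitzOnWith
        continuousOn := fun x _ => (hc x).continuousOn
        norm_le := fun t _ x _ => hL t x
        mul_max_le := by simp [s] }
    obtain ⟨γ, h0, h1⟩ := hp.exists_eq_forall_mem_Icc_hasDerivWithinAt₀
    exact ⟨γ, h0, fun t ht => (h1 t (Ioo_subset_Icc_self ht)).hasDerivAt (Icc_mem_nhds ht.1 ht.2)⟩
  choose γ h0 h1 using key
  have heq : ∀ n m : ℕ, n ≤ m → EqOn (γ n) (γ m) (Ioo (t₀ - (n + 1)) (t₀ + (n + 1))) := by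
    intro n m hnm
    have hn : (0 : ℝ) ≤ n := n.cast_nonneg
    have hm : (n : ℝ) ≤ m := by exact_mod_cast hnm
    refine ODE_solution_unique_of_mem_Ioo (v := f) (s := fun _ => univ) (K := K) (t₀ := t₀)
      (fun t _ => (hK t).lipschitzOnWith) (by constructor <;> linarith)
      (fun t ht => ⟨h1 n t ht, trivial⟩) (fun t ht => ⟨h1 m t ?_, trivial⟩) (by rw [h0, h0])
    exact ⟨by linarith [ht.1], by linarith [ht.2]⟩
  -- The solution with index `n` lives on the open interval of radius `n + 1`, which contains every
  -- `t` with `⌈|t - t₀|⌉₊ = n`. Raising the index by one gives a single solution that represents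
  -- the glued function on a neighbourhood of `t`.
  refine ⟨fun t => γ ⌈|t - t₀|⌉₊ t, by simp [h0], fun t => ?_⟩
  set N := ⌈|t - t₀|⌉₊ + 1
  have hN : |t - t₀| < N := lt_of_le_of_lt (Nat.le_ceil _) (by simp [N])
  have hev : (fun s => γ ⌈|s - t₀|⌉₊ s) =ᶠ[𝓝 t] γ N := by
    have hc : ContinuousAt (fun s => |s - t₀|) t := by fun_prop
    filter_upwards [hc.eventually (gt_mem_nhds hN)] with s hs
    have h2 : |s - t₀| ≤ ⌈|s - t₀|⌉₊ := Nat.le_ceil _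
    refine heq _ _ (Nat.ceil_le.2 hs.le) ?_
    have := abs_le.1 h2
    constructor <;> linarith
  have h3 := h1 N t (by have := abs_lt.1 hN; constructor <;> linarith)
  rw [show f t (γ ⌈|t - t₀|⌉₊ t) = f t (γ N t) by rw [hev.eq_of_nhds]]
  exact h3.congr_of_eventuallyEq hev

/-- A function whose derivative is `1 / w` with `w` bounded between positive constants has a global
inverse `Θ`, which solves `Θ' = w ∘ Θ`. -/
theorem exists_inverse_of_hasDerivAt_inv {T w : ℝ → ℝ} {w₀ w₁ : ℝ} (hw₀ : 0 < w₀)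
    (hw : ∀ θ, w₀ ≤ w θ ∧ w θ ≤ w₁) (hT : ∀ θ, HasDerivAt T (w θ)⁻¹ θ) :
    ∃ Θ : ℝ → ℝ, (∀ t, T (Θ t) = t) ∧ (∀ θ, Θ (T θ) = θ) ∧ StrictMono Θ ∧
      ∀ t, HasDerivAt Θ (w (Θ t)) t := by
  have hpos : ∀ θ, 0 < w θ := fun θ => hw₀.trans_le (hw θ).1
  have hw₁ : 0 < w₁ := hw₀.trans_le ((hw 0).1.trans (hw 0).2)
  have hmono : StrictMono T := strictMono_of_deriv_pos fun θ => by
    rw [(hT θ).deriv]; exact inv_pos.2 (hpos θ)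
  have hcont : Continuous T := continuous_iff_continuousAt.2 fun θ => (hT θ).continuousAt
  -- The upper bound on `w` makes `T` grow at least linearly, hence surjective.
  have hslope : ∀ x y, x ≤ y → w₁⁻¹ * (y - x) ≤ T y - T x := fun x y hxy =>
    (convex_univ).mul_sub_le_image_sub_of_le_deriv hcont.continuousOn
      (fun θ _ => (hT θ).differentiableAt.differentiableWithinAt)
      (fun θ _ => by
        rw [(hT θ).deriv]
        exact inv_anti₀ (hpos θ) (hw θ).2) x trivial y trivial hxy
  have hsurj : Function.Surjective T := by
    refine hcont.surjective ?_ ?_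
    · refine tendsto_atTop_mono' atTop (f₁ := fun x => T 0 + w₁⁻¹ * x) ?_
        (tendsto_atTop_add_const_left _ _ (tendsto_id.const_mul_atTop (inv_pos.2 hw₁)))
      filter_upwards [eventually_ge_atTop 0] with x hx
      have := hslope 0 x hx
      simp only [sub_zero] at this
      linarith
    · refine tendsto_atBot_mono' atBot (?_ : T ≤ᶠ[atBot] fun x => T 0 + w₁⁻¹ * x)
        (tendsto_atBot_add_const_left _ _ (tendsto_id.const_mul_atBot (inv_pos.2 hw₁)))
      filter_upwards [eventually_le_atBot 0] with x hx
      have := hslope x 0 hx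
      simp only [zero_sub, mul_neg] at this
      linarith
  let e := hmono.orderIsoOfSurjective T hsurj
  have h1 : ∀ t, T (e.symm t) = t := fun t => e.apply_symm_apply t
  refine ⟨e.symm, h1, fun θ => e.symm_apply_apply θ, e.symm.strictMono, fun t => ?_⟩
  have := HasDerivAt.of_local_left_inverse (f := T) (g := e.symm) (a := t)
    e.symm.continuous.continuousAt (hT _) (inv_pos.2 (hpos _)).ne' (Eventually.of_forall h1)
  simpa using this

/-! ### Attracting strips of scalar periodic equations -/

/-- The scalar equation `dσ/dθ = q θ σ`, `2π`-periodic in `θ`, has the attracting strip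
`σ₁ ≤ σ ≤ σ₂`, on which it is contracting with rate `m`; `Ω` is the angular speed. -/
structure IsCylinderField (q Ω : ℝ → ℝ → ℝ) (σ₁ σ₂ m L w₀ w₁ : ℝ) : Prop where
  lt : σ₁ < σ₂
  m_pos : 0 < m
  L_nonneg : 0 ≤ L
  w₀_pos : 0 < w₀
  q_continuous : Continuous fun x : ℝ × ℝ => q x.1 x.2
  Ω_continuous : Continuous fun x : ℝ × ℝ => Ω x.1 x.2
  q_periodic : ∀ θ σ, q (θ + 2 * Real.pi) σ = q θ σ
  Ω_periodic : ∀ θ σ, Ω (θ + 2 * Real.pi) σ = Ω θ σ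
  q_lipschitz : ∀ θ x y, |q θ x - q θ y| ≤ L * |x - y|
  Ω_lipschitz : ∀ θ x y, |Ω θ x - Ω θ y| ≤ L * |x - y|
  q_bounded : ∀ θ x, |q θ x| ≤ L
  Ω_bounds : ∀ θ x, w₀ ≤ Ω θ x ∧ Ω θ x ≤ w₁
  q_left : ∀ θ, 0 < q θ σ₁
  q_right : ∀ θ, q θ σ₂ < 0
  q_contract : ∀ θ x y, σ₁ ≤ y → y ≤ x → x ≤ σ₂ → q θ x - q θ y ≤ -m * (x - y)

namespace IsCylinderField

variable {q Ω : ℝ → ℝ → ℝ} {σ₁ σ₂ m L w₀ w₁ : ℝ}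

theorem exists_solution (h : IsCylinderField q Ω σ₁ σ₂ m L w₀ w₁) (θ₀ x₀ : ℝ) :
    ∃ s : ℝ → ℝ, s θ₀ = x₀ ∧ ∀ θ, HasDerivAt s (q θ (s θ)) θ := by
  refine exists_global_solution (K := ⟨L, h.L_nonneg⟩) (L := ⟨L, h.L_nonneg⟩) (fun θ => ?_)
    (fun x => ?_) (fun θ x => ?_) θ₀ x₀
  · exact LipschitzWith.of_dist_le_mul fun x y => by
      rw [Real.dist_eq, Real.dist_eq]; exact h.q_lipschitz θ x y
  · exact h.q_continuous.comp (by fun_prop : Continuous fun t : ℝ => (t, x))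
  · exact h.q_bounded θ x

theorem solution_unique (h : IsCylinderField q Ω σ₁ σ₂ m L w₀ w₁) {s s' : ℝ → ℝ} {θ₀ : ℝ}
    (hs : ∀ θ, HasDerivAt s (q θ (s θ)) θ) (hs' : ∀ θ, HasDerivAt s' (q θ (s' θ)) θ)
    (h0 : s θ₀ = s' θ₀) : s = s' := by
  refine ODE_solution_unique_univ (v := q) (s := fun _ => univ) (K := ⟨L, h.L_nonneg⟩) (fun θ => ?_)
    (fun θ => ⟨hs θ, trivial⟩) (fun θ => ⟨hs' θ, trivial⟩) h0
  exact (LipschitzWith.of_dist_le_mul fun x y => by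
      rw [Real.dist_eq, Real.dist_eq]; exact h.q_lipschitz θ x y).lipschitzOnWith

/-- The slope points strictly inward on both edges, so the constants `σ₁` and `σ₂` are barriers for
increasing angle. -/
theorem mem_strip (h : IsCylinderField q Ω σ₁ σ₂ m L w₀ w₁) {s : ℝ → ℝ} {θ₀ : ℝ}
    (hs : ∀ θ, HasDerivAt s (q θ (s θ)) θ) (h0 : s θ₀ ∈ Icc σ₁ σ₂) {θ : ℝ} (hθ : θ₀ ≤ θ) :
    s θ ∈ Icc σ₁ σ₂ := by
  have hc : Continuous s := continuous_iff_continuousAt.2 fun θ => (hs θ).continuousAt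
  constructor
  · have := image_le_of_deriv_right_lt_deriv_boundary (f := fun t => -s t) (f' := fun t => -q t (s t))
      (B := fun _ => -σ₁) (B' := fun _ => 0) (a := θ₀) (b := θ) hc.neg.continuousOn
      (fun x _ => (hs x).neg.hasDerivWithinAt) (by simpa using h0.1)
      (fun x => hasDerivAt_const x _)
      (fun x _ hx => by
        have h1 := h.q_left x
        have h2 : s x = σ₁ := neg_injective hx
        simpa [h2] using h1) (right_mem_Icc.2 hθ)
    exact neg_le_neg_iff.1 this
  · exact image_le_of_deriv_right_lt_deriv_boundary (f := s) (f' := fun t => q t (s t))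
      (B := fun _ => σ₂) (B' := fun _ => 0) (a := θ₀) (b := θ) hc.continuousOn
      (fun x _ => (hs x).hasDerivWithinAt) h0.2
      (fun x => hasDerivAt_const x _)
      (fun x _ hx => by
        have h1 := h.q_right x
        simpa [hx] using h1) (right_mem_Icc.2 hθ)

theorem q_contract_sq (h : IsCylinderField q Ω σ₁ σ₂ m L w₀ w₁) (θ : ℝ) {x y : ℝ}
    (hx : x ∈ Icc σ₁ σ₂) (hy : y ∈ Icc σ₁ σ₂) :
    (x - y) * (q θ x - q θ y) ≤ -m * (x - y) ^ 2 := by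
  rcases le_total y x with hxy | hxy
  · have := h.q_contract θ x y hy.1 hxy hx.2
    nlinarith [mul_le_mul_of_nonneg_left this (sub_nonneg.2 hxy)]
  · have := h.q_contract θ y x hx.1 hxy hy.2
    nlinarith [mul_le_mul_of_nonneg_left this (sub_nonneg.2 hxy)]

/-- Contraction makes the squared difference, weighted by `exp (2m(θ - θ₀))`, nonincreasing.
Squaring avoids deciding which solution is the larger one. -/
theorem abs_sub_le (h : IsCylinderField q Ω σ₁ σ₂ m L w₀ w₁) {s s' : ℝ → ℝ} {θ₀ : ℝ}
    (hs : ∀ θ, HasDerivAt s (q θ (s θ)) θ) (hs' : ∀ θ, HasDerivAt s' (q θ (s' θ)) θ)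
    (h0 : s θ₀ ∈ Icc σ₁ σ₂) (h0' : s' θ₀ ∈ Icc σ₁ σ₂) {θ : ℝ} (hθ : θ₀ ≤ θ) :
    |s θ - s' θ| ≤ Real.exp (-m * (θ - θ₀)) * |s θ₀ - s' θ₀| := by
  let d : ℝ → ℝ := fun t => Real.exp (2 * m * (t - θ₀)) * (s t - s' t) ^ 2
  have hd : ∀ t, HasDerivAt d (2 * Real.exp (2 * m * (t - θ₀)) *
      (m * (s t - s' t) ^ 2 + (s t - s' t) * (q t (s t) - q t (s' t)))) t := by
    intro t
    have h1 : HasDerivAt (fun t => Real.exp (2 * m * (t - θ₀)))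
        (Real.exp (2 * m * (t - θ₀)) * (2 * m * 1)) t :=
      (((hasDerivAt_id t).sub_const θ₀).const_mul (2 * m)).exp
    have h2 := ((hs t).sub (hs' t)).pow 2
    refine (h1.mul h2).congr_deriv ?_
    simp only [Pi.sub_apply, Pi.pow_apply]
    push_cast
    ring
  have hanti : AntitoneOn d (Ici θ₀) := by
    refine antitoneOn_of_deriv_nonpos (convex_Ici _)
      (fun t _ => (hd t).continuousAt.continuousWithinAt)
      (fun t _ => (hd t).differentiableAt.differentiableWithinAt) (fun t ht => ?_)
    rw [interior_Ici] at ht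
    rw [(hd t).deriv]
    have := h.q_contract_sq t (h.mem_strip hs h0 (le_of_lt ht)) (h.mem_strip hs' h0' (le_of_lt ht))
    have he := Real.exp_pos (2 * m * (t - θ₀))
    nlinarith
  have h1 : d θ ≤ d θ₀ := hanti self_mem_Ici hθ hθ
  have h2 : (Real.exp (m * (θ - θ₀)) * |s θ - s' θ|) ^ 2 ≤ |s θ₀ - s' θ₀| ^ 2 := by
    rw [mul_pow, sq_abs, sq_abs, ← Real.exp_nat_mul]
    simpa [d, mul_assoc] using h1
  have h3 := abs_le_of_sq_le_sq' h2 (abs_nonneg _)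
  rw [show -m * (θ - θ₀) = -(m * (θ - θ₀)) by ring, Real.exp_neg, ← div_eq_inv_mul,
    le_div_iff₀ (Real.exp_pos _)]
  linarith [h3.2]

/-- The periodic solution in the strip. -/
theorem exists_periodic (h : IsCylinderField q Ω σ₁ σ₂ m L w₀ w₁) :
    ∃ s : ℝ → ℝ, (∀ θ, HasDerivAt s (q θ (s θ)) θ) ∧ (∀ θ, s (θ + 2 * Real.pi) = s θ) ∧
      ∀ θ, s θ ∈ Ioo σ₁ σ₂ := by
  have hpi := Real.two_pi_pos
  choose γ h0 h1 using h.exists_solution 0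
  have hmaps : ∀ x ∈ Icc σ₁ σ₂, γ x (2 * Real.pi) ∈ Icc σ₁ σ₂ := fun x hx =>
    h.mem_strip (h1 x) (by rwa [h0]) hpi.le
  have hcont : ContinuousOn (fun x => γ x (2 * Real.pi)) (Icc σ₁ σ₂) := by
    refine LipschitzOnWith.continuousOn (K := 1) (LipschitzOnWith.of_dist_le_mul fun x hx y hy => ?_)
    have := h.abs_sub_le (h1 x) (h1 y) (by rwa [h0]) (by rwa [h0]) hpi.le
    rw [h0, h0] at this
    rw [Real.dist_eq, Real.dist_eq]
    refine this.trans (mul_le_mul_of_nonneg_right ?_ (abs_nonneg _))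
    simp only [NNReal.coe_one, Real.exp_le_one_iff]
    nlinarith [h.m_pos]
  -- The return map sends the strip's interval continuously into itself, so the intermediate value
  -- theorem gives a fixed point.
  obtain ⟨x, hx, hfix⟩ : ∃ x ∈ Icc σ₁ σ₂, γ x (2 * Real.pi) = x := by
    have := intermediate_value_Icc' h.lt.le (f := fun x => γ x (2 * Real.pi) - x)
      (hcont.sub continuousOn_id)
    obtain ⟨x, hx, hx0⟩ := this (show (0 : ℝ) ∈ _ from
      ⟨by linarith [(hmaps σ₂ (right_mem_Icc.2 h.lt.le)).2],
        by linarith [(hmaps σ₁ (left_mem_Icc.2 h.lt.le)).1]⟩)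
    exact ⟨x, hx, by simpa [sub_eq_zero] using hx0⟩
  have hper : ∀ θ, γ x (θ + 2 * Real.pi) = γ x θ := by
    have : (fun θ => γ x (θ + 2 * Real.pi)) = γ x := by
      refine h.solution_unique (θ₀ := 0) (fun θ => ?_) (h1 x) (by simp [h0, hfix])
      have := (h1 x (θ + 2 * Real.pi)).comp_add_const θ (2 * Real.pi)
      rwa [h.q_periodic] at this
    exact fun θ => congrFun this θ
  -- The strip is invariant only forward; angles to the left of 0 are reached by adding full turns.
  have hIcc : ∀ θ, γ x θ ∈ Icc σ₁ σ₂ := by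
    intro θ
    obtain ⟨n, hn⟩ := exists_nat_ge (-θ / (2 * Real.pi))
    have h2 : γ x (θ + n * (2 * Real.pi)) = γ x θ :=
      (show Function.Periodic (γ x) (2 * Real.pi) from hper).nat_mul n θ
    rw [← h2]
    refine h.mem_strip (h1 x) (by rwa [h0]) ?_
    rw [div_le_iff₀ hpi] at hn
    linarith
  refine ⟨γ x, h1 x, hper, fun θ => ⟨lt_of_le_of_ne (hIcc θ).1 fun he => ?_,
    lt_of_le_of_ne (hIcc θ).2 fun he => ?_⟩⟩
  -- Touching an edge would be a global extremum of the solution, where its slope vanishes, while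
  -- the slope on the edge is nonzero.
  · have hmin : IsLocalMin (γ x) θ := Eventually.of_forall fun t => he ▸ (hIcc t).1
    have := hmin.hasDerivAt_eq_zero (h1 x θ)
    rw [← he] at this
    exact (h.q_left θ).ne' this
  · have hmax : IsLocalMax (γ x) θ := Eventually.of_forall fun t => he ▸ (hIcc t).2
    have := hmax.hasDerivAt_eq_zero (h1 x θ)
    rw [he] at this
    exact (h.q_right θ).ne this

end IsCylinderField

/-- Comparison of periodic solutions of two equations, the first one contracting. -/
theorem IsCylinderField.exists_abs_sub_periodic_le {q Ω q' : ℝ → ℝ → ℝ} {σ₁ σ₂ m L w₀ w₁ : ℝ}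
    (h : IsCylinderField q Ω σ₁ σ₂ m L w₀ w₁) {s s' : ℝ → ℝ}
    (hs : ∀ θ, HasDerivAt s (q θ (s θ)) θ) (hs' : ∀ θ, HasDerivAt s' (q' θ (s' θ)) θ)
    (hp : ∀ θ, s (θ + 2 * Real.pi) = s θ) (hp' : ∀ θ, s' (θ + 2 * Real.pi) = s' θ)
    (hm : ∀ θ, s θ ∈ Icc σ₁ σ₂) (hm' : ∀ θ, s' θ ∈ Icc σ₁ σ₂) :
    ∃ θ ∈ Icc 0 (2 * Real.pi), ∀ t, m * |s t - s' t| ≤ |q θ (s' θ) - q' θ (s' θ)| := by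
  have hpi := Real.two_pi_pos
  let d : ℝ → ℝ := fun t => (s t - s' t) ^ 2
  have hd : ∀ t, HasDerivAt d (2 * (s t - s' t) * (q t (s t) - q' t (s' t))) t := fun t => by
    refine (((hs t).sub (hs' t)).pow 2).congr_deriv ?_
    simp
  have hdc : Continuous d := continuous_iff_continuousAt.2 fun t => (hd t).continuousAt
  have hdp : Function.Periodic d (2 * Real.pi) := fun t => by simp [d, hp, hp']
  obtain ⟨θ, hθ, hmax⟩ := isCompact_Icc.exists_isMaxOn (nonempty_Icc.2 hpi.le) hdc.continuousOn
  have hmax' : ∀ t, d t ≤ d θ := by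
    intro t
    obtain ⟨y, hy, hty⟩ := hdp.exists_mem_Ico₀ hpi t
    rw [hty]
    exact hmax (Ico_subset_Icc_self hy)
  -- Where the squared difference is largest, either the two solutions coincide or their slopes
  -- agree. In the second case the contraction of `q` converts the distance of the solutions into
  -- the distance of the two fields at the same point.
  have h0 := IsLocalMax.hasDerivAt_eq_zero (Eventually.of_forall hmax') (hd θ)
  have hle : ∀ t, |s t - s' t| ≤ |s θ - s' θ| := fun t => by
    have := hmax' t
    exact sq_le_sq.1 this
  refine ⟨θ, hθ, fun t => (mul_le_mul_of_nonneg_left (hle t) h.m_pos.le).trans ?_⟩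
  have hc := h.q_contract_sq θ (hm θ) (hm' θ)
  rcases eq_or_ne (s θ - s' θ) 0 with hz | hz
  · simp [hz]
  have h1 : q θ (s θ) - q' θ (s' θ) = 0 := by
    rcases mul_eq_zero.1 h0 with h2 | h2
    · exact absurd (by linarith) hz
    · exact h2
  have h2 : (s θ - s' θ) * (q θ (s θ) - q θ (s' θ))
      = -((s θ - s' θ) * (q θ (s' θ) - q' θ (s' θ))) := by
    rw [← sub_eq_zero]
    linear_combination (s θ - s' θ) * h1
  rw [h2] at hc
  have h3 : m * |s θ - s' θ| ^ 2 ≤ |s θ - s' θ| * |q θ (s' θ) - q' θ (s' θ)| := by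
    rw [← abs_mul, sq_abs]
    exact le_trans (by linarith) (le_abs_self _)
  have h4 := abs_pos.2 hz
  nlinarith

/-! ### Stability of the periodic orbit -/

/-- Forward solutions of a locally Lipschitz autonomous equation are unique. -/
theorem IsForwardSolution.eqOn {E : Type*} [NormedAddCommGroup E] [NormedSpace ℝ E] {F : E → E}
    (hF : LocallyLipschitz F) {x₀ : E} {x y : ℝ → E} (hx : IsForwardSolution F x₀ x)
    (hy : IsForwardSolution F x₀ y) : EqOn x y (Ici 0) := by
  intro t ht
  have hxc : ContinuousOn x (Icc 0 t) := hx.1.continuousOn.mono Icc_subset_Ici_self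
  have hyc : ContinuousOn y (Icc 0 t) := hy.1.continuousOn.mono Icc_subset_Ici_self
  -- A local Lipschitz condition is uniform on the compact union of the two trajectories, and that
  -- suffices for Grönwall uniqueness.
  have hcomp : IsCompact (x '' Icc 0 t ∪ y '' Icc 0 t) :=
    (isCompact_Icc.image_of_continuousOn hxc).union (isCompact_Icc.image_of_continuousOn hyc)
  obtain ⟨K, hK⟩ := hF.locallyLipschitzOn.exists_lipschitzOnWith_of_compact hcomp
  have hd : ∀ z : ℝ → E, IsForwardSolution F x₀ z →
      ∀ s ∈ Ico 0 t, HasDerivWithinAt z (F (z s)) (Ici s) s := fun z hz s hs =>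
    (hz.1 s hs.1).mono (Ici_subset_Ici.2 hs.1)
  exact ODE_solution_unique_of_mem_Icc_right (v := fun _ => F)
    (s := fun _ => x '' Icc 0 t ∪ y '' Icc 0 t) (K := K) (fun _ _ => hK) hxc (hd x hx)
    (fun s hs => Or.inl (mem_image_of_mem _ (Ico_subset_Icc_self hs))) hyc (hd y hy)
    (fun s hs => Or.inr (mem_image_of_mem _ (Ico_subset_Icc_self hs))) (by rw [hx.2, hy.2])
    (right_mem_Icc.2 ht)

/-- The map `X` from the cylinder coordinates `(θ, σ)` turns solutions of
`θ' = Ω θ σ`, `σ' = Ω θ σ * q θ σ` into solutions of `ẋ = F x`. -/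
structure IsCylinderChart {E : Type*} [NormedAddCommGroup E] [NormedSpace ℝ E] (F : E → E)
    (X : ℝ × ℝ → E) (q Ω : ℝ → ℝ → ℝ) (σ₁ σ₂ : ℝ) : Prop where
  continuousOn : ContinuousOn X (univ ×ˢ Icc σ₁ σ₂)
  periodic : ∀ θ σ, X (θ + 2 * Real.pi, σ) = X (θ, σ)
  nhds_le : ∀ θ, ∀ σ ∈ Ioo σ₁ σ₂, 𝓝 (X (θ, σ)) ≤ map X (𝓝 (θ, σ))
  hasDerivAt : ∀ (a b : ℝ → ℝ) (t : ℝ), HasDerivAt a (Ω (a t) (b t)) t →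
    HasDerivAt b (q (a t) (b t) * Ω (a t) (b t)) t → b t ∈ Icc σ₁ σ₂ →
    HasDerivAt (fun u => X (a u, b u)) (F (X (a t, b t))) t
  angle : ∀ θ θ' σ σ', σ ∈ Icc σ₁ σ₂ → σ' ∈ Icc σ₁ σ₂ → X (θ, σ) = X (θ', σ') →
    ∃ n : ℤ, θ - θ' = n * (2 * Real.pi)

/-- Uniform continuity over one full turn is uniform continuity at all angles, because the chart is
periodic. -/
theorem IsCylinderChart.exists_dist_lt {E : Type*} [NormedAddCommGroup E] [NormedSpace ℝ E]
    {F : E → E} {X : ℝ × ℝ → E} {q Ω : ℝ → ℝ → ℝ} {σ₁ σ₂ : ℝ}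
    (hX : IsCylinderChart F X q Ω σ₁ σ₂) {ε : ℝ} (hε : 0 < ε) :
    ∃ δ > 0, ∀ θ, ∀ x ∈ Icc σ₁ σ₂, ∀ y ∈ Icc σ₁ σ₂, |x - y| < δ →
      dist (X (θ, x)) (X (θ, y)) < ε := by
  have hc : IsCompact (Icc 0 (2 * Real.pi) ×ˢ Icc σ₁ σ₂) := isCompact_Icc.prod isCompact_Icc
  have hu := hc.uniformContinuousOn_of_continuous
    (hX.continuousOn.mono (prod_mono_left (subset_univ _)))
  obtain ⟨δ, hδ, h⟩ := Metric.uniformContinuousOn_iff.1 hu ε hε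
  refine ⟨δ, hδ, fun θ x hx y hy hxy => ?_⟩
  have hp : Function.Periodic (fun θ => (X (θ, x), X (θ, y))) (2 * Real.pi) := fun θ => by
    simp [hX.periodic]
  obtain ⟨θ', hθ', he⟩ := hp.exists_mem_Ico₀ Real.two_pi_pos θ
  have he1 : X (θ, x) = X (θ', x) := congrArg Prod.fst he
  have he2 : X (θ, y) = X (θ', y) := congrArg Prod.snd he
  rw [he1, he2]
  refine h _ ⟨Ico_subset_Icc_self hθ', hx⟩ _ ⟨Ico_subset_Icc_self hθ', hy⟩ ?_
  simpa [Prod.dist_eq, Real.dist_eq] using hxy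

/-- The time at which a solution `s` passes the angle `θ`, if it starts at the angle `θ₀`. -/
noncomputable def passageTime (Ω : ℝ → ℝ → ℝ) (s : ℝ → ℝ) (θ₀ θ : ℝ) : ℝ :=
  ∫ τ in θ₀..θ, (Ω τ (s τ))⁻¹

namespace IsCylinderField

variable {q Ω : ℝ → ℝ → ℝ} {σ₁ σ₂ m L w₀ w₁ : ℝ}

theorem Ω_pos (h : IsCylinderField q Ω σ₁ σ₂ m L w₀ w₁) (θ x : ℝ) : 0 < Ω θ x :=
  h.w₀_pos.trans_le (h.Ω_bounds θ x).1

theorem continuous_solution {s : ℝ → ℝ} (hs : ∀ θ, HasDerivAt s (q θ (s θ)) θ) : Continuous s :=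
  continuous_iff_continuousAt.2 fun θ => (hs θ).continuousAt

theorem continuous_inv_Ω (h : IsCylinderField q Ω σ₁ σ₂ m L w₀ w₁) {s : ℝ → ℝ}
    (hs : Continuous s) : Continuous fun τ => (Ω τ (s τ))⁻¹ :=
  (h.Ω_continuous.comp (continuous_id.prodMk hs)).inv₀ fun _ => (h.Ω_pos _ _).ne'

theorem hasDerivAt_passageTime (h : IsCylinderField q Ω σ₁ σ₂ m L w₀ w₁) {s : ℝ → ℝ}
    (hs : Continuous s) (θ₀ θ : ℝ) :
    HasDerivAt (passageTime Ω s θ₀) (Ω θ (s θ))⁻¹ θ :=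
  intervalIntegral.integral_hasDerivAt_right ((h.continuous_inv_Ω hs).intervalIntegrable _ _)
    ((h.continuous_inv_Ω hs).stronglyMeasurableAtFilter _ _) (h.continuous_inv_Ω hs).continuousAt

theorem exists_angle (h : IsCylinderField q Ω σ₁ σ₂ m L w₀ w₁) {s : ℝ → ℝ}
    (hs : Continuous s) (θ₀ : ℝ) :
    ∃ Θ : ℝ → ℝ, (∀ t, passageTime Ω s θ₀ (Θ t) = t) ∧ (∀ θ, Θ (passageTime Ω s θ₀ θ) = θ) ∧
      StrictMono Θ ∧ ∀ t, HasDerivAt Θ (Ω (Θ t) (s (Θ t))) t :=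
  exists_inverse_of_hasDerivAt_inv (w := fun θ => Ω θ (s θ)) h.w₀_pos (fun _ => h.Ω_bounds _ _)
    (h.hasDerivAt_passageTime hs θ₀)

theorem passageTime_self (θ₀ : ℝ) (s : ℝ → ℝ) : passageTime Ω s θ₀ θ₀ = 0 := by
  simp [passageTime]

/-- The two clocks run at rates that differ by at most `L / w₀²` times the distance of the
solutions. This distance decays like `exp (-m(θ - θ₀))`, so the accumulated lag is bounded for all
angles; the factor `1/m` is the integral of the exponential. Without this bound only orbital
stability would follow. -/
theorem passageTime_sub (h : IsCylinderField q Ω σ₁ σ₂ m L w₀ w₁) {s s' : ℝ → ℝ} {θ₀ θ₁ : ℝ}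
    (hs : ∀ θ, HasDerivAt s (q θ (s θ)) θ) (hs' : ∀ θ, HasDerivAt s' (q θ (s' θ)) θ)
    (h0 : s θ₀ ∈ Icc σ₁ σ₂) (h0' : s' θ₀ ∈ Icc σ₁ σ₂) {θ : ℝ} (hθ : θ₀ ≤ θ) :
    |passageTime Ω s' θ₁ θ - passageTime Ω s θ₀ θ| ≤
      |passageTime Ω s' θ₁ θ₀| + L / (w₀ ^ 2 * m) * |s θ₀ - s' θ₀| := by
  have hsc := continuous_solution hs
  have hsc' := continuous_solution hs'
  have hd : ∀ θ, HasDerivAt (fun θ => passageTime Ω s' θ₁ θ - passageTime Ω s θ₀ θ)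
      ((Ω θ (s' θ))⁻¹ - (Ω θ (s θ))⁻¹) θ := fun θ =>
    (h.hasDerivAt_passageTime hsc' θ₁ θ).sub (h.hasDerivAt_passageTime hsc θ₀ θ)
  have hm := h.m_pos
  have hw := h.w₀_pos
  set D := |s θ₀ - s' θ₀|
  have hB : ∀ t, HasDerivAt (fun t => |passageTime Ω s' θ₁ θ₀| +
      L / (w₀ ^ 2 * m) * (D * (1 - Real.exp (-m * (t - θ₀)))))
      (L / w₀ ^ 2 * (Real.exp (-m * (t - θ₀)) * D)) t := by
    intro t
    have h1 : HasDerivAt (fun t => Real.exp (-m * (t - θ₀)))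
        (Real.exp (-m * (t - θ₀)) * (-m * 1)) t :=
      (((hasDerivAt_id t).sub_const θ₀).const_mul (-m)).exp
    refine ((((h1.const_sub 1).const_mul D).const_mul _).const_add _).congr_deriv ?_
    field_simp
  have hbound := image_norm_le_of_norm_deriv_right_le_deriv_boundary
    (f := fun θ => passageTime Ω s' θ₁ θ - passageTime Ω s θ₀ θ) (a := θ₀) (b := θ)
    (fun t _ => (hd t).continuousAt.continuousWithinAt) (fun t _ => (hd t).hasDerivWithinAt)
    (by simp [passageTime_self]) hB (fun t ht => ?_) (right_mem_Icc.2 hθ)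
  · refine (Real.norm_eq_abs _ ▸ hbound).trans ?_
    gcongr
    · have := h.L_nonneg
      positivity
    · have := Real.exp_pos (-m * (θ - θ₀))
      have hD : 0 ≤ D := abs_nonneg _
      nlinarith
  · have h1 := h.Ω_pos t (s t)
    have h2 := h.Ω_pos t (s' t)
    rw [Real.norm_eq_abs, inv_sub_inv h2.ne' h1.ne', abs_div, abs_of_pos (mul_pos h2 h1),
      div_le_iff₀ (mul_pos h2 h1)]
    have h3 := h.Ω_lipschitz t (s t) (s' t)
    have h4 := h.abs_sub_le hs hs' h0 h0' ht.1
    have h5 : w₀ ^ 2 ≤ Ω t (s' t) * Ω t (s t) := by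
      rw [sq]
      exact mul_le_mul (h.Ω_bounds _ _).1 (h.Ω_bounds _ _).1 hw.le h2.le
    have h6 : 0 ≤ L * (Real.exp (-m * (t - θ₀)) * D) := by
      have := h.L_nonneg
      positivity
    calc |Ω t (s t) - Ω t (s' t)| ≤ L * (Real.exp (-m * (t - θ₀)) * D) :=
          h3.trans (mul_le_mul_of_nonneg_left h4 h.L_nonneg)
      _ = L / w₀ ^ 2 * (Real.exp (-m * (t - θ₀)) * D) * w₀ ^ 2 := by field_simp
      _ ≤ _ := by
          refine mul_le_mul_of_nonneg_left h5 ?_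
          have := h.L_nonneg
          positivity

variable {E : Type*} [NormedAddCommGroup E] [NormedSpace ℝ E] {F : E → E} {X : ℝ × ℝ → E}

theorem hasDerivAt_chart (hX : IsCylinderChart F X q Ω σ₁ σ₂) {s Θ : ℝ → ℝ}
    (hs : ∀ θ, HasDerivAt s (q θ (s θ)) θ) (hΘ : ∀ t, HasDerivAt Θ (Ω (Θ t) (s (Θ t))) t) {t : ℝ}
    (ht : s (Θ t) ∈ Icc σ₁ σ₂) :
    HasDerivAt (fun t => X (Θ t, s (Θ t))) (F (X (Θ t, s (Θ t)))) t :=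
  hX.hasDerivAt Θ (fun t => s (Θ t)) t (hΘ t) ((hs (Θ t)).comp t (hΘ t)) ht

/-- The solution through a point of the strip. -/
theorem exists_forwardSolution (h : IsCylinderField q Ω σ₁ σ₂ m L w₀ w₁)
    (hX : IsCylinderChart F X q Ω σ₁ σ₂) (hF : LocallyLipschitz F) (θ₀ : ℝ) {x₀ : ℝ}
    (hx₀ : x₀ ∈ Icc σ₁ σ₂) :
    ∃ s Θ : ℝ → ℝ, s θ₀ = x₀ ∧ (∀ θ, HasDerivAt s (q θ (s θ)) θ) ∧
      (∀ t, passageTime Ω s θ₀ (Θ t) = t) ∧ (∀ t, 0 ≤ t → θ₀ ≤ Θ t) ∧ Tendsto Θ atTop atTop ∧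
      (∃ y, IsForwardSolution F (X (θ₀, x₀)) y) ∧
      ∀ y, IsForwardSolution F (X (θ₀, x₀)) y → ∀ t, 0 ≤ t → y t = X (Θ t, s (Θ t)) := by
  obtain ⟨s, h0, hs⟩ := h.exists_solution θ₀ x₀
  obtain ⟨Θ, h1, h2, h3, h4⟩ := h.exists_angle (continuous_solution hs) θ₀
  have hΘ0 : Θ 0 = θ₀ := by
    have := h2 θ₀
    rwa [passageTime_self] at this
  have hle : ∀ t, 0 ≤ t → θ₀ ≤ Θ t := fun t ht => hΘ0 ▸ h3.monotone ht
  have hsol : IsForwardSolution F (X (θ₀, x₀)) fun t => X (Θ t, s (Θ t)) :=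
    ⟨fun t ht => (hasDerivAt_chart hX hs h4
      (h.mem_strip hs (by rwa [h0]) (hle t ht))).hasDerivWithinAt, by simp [hΘ0, h0]⟩
  refine ⟨s, Θ, h0, hs, h1, hle, ?_, ⟨_, hsol⟩, fun y hy t ht => hy.eqOn hF hsol ht⟩
  exact h3.monotone.tendsto_atTop_atTop fun b => ⟨passageTime Ω s θ₀ b, by rw [h2]⟩

/-- The periodic solution of the cylinder equation gives a stable periodic solution. -/
theorem isStablePeriodicSolution (h : IsCylinderField q Ω σ₁ σ₂ m L w₀ w₁)
    (hX : IsCylinderChart F X q Ω σ₁ σ₂) (hF : LocallyLipschitz F) {s Θ : ℝ → ℝ}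
    (hs : ∀ θ, HasDerivAt s (q θ (s θ)) θ) (hp : ∀ θ, s (θ + 2 * Real.pi) = s θ)
    (hmem : ∀ θ, s θ ∈ Ioo σ₁ σ₂) (hΘ₁ : ∀ t, passageTime Ω s 0 (Θ t) = t)
    (hΘ₂ : ∀ θ, Θ (passageTime Ω s 0 θ) = θ) (hΘ₃ : StrictMono Θ)
    (hΘ₄ : ∀ t, HasDerivAt Θ (Ω (Θ t) (s (Θ t))) t) :
    IsStablePeriodicSolution F fun t => X (Θ t, s (Θ t)) := by
  have hsc := continuous_solution hs
  have hIcc : ∀ θ, s θ ∈ Icc σ₁ σ₂ := fun θ => Ioo_subset_Icc_self (hmem θ)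
  set φ : ℝ → E := fun t => X (Θ t, s (Θ t)) with hφ
  have hφT : ∀ θ, φ (passageTime Ω s 0 θ) = X (θ, s θ) := fun θ => by simp [hφ, hΘ₂]
  have hderiv : ∀ t, HasDerivAt φ (F (φ t)) t := fun t => hasDerivAt_chart hX hs hΘ₄ (hIcc _)
  have hφc : Continuous φ := continuous_iff_continuousAt.2 fun t => (hderiv t).continuousAt
  have hΘ0 : Θ 0 = 0 := by
    have := hΘ₂ 0
    rwa [passageTime_self] at this
  set P := passageTime Ω s 0 (2 * Real.pi) with hP
  have hΘP : Θ P = 2 * Real.pi := hΘ₂ _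
  have hPpos : 0 < P := hΘ₃.lt_iff_lt.1 (by rw [hΘ0, hΘP]; exact Real.two_pi_pos)
  -- The angular speed along the periodic solution is periodic in the angle, so every full turn
  -- takes the same time `P`.
  have hTper : ∀ θ, passageTime Ω s 0 (θ + 2 * Real.pi) = passageTime Ω s 0 θ + P := by
    have hd : ∀ θ, HasDerivAt (fun θ => passageTime Ω s 0 (θ + 2 * Real.pi) - passageTime Ω s 0 θ)
        0 θ := fun θ => by
      have h1 := (h.hasDerivAt_passageTime hsc 0 (θ + 2 * Real.pi)).comp_add_const θ (2 * Real.pi)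
      refine (h1.sub (h.hasDerivAt_passageTime hsc 0 θ)).congr_deriv ?_
      rw [hp, h.Ω_periodic, sub_self]
    intro θ
    have := is_const_of_deriv_eq_zero (fun θ => (hd θ).differentiableAt) (fun θ => (hd θ).deriv) θ 0
    simp only [passageTime_self, zero_add, sub_zero] at this
    linarith
  have hΘper : ∀ t, Θ (t + P) = Θ t + 2 * Real.pi := fun t => by
    have := hΘ₂ (Θ t + 2 * Real.pi)
    rwa [hTper, hΘ₁] at this
  have hφp : Function.Periodic φ P := fun t => by
    simp only [hφ, hΘper, hp, hX.periodic]
  have hper : IsPeriodicSolution F φ := by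
    refine ⟨hderiv, P, hPpos, hφp, fun Q hQ hQP hQp => ?_⟩
    have h1 : X (Θ Q, s (Θ Q)) = X (Θ 0, s (Θ 0)) := by simpa using hQp 0
    -- A smaller period `Q` would make `Θ Q` a multiple of `2π` strictly between 0 and `2π`.
    obtain ⟨n, hn⟩ := hX.angle _ _ _ _ (hIcc _) (hIcc _) h1
    rw [hΘ0, sub_zero] at hn
    have h2 : 0 < Θ Q := hΘ0 ▸ hΘ₃ hQ
    have h3 : Θ Q < 2 * Real.pi := hΘP ▸ hΘ₃ hQP
    have hpi := Real.two_pi_pos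
    rw [hn] at h2 h3
    have h4 : (0 : ℝ) < n := pos_of_mul_pos_left h2 hpi.le
    have h5 : (n : ℝ) < 1 := by nlinarith
    have h6 : 0 < n := by exact_mod_cast h4
    have h7 : n < 1 := by exact_mod_cast h5
    omega
  have hcompact : IsCompact (range φ) := hφp.compact_of_continuous hPpos.ne' hφc
  refine ⟨hper, fun ε hε => ?_, ?_⟩
  · -- Lyapunov stability
    obtain ⟨δ₁, hδ₁, hu⟩ : ∃ δ > 0, ∀ a b, |a - b| < δ → dist (φ a) (φ b) < ε / 2 := by
      have hu : UniformContinuousOn φ (Icc (-1) (P + 1)) :=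
        isCompact_Icc.uniformContinuousOn_of_continuous hφc.continuousOn
      obtain ⟨δ, hδ, hu⟩ := Metric.uniformContinuousOn_iff.1 hu (ε / 2) (half_pos hε)
      refine ⟨min δ 1, lt_min hδ one_pos, fun a b hab => ?_⟩
      -- Shifting `a` and `b` by the same multiple of `P` preserves their difference. With `|a - b|
      -- < 1` both then lie in `[-1, P + 1]`, where continuity is uniform.
      have hp2 : Function.Periodic (fun t => (φ t, φ (t + (b - a)))) P := fun t => by
        have := hφp (t + (b - a))
        simp only [hφp t, Prod.mk.injEq, true_and]
        rw [← this]
        ring_nf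
      obtain ⟨a', ha', he⟩ := hp2.exists_mem_Ico₀ hPpos a
      have he1 : φ a = φ a' := congrArg Prod.fst he
      have he2 : φ b = φ (a' + (b - a)) := by
        have := congrArg Prod.snd he
        simpa using this
      have hlt := abs_lt.1 (hab.trans_le (min_le_right _ _))
      rw [he1, he2]
      refine hu _ ⟨by linarith [ha'.1], by linarith [ha'.2]⟩ _
        ⟨by linarith [ha'.1], by linarith [ha'.2]⟩ ?_
      rw [Real.dist_eq]
      have := hab.trans_le (min_le_left δ 1)
      rwa [show a' - (a' + (b - a)) = a - b by ring]
    obtain ⟨δ₂, hδ₂, hx⟩ := hX.exists_dist_lt (half_pos hε)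
    set c := L / (w₀ ^ 2 * m)
    have hTc : Continuous (passageTime Ω s 0) :=
      continuous_iff_continuousAt.2 fun θ => (h.hasDerivAt_passageTime hsc 0 θ).continuousAt
    -- The initial conditions to allow: inside the strip, close to the periodic solution at the same
    -- angle, and with a small bound on the eventual time lag as given by `passageTime_sub`.
    have hW : {p : ℝ × ℝ | p.2 ∈ Ioo σ₁ σ₂ ∧ |p.2 - s p.1| < δ₂ ∧
        |passageTime Ω s 0 p.1| + c * |p.2 - s p.1| < δ₁} ∈ 𝓝 ((0 : ℝ), s 0) := by
      refine IsOpen.mem_nhds ?_ ?_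
      · refine (isOpen_Ioo.preimage continuous_snd).inter (IsOpen.inter ?_ ?_)
        · exact isOpen_lt (f := fun p : ℝ × ℝ => |p.2 - s p.1|) (by fun_prop) continuous_const
        · exact isOpen_lt (f := fun p : ℝ × ℝ => |passageTime Ω s 0 p.1| + c * |p.2 - s p.1|)
            (by fun_prop) continuous_const
      · simpa [passageTime_self, hδ₁, hδ₂] using hmem 0
    have hball : X '' _ ∈ 𝓝 (X (0, s 0)) := hX.nhds_le 0 _ (hmem 0) (image_mem_map hW)
    obtain ⟨η, hη, hsub⟩ := Metric.mem_nhds_iff.1 hball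
    refine ⟨η, hη, fun x₀ hx₀ => ?_⟩
    have hφ0 : φ 0 = X (0, s 0) := by simp [hφ, hΘ0]
    rw [hφ0] at hx₀
    obtain ⟨⟨θ₀, y₀⟩, ⟨hy₀, hy₁, hy₂⟩, rfl⟩ := hsub hx₀
    obtain ⟨r, Ψ, hr0, hr, hΨ, hΨ', -, hex, hall⟩ :=
      h.exists_forwardSolution hX hF θ₀ (Ioo_subset_Icc_self hy₀)
    refine ⟨hex, fun y hy t ht => ?_⟩
    rw [hall y hy t ht]
    have hrm : r θ₀ ∈ Icc σ₁ σ₂ := by rw [hr0]; exact Ioo_subset_Icc_self hy₀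
    have hge := hΨ' t ht
    -- The intermediate point is the one on the periodic orbit with the same angle. It differs from
    -- the solution in σ only, and from `φ t` only by the time lag.
    have h1 : dist (X (Ψ t, r (Ψ t))) (X (Ψ t, s (Ψ t))) < ε / 2 := by
      refine hx _ _ (h.mem_strip hr hrm hge) _ (hIcc _) ?_
      refine (h.abs_sub_le hr hs hrm (hIcc _) hge).trans_lt (lt_of_le_of_lt ?_ hy₁)
      rw [hr0]
      refine mul_le_of_le_one_left (abs_nonneg _) (Real.exp_le_one_iff.2 ?_)
      nlinarith [h.m_pos]
    have h2 : dist (X (Ψ t, s (Ψ t))) (φ t) < ε / 2 := by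
      rw [← hφT]
      refine hu _ _ (lt_of_le_of_lt ?_ hy₂)
      have := h.passageTime_sub (θ₁ := 0) hr hs hrm (hIcc _) hge
      rwa [hΨ, hr0] at this
    calc _ ≤ _ := dist_triangle _ _ _
      _ < ε := by linarith
  · -- orbital attraction
    have hU : ∀ p ∈ range φ, interior (X '' (univ ×ˢ Ioo σ₁ σ₂)) ∈ 𝓝 p := by
      rintro _ ⟨t, rfl⟩
      refine interior_mem_nhds.2 (hX.nhds_le _ _ (hmem (Θ t)) (image_mem_map ?_))
      exact (isOpen_univ.prod isOpen_Ioo).mem_nhds ⟨trivial, hmem _⟩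
    obtain ⟨η, hη, hsub⟩ := hcompact.exists_thickening_subset_open isOpen_interior
      fun p hp => mem_of_mem_nhds (hU p hp)
    refine ⟨η, hη, fun x₀ hx₀ => ?_⟩
    obtain ⟨⟨θ₀, y₀⟩, ⟨-, hy₀⟩, rfl⟩ := interior_subset
      (hsub ((Metric.mem_thickening_iff_infDist_lt (range_nonempty φ)).2 hx₀))
    obtain ⟨r, Ψ, hr0, hr, hΨ, hΨ', htop, hex, hall⟩ :=
      h.exists_forwardSolution hX hF θ₀ (Ioo_subset_Icc_self hy₀)
    refine ⟨hex, fun y hy => ?_⟩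
    have hrm : r θ₀ ∈ Icc σ₁ σ₂ := by rw [hr0]; exact Ioo_subset_Icc_self hy₀
    have hlim : Tendsto (fun t => Real.exp (-m * (Ψ t - θ₀)) * |r θ₀ - s θ₀|) atTop (𝓝 0) := by
      have h1 : Tendsto (fun t => -m * (Ψ t - θ₀)) atTop atBot :=
        (tendsto_atTop_add_const_right _ (-θ₀) htop).const_mul_atTop_of_neg (by linarith [h.m_pos])
      simpa using (Real.tendsto_exp_atBot.comp h1).mul_const |r θ₀ - s θ₀|
    rw [Metric.tendsto_atTop]
    intro ε hε
    obtain ⟨δ, hδ, hx⟩ := hX.exists_dist_lt hε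
    obtain ⟨N, hN⟩ := eventually_atTop.1 ((hlim.eventually (gt_mem_nhds hδ)).and
      (eventually_ge_atTop 0))
    refine ⟨N, fun t ht => ?_⟩
    obtain ⟨h1, h0⟩ := hN t ht
    rw [Real.dist_eq, sub_zero, abs_of_nonneg Metric.infDist_nonneg, hall y hy t h0]
    refine (Metric.infDist_le_dist_of_mem (s := range φ) (y := X (Ψ t, s (Ψ t))) ⟨_, hφT _⟩).trans_lt ?_
    exact hx _ _ (h.mem_strip hr hrm (hΨ' t h0)) _ (hIcc _)
      ((h.abs_sub_le hr hs hrm (hIcc _) (hΨ' t h0)).trans_lt h1)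

end IsCylinderField

/-! ### Dependence on a parameter -/

/-- The periodic solutions of a continuous family of cylinder equations form a continuous family,
in the angle as well as in the time parametrization. -/
theorem exists_continuous_periodic {Λ : Type*} [TopologicalSpace Λ] {q Ω : Λ → ℝ → ℝ → ℝ}
    {σ₁ σ₂ w₀ w₁ : ℝ} {m L : Λ → ℝ}
    (h : ∀ p, IsCylinderField (q p) (Ω p) σ₁ σ₂ (m p) (L p) w₀ w₁)
    (hq : Continuous fun x : Λ × ℝ × ℝ => q x.1 x.2.1 x.2.2)
    (hΩ : Continuous fun x : Λ × ℝ × ℝ => Ω x.1 x.2.1 x.2.2) :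
    ∃ s Θ : Λ → ℝ → ℝ, (∀ p θ, HasDerivAt (s p) (q p θ (s p θ)) θ) ∧
      (∀ p θ, s p (θ + 2 * Real.pi) = s p θ) ∧ (∀ p θ, s p θ ∈ Ioo σ₁ σ₂) ∧
      (∀ p t, passageTime (Ω p) (s p) 0 (Θ p t) = t) ∧
      (∀ p θ, Θ p (passageTime (Ω p) (s p) 0 θ) = θ) ∧ (∀ p, StrictMono (Θ p)) ∧
      (∀ p t, HasDerivAt (Θ p) (Ω p (Θ p t) (s p (Θ p t))) t) ∧
      Continuous (fun x : Λ × ℝ => (Θ x.1 x.2, s x.1 (Θ x.1 x.2))) := by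
  choose s hs hp hmem using fun p => (h p).exists_periodic
  have hsc := fun p => IsCylinderField.continuous_solution (hs p)
  choose Θ hΘ₁ hΘ₂ hΘ₃ hΘ₄ using fun p => (h p).exists_angle (hsc p) 0
  have hIcc : ∀ p θ, s p θ ∈ Icc σ₁ σ₂ := fun p θ => Ioo_subset_Icc_self (hmem p θ)
  -- The contraction rate at the fixed parameter `p₀` is the one that matters, so the rates `m p`
  -- need no uniform lower bound.
  have hunif : ∀ p₀, ∀ ε > 0, ∀ᶠ p in 𝓝 p₀, ∀ θ, |s p₀ θ - s p θ| < ε := by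
    intro p₀ ε hε
    have hK : IsCompact (Icc 0 (2 * Real.pi) ×ˢ Icc σ₁ σ₂) := isCompact_Icc.prod isCompact_Icc
    have hev : ∀ᶠ p in 𝓝 p₀, ∀ x ∈ Icc 0 (2 * Real.pi) ×ˢ Icc σ₁ σ₂,
        |q p₀ x.1 x.2 - q p x.1 x.2| < m p₀ * ε := by
      refine hK.eventually_forall_of_forall_eventually fun x _ => ?_
      have hc : Continuous fun z : Λ × ℝ × ℝ => |q p₀ z.2.1 z.2.2 - q z.1 z.2.1 z.2.2| :=
        ((hq.comp (by fun_prop : Continuous fun z : Λ × ℝ × ℝ => (p₀, z.2.1, z.2.2))).sub hq).abs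
      refine hc.continuousAt.eventually (gt_mem_nhds ?_)
      simpa using mul_pos (h p₀).m_pos hε
    filter_upwards [hev] with p hp' θ
    obtain ⟨θ', hθ', hle⟩ := (h p₀).exists_abs_sub_periodic_le (hs p₀) (hs p) (hp p₀) (hp p)
      (hIcc p₀) (hIcc p)
    have h1 := (hle θ).trans_lt (hp' (θ', s p θ') ⟨hθ', hIcc p θ'⟩)
    exact lt_of_mul_lt_mul_left h1 (h p₀).m_pos.le
  have hsj : Continuous fun x : Λ × ℝ => s x.1 x.2 := by
    rw [continuous_iff_continuousAt]
    rintro ⟨p₀, θ₀⟩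
    rw [ContinuousAt, Metric.tendsto_nhds]
    intro ε hε
    have h1 := (hunif p₀ (ε / 2) (half_pos hε)).prod_inl_nhds θ₀
    have h2 : ∀ᶠ x : Λ × ℝ in 𝓝 (p₀, θ₀), |s p₀ x.2 - s p₀ θ₀| < ε / 2 := by
      have hc : Continuous fun x : Λ × ℝ => |s p₀ x.2 - s p₀ θ₀| :=
        (((hsc p₀).comp continuous_snd).sub continuous_const).abs
      exact hc.continuousAt.eventually (gt_mem_nhds (by simpa using half_pos hε))
    filter_upwards [h1, h2] with x hx1 hx2
    rw [Real.dist_eq]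
    have := hx1 x.2
    rw [abs_lt] at *
    constructor <;> linarith
  have hT : Continuous fun x : Λ × ℝ => passageTime (Ω x.1) (s x.1) 0 x.2 := by
    refine intervalIntegral.continuous_parametric_intervalIntegral_of_continuous
      (f := fun (x : Λ × ℝ) τ => (Ω x.1 τ (s x.1 τ))⁻¹) ?_ continuous_snd
    refine Continuous.inv₀ ?_ fun x => ((h _).Ω_pos _ _).ne'
    exact hΩ.comp ((continuous_fst.comp continuous_fst).prodMk (continuous_snd.prodMk
      (hsj.comp ((continuous_fst.comp continuous_fst).prodMk continuous_snd))))
  have hlip : ∀ p x y, |Θ p x - Θ p y| ≤ w₁ * |x - y| := fun p x y => by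
    have := convex_univ.norm_image_sub_le_of_norm_hasDerivWithin_le (f := Θ p) (C := w₁)
      (fun t _ => (hΘ₄ p t).hasDerivWithinAt) (fun t _ => by
        rw [Real.norm_eq_abs, abs_of_pos ((h p).Ω_pos _ _)]
        exact ((h p).Ω_bounds _ _).2) (mem_univ y) (mem_univ x)
    simpa using this
  have hΘc : Continuous fun x : Λ × ℝ => Θ x.1 x.2 := by
    rw [continuous_iff_continuousAt]
    rintro ⟨p₀, t₀⟩
    -- The fixed angle `Θ p₀ t₀` equals `Θ p` at its own passage time. The common Lipschitz constant
    -- `w₁` thus reduces continuity of the inverse to continuity of the passage time.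
    have hb : ∀ x : Λ × ℝ, dist (Θ x.1 x.2) (Θ p₀ t₀) ≤
        w₁ * |x.2 - passageTime (Ω x.1) (s x.1) 0 (Θ p₀ t₀)| := fun x => by
      have := hlip x.1 x.2 (passageTime (Ω x.1) (s x.1) 0 (Θ p₀ t₀))
      rwa [hΘ₂] at this
    have hc : Continuous fun x : Λ × ℝ =>
        w₁ * |x.2 - passageTime (Ω x.1) (s x.1) 0 (Θ p₀ t₀)| :=
      continuous_const.mul (continuous_snd.sub (hT.comp (continuous_fst.prodMk
        continuous_const))).abs
    refine tendsto_iff_dist_tendsto_zero.2 (squeeze_zero (fun _ => dist_nonneg) hb ?_)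
    have := hc.tendsto (p₀, t₀)
    simpa [hΘ₁] using this
  exact ⟨s, Θ, hs, hp, hmem, hΘ₁, hΘ₂, hΘ₃, hΘ₄,
    hΘc.prodMk (hsj.comp (continuous_fst.prodMk hΘc))⟩

/-! ### Taylor estimates -/

section Taylor

open Asymptotics

variable {V W : Type*} [NormedAddCommGroup V] [NormedSpace ℝ V] [NormedAddCommGroup W]
  [NormedSpace ℝ W]

/-- Letting `t → 0` kills the constant coefficient; division by `t` then lowers the degree by one.
-/
theorem coeff_eq_zero_of_isBigO (m : ℕ) (c : ℕ → W)
    (h : (fun t : ℝ => ∑ k ∈ Finset.range m, t ^ k • c k) =O[𝓝[>] 0] fun t => t ^ m) :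
    ∀ k < m, c k = 0 := by
  induction m generalizing c with
  | zero => simp
  | succ m ih =>
    have hsum : ∀ t : ℝ, ∑ k ∈ Finset.range (m + 1), t ^ k • c k
        = t • (∑ k ∈ Finset.range m, t ^ k • c (k + 1)) + c 0 := fun t => by
      rw [Finset.sum_range_succ', Finset.smul_sum]
      simp [smul_smul, pow_succ']
    have hlim1 : Tendsto (fun t : ℝ => ∑ k ∈ Finset.range (m + 1), t ^ k • c k) (𝓝[>] 0) (𝓝 0) := by
      refine h.trans_tendsto (tendsto_nhdsWithin_of_tendsto_nhds ?_)
      have : Continuous fun t : ℝ => t ^ (m + 1) := by fun_prop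
      simpa using this.tendsto 0
    have hlim2 : Tendsto (fun t : ℝ => ∑ k ∈ Finset.range (m + 1), t ^ k • c k)
        (𝓝[>] 0) (𝓝 (c 0)) := by
      refine tendsto_nhdsWithin_of_tendsto_nhds ?_
      have : Continuous fun t : ℝ => ∑ k ∈ Finset.range (m + 1), t ^ k • c k := by fun_prop
      have h0 := this.tendsto 0
      simp only [hsum] at h0 ⊢
      simpa using h0
    have hc0 : c 0 = 0 := tendsto_nhds_unique hlim2 hlim1
    have h' : (fun t : ℝ => ∑ k ∈ Finset.range m, t ^ k • c (k + 1)) =O[𝓝[>] 0]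
        fun t => t ^ m := by
      obtain ⟨C, hC⟩ := h.bound
      refine IsBigO.of_bound C ?_
      filter_upwards [hC, self_mem_nhdsWithin] with t ht (hpos : 0 < t)
      rw [hsum, hc0, add_zero, norm_smul, pow_succ', norm_mul] at ht
      have : 0 < ‖t‖ := norm_pos_iff.2 hpos.ne'
      nlinarith
    intro k hk
    rcases k with _ | k
    · exact hc0
    · exact ih (fun k => c (k + 1)) h' k (by omega)

theorem exists_norm_sub_taylor_le [CompleteSpace W] {g : V → W} {n : ℕ}
    (hg : ContDiffAt ℝ (n + 1) g 0) :
    ∃ C, ∀ᶠ y in 𝓝 (0 : V), ‖g y - ∑ k ∈ Finset.range (n + 1),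
      (k.factorial : ℝ)⁻¹ • iteratedFDeriv ℝ k g 0 (fun _ => y)‖ ≤ C * ‖y‖ ^ (n + 1) := by
  have h1 : ∀ᶠ x in 𝓝 (0 : V), ContDiffAt ℝ (n + 1) g x := hg.eventually (by simp)
  have h2 : ∀ᶠ x in 𝓝 (0 : V), ‖iteratedFDeriv ℝ (n + 1) g x‖ <
      ‖iteratedFDeriv ℝ (n + 1) g 0‖ + 1 := by
    have hc : ContinuousAt (iteratedFDeriv ℝ (n + 1) g) 0 :=
      (hg.iteratedFDeriv_right (i := n + 1) (m := 0) (by simp)).continuousAt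
    exact hc.norm.eventually (gt_mem_nhds (by linarith))
  obtain ⟨r, hr, hball⟩ := Metric.eventually_nhds_iff_ball.1 (h1.and h2)
  set B := ‖iteratedFDeriv ℝ (n + 1) g 0‖ + 1
  refine ⟨(n.factorial : ℝ)⁻¹ * B, ?_⟩
  filter_upwards [Metric.ball_mem_nhds (0 : V) hr] with y hy
  have hty : ∀ t ∈ Icc (0 : ℝ) 1, (0 : V) + t • y ∈ Metric.ball (0 : V) r := fun t ht => by
    rw [zero_add, mem_ball_zero_iff, norm_smul, Real.norm_eq_abs, abs_of_nonneg ht.1]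
    rw [mem_ball_zero_iff] at hy
    exact (mul_le_of_le_one_left (norm_nonneg _) ht.2).trans_lt hy
  have htaylor := map_add_eq_sum_add_integral_iteratedFDeriv (f := g) (x := 0) (y := y) (n := n)
    fun t ht => (hball _ (hty t ht)).1
  rw [zero_add] at htaylor
  rw [htaylor, add_sub_cancel_left, norm_smul, Real.norm_eq_abs, abs_of_nonneg (by positivity),
    mul_assoc]
  refine mul_le_mul_of_nonneg_left ?_ (by positivity)
  have := intervalIntegral.norm_integral_le_of_norm_le_const (a := (0 : ℝ)) (b := 1)
    (C := B * ‖y‖ ^ (n + 1))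
    (f := fun t => (1 - t) ^ n • iteratedFDeriv ℝ (n + 1) g (0 + t • y) fun _ => y) fun t ht => ?_
  · simpa using this
  · rw [uIoc_of_le zero_le_one] at ht
    rw [norm_smul, Real.norm_eq_abs, abs_pow, abs_of_nonneg (by linarith [ht.2])]
    have h3 := (iteratedFDeriv ℝ (n + 1) g (0 + t • y)).le_opNorm fun _ => y
    simp only [Finset.prod_const, Finset.card_univ, Fintype.card_fin] at h3
    have h4 := (hball _ (hty t ⟨ht.1.le, ht.2⟩)).2
    have h5 : (1 - t) ^ n ≤ 1 := pow_le_one₀ (by linarith [ht.2]) (by linarith [ht.1])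
    calc _ ≤ 1 * ‖iteratedFDeriv ℝ (n + 1) g (0 + t • y) fun _ => y‖ :=
          mul_le_mul_of_nonneg_right h5 (norm_nonneg _)
      _ ≤ _ := by
          rw [one_mul]
          exact h3.trans (mul_le_mul_of_nonneg_right h4.le (by positivity))

/-- The radial derivative of a smooth function that is `O(‖z‖ ^ m)` is `O(‖z‖ ^ m)`. -/
theorem isBigO_fderiv_apply_self [CompleteSpace W] {f : V → W} {n : ℕ}
    (hf : ContDiffAt ℝ (n + 2) f 0) (hO : f =O[𝓝 0] fun z => ‖z‖ ^ (n + 2)) :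
    (fun z => fderiv ℝ f z z) =O[𝓝 0] fun z => ‖z‖ ^ (n + 2) := by
  -- Along each ray the Taylor polynomial of degree `n + 1` is itself `O(t ^ (n + 2))`, so all its
  -- coefficients vanish.
  have hzero : ∀ y : V, ∀ k < n + 2, iteratedFDeriv ℝ k f 0 (fun _ => y) = 0 := by
    intro y
    obtain ⟨C, hC⟩ := exists_norm_sub_taylor_le (g := f) (n := n + 1)
      (by exact_mod_cast hf)
    have hty : Tendsto (fun t : ℝ => t • y) (𝓝[>] 0) (𝓝 0) := by
      refine tendsto_nhdsWithin_of_tendsto_nhds ?_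
      have : Continuous fun t : ℝ => t • y := by fun_prop
      simpa using this.tendsto 0
    have hnorm : (fun t : ℝ => ‖t • y‖ ^ (n + 2)) =O[𝓝[>] 0] fun t => t ^ (n + 2) := by
      refine IsBigO.of_bound (‖y‖ ^ (n + 2)) (Eventually.of_forall fun t => ?_)
      rw [norm_smul, mul_pow, norm_mul, norm_pow, norm_pow, norm_pow, norm_norm, norm_norm, mul_comm]
    have h1 := (hO.comp_tendsto hty).trans hnorm
    have h2 : (fun t : ℝ => f (t • y) - ∑ k ∈ Finset.range (n + 2),
        (k.factorial : ℝ)⁻¹ • iteratedFDeriv ℝ k f 0 (fun _ => t • y)) =O[𝓝[>] 0]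
        fun t => t ^ (n + 2) := by
      refine IsBigO.trans (IsBigO.of_bound C ?_) hnorm
      filter_upwards [hty.eventually hC] with t ht
      rw [norm_pow, norm_norm]
      exact ht
    have h3 := h1.sub h2
    have h4 := coeff_eq_zero_of_isBigO (n + 2)
      (fun k => (k.factorial : ℝ)⁻¹ • iteratedFDeriv ℝ k f 0 (fun _ => y)) (by
        refine h3.congr_left fun t => ?_
        simp only [Function.comp_apply, sub_sub_cancel]
        refine Finset.sum_congr rfl fun k _ => ?_
        rw [(iteratedFDeriv ℝ k f 0).map_smul_univ (fun _ => t) (fun _ => y)]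
        simp [smul_smul, mul_comm])
    intro k hk
    have := h4 k hk
    rw [smul_eq_zero] at this
    exact this.resolve_left (inv_ne_zero (by exact_mod_cast k.factorial_ne_zero))
  -- The derivative is expanded one order less; its application to `y` restores the missing factor
  -- `‖y‖`. The Taylor terms of the derivative, applied to `y`, are multiples of the diagonal
  -- derivatives of `f` that vanish by `hzero`.
  obtain ⟨C, hC⟩ := exists_norm_sub_taylor_le (g := fderiv ℝ f) (n := n)
    (hf.fderiv_right (by norm_num [add_assoc]))
  refine IsBigO.of_bound C ?_
  filter_upwards [hC] with y hy
  have h1 := ContinuousLinearMap.le_of_opNorm_le _ hy y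
  have h2 : (∑ k ∈ Finset.range (n + 1), (k.factorial : ℝ)⁻¹ •
      iteratedFDeriv ℝ k (fderiv ℝ f) 0 (fun _ => y)) y = 0 := by
    rw [sum_apply]
    refine Finset.sum_eq_zero fun k hk => ?_
    have h3 := hzero y (k + 1) (by have := Finset.mem_range.1 hk; omega)
    rw [iteratedFDeriv_succ_apply_right] at h3
    rw [smul_apply]
    have h4 : iteratedFDeriv ℝ k (fderiv ℝ f) 0 (fun _ => y) y = 0 := h3
    rw [h4, smul_zero]
  rw [sub_apply, h2, sub_zero] at h1
  rw [norm_pow, norm_norm]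
  calc _ ≤ _ := h1
    _ = _ := by ring

/-- A mixed second difference of a `C²` function is bounded by the product of the increments. -/
theorem exists_norm_mixed_difference_le {H : V × ℝ → W} (hH : ContDiffAt ℝ 2 H 0) :
    ∃ K, 0 ≤ K ∧ ∀ᶠ p in 𝓝 (0 : V × ℝ),
      ‖H p - H (0, p.2) - (H (p.1, 0) - H 0)‖ ≤ K * |p.2| * ‖p.1‖ := by
  have h1 : ContDiffAt ℝ 1 (fderiv ℝ H) 0 := hH.fderiv_right (by norm_num)
  obtain ⟨K, U, hU, hK⟩ := h1.exists_lipschitzOnWith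
  have h2 : ∀ᶠ p in 𝓝 (0 : V × ℝ), ContDiffAt ℝ 2 H p := hH.eventually (by simp)
  obtain ⟨r, hr, hball⟩ := Metric.eventually_nhds_iff_ball.1 (h2.and hU)
  refine ⟨K, K.2, ?_⟩
  filter_upwards [Metric.ball_mem_nhds (0 : V × ℝ) hr] with p hp
  have hp1 : ‖p.1‖ < r := (norm_fst_le p).trans_lt (mem_ball_zero_iff.1 hp)
  have hp2 : ‖p.2‖ < r := (norm_snd_le p).trans_lt (mem_ball_zero_iff.1 hp)
  have hmem : ∀ z ∈ Metric.ball (0 : V) r, ∀ a : ℝ, ‖a‖ < r → (z, a) ∈ Metric.ball (0 : V × ℝ) r :=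
    fun z hz a ha => by
      rw [mem_ball_zero_iff] at *
      exact Prod.norm_mk z a ▸ max_lt hz ha
  have hsl : ∀ z ∈ Metric.ball (0 : V) r, ∀ a : ℝ, ‖a‖ < r →
      HasFDerivAt (fun z => H (z, a)) ((fderiv ℝ H (z, a)).comp (.inl ℝ V ℝ)) z := fun z hz a ha =>
    ((hball _ (hmem z hz a ha)).1.differentiableAt (by simp)).hasFDerivAt.comp z
      (hasFDerivAt_prodMk_left z a)
  -- The mean value inequality is applied to the difference of two parameter slices. Its derivative
  -- is small by the Lipschitz bound for `fderiv ℝ H` in the parameter.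
  have key := (convex_ball (0 : V) r).norm_image_sub_le_of_norm_hasFDerivWithin_le
    (f := fun z => H (z, p.2) - H (z, 0)) (C := K * |p.2|)
    (fun z hz => ((hsl z hz p.2 hp2).sub (hsl z hz 0 (by simpa using hr))).hasFDerivWithinAt)
    (fun z hz => ?_) (Metric.mem_ball_self hr) (mem_ball_zero_iff.2 hp1)
  · simp only [sub_zero] at key
    convert key using 2
    simp only [Prod.mk.eta, ← Prod.zero_eq_mk]
    abel
  · rw [← ContinuousLinearMap.sub_comp]
    refine (ContinuousLinearMap.opNorm_comp_le _ _).trans ?_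
    have h3 := hK.dist_le_mul _ (hball _ (hmem z hz p.2 hp2)).2 _
      (hball _ (hmem z hz 0 (by simpa using hr))).2
    rw [dist_eq_norm] at h3
    have h4 : dist (z, p.2) (z, (0 : ℝ)) = |p.2| := by simp [Prod.dist_eq]
    rw [h4] at h3
    calc _ ≤ K * |p.2| * 1 := mul_le_mul h3 (ContinuousLinearMap.norm_inl_le_one ℝ V ℝ)
          (norm_nonneg _) (by positivity)
      _ = _ := mul_one _

/-- The `z`-derivative at the origin of a function of `(z, α)`. -/
noncomputable def sliceDeriv (G : V × ℝ → W) (p : V × ℝ) : V →L[ℝ] W :=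
  (fderiv ℝ G p).comp (.inl ℝ V ℝ)

theorem contDiffAt_sliceDeriv {G : V × ℝ → W} {p : V × ℝ} (hG : ContDiffAt ℝ ∞ G p) :
    ContDiffAt ℝ ∞ (sliceDeriv G) p :=
  (hG.fderiv_right (m := ∞) (by simp)).clm_comp contDiffAt_const

theorem hasFDerivAt_slice {G : V × ℝ → W} {z : V} {a : ℝ} (hG : DifferentiableAt ℝ G (z, a)) :
    HasFDerivAt (fun z => G (z, a)) (sliceDeriv G (z, a)) z :=
  hG.hasFDerivAt.comp z (hasFDerivAt_prodMk_left z a)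

/-- Up to an error `O(|α| ‖z‖²)`, a family of maps that fix the origin depends on the parameter only
through its linear part. -/
theorem exists_norm_sub_linear_part_le {G : V × ℝ → W} (hG : ContDiffAt ℝ ∞ G 0)
    (h0 : ∀ᶠ α in 𝓝 (0 : ℝ), G (0, α) = 0) :
    ∃ K, 0 ≤ K ∧ ∀ᶠ p in 𝓝 (0 : V × ℝ),
      ‖sliceDeriv G p p.1 - sliceDeriv G (0, p.2) p.1 -
        (sliceDeriv G (p.1, 0) p.1 - sliceDeriv G 0 p.1)‖ ≤ K * |p.2| * ‖p.1‖ ^ 2 ∧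
      ‖G p - sliceDeriv G (0, p.2) p.1 - (G (p.1, 0) - sliceDeriv G 0 p.1)‖ ≤
        K * |p.2| * ‖p.1‖ ^ 2 := by
  obtain ⟨K, hK0, hK⟩ := exists_norm_mixed_difference_le (H := sliceDeriv G)
    ((contDiffAt_sliceDeriv hG).of_le ENat.LEInfty.out)
  have h2 : ∀ᶠ p in 𝓝 (0 : V × ℝ), ContDiffAt ℝ 2 G p :=
    (hG.of_le (m := 2) ENat.LEInfty.out).eventually (by simp)
  have h3 : ∀ᶠ p in 𝓝 (0 : V × ℝ), G (0, p.2) = 0 :=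
    (continuous_snd.tendsto (0 : V × ℝ)).eventually h0
  obtain ⟨r, hr, hball⟩ := Metric.eventually_nhds_iff_ball.1 ((hK.and h2).and h3)
  refine ⟨K, hK0, ?_⟩
  filter_upwards [Metric.ball_mem_nhds (0 : V × ℝ) hr] with p hp
  have hp1 : ‖p.1‖ < r := (norm_fst_le p).trans_lt (mem_ball_zero_iff.1 hp)
  have hp2 : ‖p.2‖ < r := (norm_snd_le p).trans_lt (mem_ball_zero_iff.1 hp)
  have hmem : ∀ z : V, ‖z‖ < r → ∀ a : ℝ, ‖a‖ < r → (z, a) ∈ Metric.ball (0 : V × ℝ) r :=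
    fun z hz a ha => mem_ball_zero_iff.2 (Prod.norm_mk z a ▸ max_lt hz ha)
  constructor
  · have h4 := ContinuousLinearMap.le_of_opNorm_le _ (hball p hp).1.1 p.1
    simp only [sub_apply] at h4
    calc _ ≤ _ := h4
      _ = _ := by ring
  · have hd : ∀ z : V, ‖z‖ < r → ∀ a : ℝ, ‖a‖ < r →
        HasFDerivAt (fun z => G (z, a)) (sliceDeriv G (z, a)) z := fun z hz a ha =>
      hasFDerivAt_slice ((hball _ (hmem z hz a ha)).1.2.differentiableAt (by simp))
    -- The derivative of this function is the mixed difference of `sliceDeriv G`, already bounded by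
    -- `K |α| ‖z‖`; the mean value inequality gains the second factor `‖z‖`.
    have key := (convex_closedBall (0 : V) ‖p.1‖).norm_image_sub_le_of_norm_hasFDerivWithin_le
      (f := fun z => G (z, p.2) - sliceDeriv G (0, p.2) z - (G (z, 0) - sliceDeriv G 0 z))
      (C := K * |p.2| * ‖p.1‖) (fun z hz => by
        have hz' : ‖z‖ < r := (mem_closedBall_zero_iff.1 hz).trans_lt hp1
        exact (((hd z hz' p.2 hp2).sub (sliceDeriv G (0, p.2)).hasFDerivAt).sub
          ((hd z hz' 0 (by simpa using hr)).sub (sliceDeriv G 0).hasFDerivAt)).hasFDerivWithinAt)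
      (fun z hz => by
        have hz2 := mem_closedBall_zero_iff.1 hz
        have hz' : ‖z‖ < r := hz2.trans_lt hp1
        exact (hball _ (hmem z hz' p.2 hp2)).1.1.trans
          (mul_le_mul_of_nonneg_left hz2 (by positivity)))
      (Metric.mem_closedBall_self (norm_nonneg _)) (mem_closedBall_zero_iff.2 le_rfl)
    have h5 : G (0, p.2) = 0 := (hball p hp).2
    have h6 : G (0, 0) = 0 := (hball 0 (Metric.mem_ball_self hr)).2
    simp only [h5, h6, map_zero, sub_zero] at key
    calc _ ≤ _ := key
      _ = _ := by ring

end Taylor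

/-! ### Expansion of a perturbed normal form -/

section NormalForm

open Asymptotics

/-- The nonlinear part `∑ w j C_j z^{j+1} z̄^j` of a normal form, with weights `w`. -/
noncomputable def resonantSum (k : ℕ) (w : ℕ → ℝ) (C : ℕ → ℂ) (z : ℂ) : ℂ :=
  ∑ j ∈ Finset.Icc 1 k, (w j : ℂ) * (C j * z ^ (j + 1) * (starRingEnd ℂ z) ^ j)

theorem contDiff_normalFormField (μ₀ : ℝ) (k : ℕ) (C : ℕ → ℂ) :
    ContDiff ℝ ∞ (normalFormField μ₀ k C) := by
  have hstar : ContDiff ℝ ∞ fun z : ℂ => starRingEnd ℂ z := Complex.conjCLE.contDiff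
  unfold normalFormField
  refine (contDiff_const.mul contDiff_id).add (ContDiff.sum fun j _ => ?_)
  exact (contDiff_const.mul (contDiff_id.pow _)).mul (hstar.pow _)

/-- On the ray through `z` each resonant monomial is a power `t ^ (2j+1)`. The value `t = 1` gives
Euler's identity, and `t = 0` gives the linear part. -/
theorem fderiv_normalFormField_smul_apply (μ₀ : ℝ) (k : ℕ) (C : ℕ → ℂ) (z : ℂ) (t : ℝ) :
    fderiv ℝ (normalFormField μ₀ k C) (t • z) z = Complex.I * μ₀ * z +
      ∑ j ∈ Finset.Icc 1 k, ((2 * j + 1 : ℕ) : ℂ) * (t : ℂ) ^ (2 * j) *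
        (C j * z ^ (j + 1) * (starRingEnd ℂ z) ^ j) := by
  have hd : HasDerivAt (fun t : ℝ => normalFormField μ₀ k C (t • z))
      (fderiv ℝ (normalFormField μ₀ k C) (t • z) z) t := by
    have h1 : HasFDerivAt (normalFormField μ₀ k C) (fderiv ℝ (normalFormField μ₀ k C) (t • z))
        (t • z) :=
      ((contDiff_normalFormField μ₀ k C).differentiable (by simp)).differentiableAt.hasFDerivAt
    have h2 : HasDerivAt (fun t : ℝ => t • z) z t := by
      simpa using (hasDerivAt_id t).smul_const z
    exact h1.comp_hasDerivAt t h2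
  have he : ∀ t : ℝ, normalFormField μ₀ k C (t • z) = (t : ℂ) * (Complex.I * μ₀ * z) +
      ∑ j ∈ Finset.Icc 1 k, (t : ℂ) ^ (2 * j + 1) * (C j * z ^ (j + 1) * (starRingEnd ℂ z) ^ j) := by
    intro t
    unfold normalFormField
    congr 1
    · simp only [Complex.real_smul]; ring
    · refine Finset.sum_congr rfl fun j _ => ?_
      simp only [Complex.real_smul, map_mul, Complex.conj_ofReal]
      ring
  have hid : HasDerivAt (fun t : ℝ => (t : ℂ)) 1 t := Complex.ofRealCLM.hasDerivAt
  have hd2 := (hid.mul_const (Complex.I * μ₀ * z)).add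
    (HasDerivAt.fun_sum (u := Finset.Icc 1 k) fun j _ =>
      (hid.pow (2 * j + 1)).mul_const (C j * z ^ (j + 1) * (starRingEnd ℂ z) ^ j))
  rw [hd.unique (hd2.congr_of_eventuallyEq (Eventually.of_forall he))]
  simp

theorem fderiv_normalFormField_apply_self (μ₀ : ℝ) (k : ℕ) (C : ℕ → ℂ) (z : ℂ) :
    fderiv ℝ (normalFormField μ₀ k C) z z =
      normalFormField μ₀ k C z + resonantSum k (fun j => 2 * j) C z := by
  have h := fderiv_normalFormField_smul_apply μ₀ k C z 1
  rw [one_smul] at h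
  rw [h, normalFormField, resonantSum, add_assoc, ← Finset.sum_add_distrib]
  congr 1
  refine Finset.sum_congr rfl fun j _ => ?_
  push_cast
  ring

theorem fderiv_normalFormField_zero_apply (μ₀ : ℝ) (k : ℕ) (C : ℕ → ℂ) (z : ℂ) :
    fderiv ℝ (normalFormField μ₀ k C) 0 z = Complex.I * μ₀ * z := by
  have h := fderiv_normalFormField_smul_apply μ₀ k C z 0
  rw [zero_smul] at h
  rw [h, add_eq_left]
  refine Finset.sum_eq_zero fun j hj => ?_
  have := (Finset.mem_Icc.1 hj).1
  simp [show j ≠ 0 by omega]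

/-- The expansion of a perturbation of a normal form and of its radial derivative. -/
theorem exists_norm_sub_normalForm_le {G : ℂ × ℝ → ℂ} {μ₀ : ℝ} {k : ℕ} {C : ℕ → ℂ}
    (hG : ContDiffAt ℝ ∞ G 0) (h0 : ∀ᶠ α in 𝓝 (0 : ℝ), G (0, α) = 0)
    (hN : (fun z => G (z, 0) - normalFormField μ₀ k C z) =O[𝓝 0] fun z => ‖z‖ ^ (2 * k + 3)) :
    (∀ z, sliceDeriv G 0 z = Complex.I * μ₀ * z) ∧
    ∃ K, 0 ≤ K ∧ ∀ᶠ p in 𝓝 (0 : ℂ × ℝ),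
      ‖G p - (sliceDeriv G (0, p.2) p.1 + resonantSum k 1 C p.1)‖ ≤
        K * (|p.2| * ‖p.1‖ ^ 2 + ‖p.1‖ ^ (2 * k + 3)) ∧
      ‖sliceDeriv G p p.1 - G p - resonantSum k (fun j => 2 * j) C p.1‖ ≤
        K * (|p.2| * ‖p.1‖ ^ 2 + ‖p.1‖ ^ (2 * k + 3)) := by
  have hinl : ContDiffAt ℝ ∞ (fun z : ℂ => (z, (0 : ℝ))) 0 := by fun_prop
  have hG0 : ContDiffAt ℝ ∞ (fun z : ℂ => G (z, 0)) 0 := ContDiffAt.comp (0 : ℂ) hG hinl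
  have hNs := contDiff_normalFormField μ₀ k C
  have hE : ContDiffAt ℝ ∞ (fun z => G (z, 0) - normalFormField μ₀ k C z) 0 :=
    hG0.sub hNs.contDiffAt
  have hEd := isBigO_fderiv_apply_self (n := 2 * k + 1) (hE.of_le
    (by exact_mod_cast (ENat.LEInfty.out : ((2 * k + 1 + 2 : ℕ) : WithTop ℕ∞) ≤ ∞))) hN
  have hdG : ∀ᶠ p in 𝓝 (0 : ℂ × ℝ), ContDiffAt ℝ 1 G p :=
    (hG.of_le (m := 1) ENat.LEInfty.out).eventually (by simp)
  have hdG0 : ∀ᶠ z in 𝓝 (0 : ℂ), DifferentiableAt ℝ G (z, 0) := by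
    have : Tendsto (fun z : ℂ => (z, (0 : ℝ))) (𝓝 0) (𝓝 0) := hinl.continuousAt
    exact (this.eventually hdG).mono fun z hz => hz.differentiableAt (by simp)
  have hEf : ∀ᶠ z in 𝓝 (0 : ℂ), fderiv ℝ (fun z => G (z, 0) - normalFormField μ₀ k C z) z z =
      sliceDeriv G (z, 0) z - (normalFormField μ₀ k C z + resonantSum k (fun j => 2 * j) C z) := by
    filter_upwards [hdG0] with z hz
    have h1 := (hasFDerivAt_slice hz).sub
      ((hNs.differentiable (by simp)).differentiableAt (x := z)).hasFDerivAt
    have h2 := h1.fderiv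
    rw [← fderiv_normalFormField_apply_self, ← sub_apply, ← h2]
    rfl
  have hlin : ∀ z, sliceDeriv G 0 z = Complex.I * μ₀ * z := by
    -- The remainder has order greater than one, so it does not contribute to the derivative at the
    -- origin.
    have hE0 : HasFDerivAt (fun z => G (z, 0) - normalFormField μ₀ k C z) (0 : ℂ →L[ℝ] ℂ) 0 :=
      IsBigO.hasFDerivAt (n := 2 * k + 3) (by simpa using hN) (by omega)
    have h1 := (hasFDerivAt_slice hdG0.self_of_nhds).sub
      ((hNs.differentiable (by simp)).differentiableAt (x := (0 : ℂ))).hasFDerivAt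
    intro z
    rw [← fderiv_normalFormField_zero_apply μ₀ k C z, ← sub_eq_zero, ← sub_apply]
    exact congrArg (fun l : ℂ →L[ℝ] ℂ => l z) (h1.unique hE0)
  refine ⟨hlin, ?_⟩
  obtain ⟨K₁, hK₁, h1⟩ := exists_norm_sub_linear_part_le hG h0
  obtain ⟨K₂, h2⟩ := hN.bound
  obtain ⟨K₃, h3⟩ := hEd.bound
  have hfst : Tendsto (fun p : ℂ × ℝ => p.1) (𝓝 0) (𝓝 0) := continuous_fst.tendsto _
  refine ⟨K₁ + |K₂| + K₁ + |K₂| + |K₃|, by positivity, ?_⟩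
  filter_upwards [h1, hfst.eventually h2, hfst.eventually h3, hfst.eventually hEf]
    with p hp1 hp2 hp3 hp4
  rw [hp4, norm_pow, norm_norm] at hp3
  rw [norm_pow, norm_norm] at hp2
  have hNz : normalFormField μ₀ k C p.1 = sliceDeriv G 0 p.1 + resonantSum k 1 C p.1 := by
    rw [hlin, normalFormField, resonantSum]
    simp
  have hu : 0 ≤ |p.2| * ‖p.1‖ ^ 2 := by positivity
  have hv : 0 ≤ ‖p.1‖ ^ (2 * k + 3) := by positivity
  have hp2' := hp2.trans (mul_le_mul_of_nonneg_right (le_abs_self K₂) hv)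
  have hp3' := hp3.trans (mul_le_mul_of_nonneg_right (le_abs_self K₃) hv)
  have hK₂ := abs_nonneg K₂
  have hK₃ := abs_nonneg K₃
  constructor
  · have he : G p - (sliceDeriv G (0, p.2) p.1 + resonantSum k 1 C p.1) =
        (G p - sliceDeriv G (0, p.2) p.1 - (G (p.1, 0) - sliceDeriv G 0 p.1)) +
          (G (p.1, 0) - normalFormField μ₀ k C p.1) := by
      rw [hNz]; ring
    rw [he]
    refine (norm_add_le_of_le hp1.2 hp2').trans ?_
    nlinarith
  · have he : sliceDeriv G p p.1 - G p - resonantSum k (fun j => 2 * j) C p.1 =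
        (sliceDeriv G p p.1 - sliceDeriv G (0, p.2) p.1 -
          (sliceDeriv G (p.1, 0) p.1 - sliceDeriv G 0 p.1)) -
        (G p - sliceDeriv G (0, p.2) p.1 - (G (p.1, 0) - sliceDeriv G 0 p.1)) +
        ((sliceDeriv G (p.1, 0) p.1 -
          (normalFormField μ₀ k C p.1 + resonantSum k (fun j => 2 * j) C p.1)) -
        (G (p.1, 0) - normalFormField μ₀ k C p.1)) := by
      ring
    rw [he]
    refine (norm_add_le_of_le (norm_sub_le_of_le hp1.1 hp1.2)
      (norm_sub_le_of_le hp3' hp2')).trans ?_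
    nlinarith

end NormalForm

/-! ### Scaled polar coordinates -/

section Scaling

open Asymptotics

/-- `G` is a smooth family of planar vector fields that fixes the origin, is in Poincaré–Birkhoff
normal form of order `k` for `α = 0`, and has the trace `2 A(α)` at the origin. -/
structure HopfNormalForm (G : ℂ × ℝ → ℂ) (μ₀ : ℝ) (k : ℕ) (C : ℕ → ℂ) (A : ℝ → ℝ) (A' : ℝ) :
    Prop where
  contDiffAt : ContDiffAt ℝ ∞ G 0
  map_zero : ∀ᶠ α in 𝓝 (0 : ℝ), G (0, α) = 0
  isBigO : (fun z => G (z, 0) - normalFormField μ₀ k C z) =O[𝓝 0] fun z => ‖z‖ ^ (2 * k + 3)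
  μ₀_pos : 0 < μ₀
  one_le : 1 ≤ k
  re_eq_zero : ∀ j, 1 ≤ j → j < k → (C j).re = 0
  re_neg : (C k).re < 0
  trace : ∀ᶠ α in 𝓝 (0 : ℝ),
    (sliceDeriv G (0, α) 1).re + (sliceDeriv G (0, α) Complex.I).im = 2 * A α
  hasDerivAt : HasDerivAt A A' 0
  ne_zero : A' ≠ 0

/-- The complex-linear part of a real-linear map of the complex plane. -/
noncomputable def linPart (l : ℂ →L[ℝ] ℂ) : ℂ := (l 1 - Complex.I * l Complex.I) / 2

/-- The antilinear part of a real-linear map of the complex plane. -/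
noncomputable def antiPart (l : ℂ →L[ℝ] ℂ) : ℂ := (l 1 + Complex.I * l Complex.I) / 2

theorem apply_eq_linPart_add_antiPart (l : ℂ →L[ℝ] ℂ) (z : ℂ) :
    l z = linPart l * z + antiPart l * starRingEnd ℂ z := by
  have h : l z = z.re * l 1 + z.im * l Complex.I := by
    conv_lhs => rw [show z = z.re • (1 : ℂ) + z.im • Complex.I by
      simp [Complex.re_add_im]]
    rw [map_add, map_smul, map_smul, Complex.real_smul, Complex.real_smul]
  have h1 : starRingEnd ℂ z = z.re - z.im * Complex.I := by
    apply Complex.ext <;> simp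
  have h2 : z = z.re + z.im * Complex.I := (Complex.re_add_im z).symm
  rw [h, h1, linPart, antiPart]
  linear_combination (-(l 1 - Complex.I * l Complex.I) / 2) * h2 +
    z.im * l Complex.I * Complex.I_sq

/-- The mean radial growth rate of a linear planar field is half its trace; this is how `A(α)`
enters. -/
theorem linPart_re (l : ℂ →L[ℝ] ℂ) : (linPart l).re = ((l 1).re + (l Complex.I).im) / 2 := by
  rw [linPart, show (2 : ℂ) = (2 : ℝ) by norm_num, Complex.div_ofReal_re]
  simp

/-- Since `z^{j+1} z̄^j = z |z|^{2j}`, the resonant terms contribute to `ż / z` only through the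
radius. -/
theorem resonantSum_eq (k : ℕ) (w : ℕ → ℝ) (C : ℕ → ℂ) (z : ℂ) :
    resonantSum k w C z = z * ∑ j ∈ Finset.Icc 1 k, (w j : ℂ) * C j * ((‖z‖ ^ (2 * j) : ℝ) : ℂ) := by
  rw [resonantSum, Finset.mul_sum]
  refine Finset.sum_congr rfl fun j _ => ?_
  have : ((‖z‖ ^ (2 * j) : ℝ) : ℂ) = (z * starRingEnd ℂ z) ^ j := by
    rw [Complex.mul_conj', ← pow_mul]
    push_cast
    rfl
  rw [this]
  ring

/-- The oscillating part of the radial growth rate of a linear vector field with antilinear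
part `b`. -/
noncomputable def oscillation (b : ℂ) (θ : ℝ) : ℝ := (b * Complex.exp (-(2 * θ * Complex.I))).re

/-- An antiderivative of the oscillation, divided by the angular speed `μ₀`. -/
noncomputable def shear (μ₀ : ℝ) (b : ℂ) (θ : ℝ) : ℝ :=
  (b * Complex.exp (-(2 * θ * Complex.I)) * Complex.I).re / (2 * μ₀)

/-- Scaled polar coordinates, corrected by the shear. -/
noncomputable def polar (μ₀ : ℝ) (b : ℂ) (ε θ σ : ℝ) : ℂ :=
  (ε * Real.exp (σ + shear μ₀ b θ) : ℝ) * Complex.exp (θ * Complex.I)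

theorem hasDerivAt_exp_neg_two_mul (θ : ℝ) :
    HasDerivAt (fun θ : ℝ => Complex.exp (-(2 * θ * Complex.I)))
      (Complex.exp (-(2 * θ * Complex.I)) * (-(2 * Complex.I))) θ := by
  have hid : HasDerivAt (fun t : ℝ => (t : ℂ)) 1 θ := Complex.ofRealCLM.hasDerivAt
  have := (((hid.const_mul 2).mul_const Complex.I).neg).cexp
  simpa using this

theorem hasDerivAt_shear (μ₀ : ℝ) (b : ℂ) (θ : ℝ) :
    HasDerivAt (shear μ₀ b) (oscillation b θ / μ₀) θ := by
  have h := ((hasDerivAt_exp_neg_two_mul θ).const_mul b).mul_const Complex.I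
  have h2 := (Complex.reCLM.hasFDerivAt.comp_hasDerivAt θ h).div_const (2 * μ₀)
  refine h2.congr_deriv ?_
  have : b * (Complex.exp (-(2 * θ * Complex.I)) * -(2 * Complex.I)) * Complex.I =
      (2 : ℝ) * (b * Complex.exp (-(2 * θ * Complex.I))) := by
    push_cast
    linear_combination (-2 * b * Complex.exp (-(2 * θ * Complex.I))) * Complex.I_sq
  rw [Complex.reCLM_apply, this, Complex.re_ofReal_mul, oscillation, mul_div_mul_left _ _ two_ne_zero]

theorem exp_neg_two_mul_add_two_pi (θ : ℝ) :
    Complex.exp (-(2 * (θ + 2 * Real.pi : ℝ) * Complex.I)) = Complex.exp (-(2 * θ * Complex.I)) := by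
  have := Complex.exp_periodic.sub_nat_mul_eq (x := -(2 * θ * Complex.I)) 2
  rw [← this]
  congr 1
  push_cast
  ring

theorem norm_exp_neg_two_mul (θ : ℝ) : ‖Complex.exp (-(2 * θ * Complex.I))‖ = 1 := by
  rw [Complex.norm_exp]
  simp

theorem oscillation_add_two_pi (b : ℂ) (θ : ℝ) :
    oscillation b (θ + 2 * Real.pi) = oscillation b θ := by
  rw [oscillation, oscillation, exp_neg_two_mul_add_two_pi]

theorem shear_add_two_pi (μ₀ : ℝ) (b : ℂ) (θ : ℝ) :
    shear μ₀ b (θ + 2 * Real.pi) = shear μ₀ b θ := by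
  rw [shear, shear, exp_neg_two_mul_add_two_pi]

theorem polar_add_two_pi (μ₀ : ℝ) (b : ℂ) (ε θ σ : ℝ) :
    polar μ₀ b ε (θ + 2 * Real.pi) σ = polar μ₀ b ε θ σ := by
  rw [polar, polar, shear_add_two_pi]
  congr 1
  have := Complex.exp_periodic (θ * Complex.I)
  rw [← this]
  congr 1
  push_cast
  ring

theorem abs_oscillation_le (b : ℂ) (θ : ℝ) : |oscillation b θ| ≤ ‖b‖ := by
  refine (Complex.abs_re_le_norm _).trans ?_
  rw [norm_mul, norm_exp_neg_two_mul, mul_one]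

theorem abs_shear_le {μ₀ : ℝ} (hμ : 0 < μ₀) (b : ℂ) (θ : ℝ) : |shear μ₀ b θ| ≤ ‖b‖ / (2 * μ₀) := by
  rw [shear, abs_div, abs_of_pos (by positivity : 0 < 2 * μ₀)]
  gcongr
  refine (Complex.abs_re_le_norm _).trans ?_
  rw [norm_mul, norm_mul, norm_exp_neg_two_mul, mul_one, Complex.norm_I, mul_one]

theorem norm_polar (μ₀ : ℝ) (b : ℂ) {ε : ℝ} (hε : 0 < ε) (θ σ : ℝ) :
    ‖polar μ₀ b ε θ σ‖ = ε * Real.exp (σ + shear μ₀ b θ) := by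
  rw [polar, norm_mul, Complex.norm_exp_ofReal_mul_I, mul_one, Complex.norm_real,
    Real.norm_of_nonneg (by positivity)]

theorem polar_ne_zero (μ₀ : ℝ) (b : ℂ) {ε : ℝ} (hε : 0 < ε) (θ σ : ℝ) :
    polar μ₀ b ε θ σ ≠ 0 := by
  rw [← norm_pos_iff, norm_polar _ _ hε]
  positivity

/-- The quotient `z̄ / z` depends on the angle alone, so the antilinear part contributes exactly `b
e^{-2iθ}` to `ż / z`. -/
theorem conj_polar (μ₀ : ℝ) (b : ℂ) (ε θ σ : ℝ) :
    starRingEnd ℂ (polar μ₀ b ε θ σ) =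
      Complex.exp (-(2 * θ * Complex.I)) * polar μ₀ b ε θ σ := by
  rw [polar, map_mul, Complex.conj_ofReal, ← Complex.exp_conj, mul_left_comm, ← Complex.exp_add]
  congr 2
  simp only [map_mul, Complex.conj_ofReal, Complex.conj_I]
  ring

variable {G : ℂ × ℝ → ℂ} {μ₀ : ℝ} {k : ℕ} {C : ℕ → ℂ} {A : ℝ → ℝ} {A' : ℝ}

/-- The coefficients below order `k` are imaginary: they rotate but do not damp. -/
theorem sum_re_eq (h : HopfNormalForm G μ₀ k C A A') (w : ℕ → ℝ) (r : ℝ) :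
    (∑ j ∈ Finset.Icc 1 k, (w j : ℂ) * C j * ((r ^ (2 * j) : ℝ) : ℂ)).re =
      w k * (C k).re * r ^ (2 * k) := by
  rw [Complex.re_sum, Finset.sum_eq_single k]
  · rw [Complex.re_mul_ofReal, Complex.re_ofReal_mul]
  · intro j hj hjk
    have := Finset.mem_Icc.1 hj
    rw [Complex.re_mul_ofReal, Complex.re_ofReal_mul, h.re_eq_zero j this.1 (by omega)]
    ring
  · intro hk
    exact absurd (Finset.mem_Icc.2 ⟨h.one_le, le_rfl⟩) hk

theorem tendsto_sum {X : Type*} {l : Filter X} {r : X → ℝ} (hr : Tendsto r l (𝓝 0)) (k : ℕ)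
    (w : ℕ → ℝ) (C : ℕ → ℂ) :
    Tendsto (fun x => ∑ j ∈ Finset.Icc 1 k, (w j : ℂ) * C j * ((r x ^ (2 * j) : ℝ) : ℂ)) l (𝓝 0) := by
  have hcont : Continuous fun t : ℝ =>
      ∑ j ∈ Finset.Icc 1 k, (w j : ℂ) * C j * ((t ^ (2 * j) : ℝ) : ℂ) := by fun_prop
  have h0 : ∑ j ∈ Finset.Icc 1 k, (w j : ℂ) * C j * (((0 : ℝ) ^ (2 * j) : ℝ) : ℂ) = 0 := by
    refine Finset.sum_eq_zero fun j hj => ?_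
    have := (Finset.mem_Icc.1 hj).1
    simp [show j ≠ 0 by omega]
  simpa only [h0, Function.comp_def] using (hcont.tendsto 0).comp hr

/-- The parameter value at the scale `ε`. -/
noncomputable def scaledParam (k : ℕ) (A' ε : ℝ) : ℝ := A' / |A'| * ε ^ (2 * k)

/-- The antilinear part of the linearization at the scale `ε`. -/
noncomputable def scaledAnti (G : ℂ × ℝ → ℂ) (k : ℕ) (A' ε : ℝ) : ℂ :=
  antiPart (sliceDeriv G (0, scaledParam k A' ε))

/-- The point with the scaled polar coordinates `(θ, σ)`. -/
noncomputable def scaledPoint (G : ℂ × ℝ → ℂ) (μ₀ : ℝ) (k : ℕ) (A' ε θ σ : ℝ) : ℂ :=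
  polar μ₀ (scaledAnti G k A' ε) ε θ σ

/-- The logarithmic derivative `ż / z`. -/
noncomputable def logRate (G : ℂ × ℝ → ℂ) (μ₀ : ℝ) (k : ℕ) (A' ε θ σ : ℝ) : ℂ :=
  G (scaledPoint G μ₀ k A' ε θ σ, scaledParam k A' ε) / scaledPoint G μ₀ k A' ε θ σ

/-- The derivative of `ż / z` with respect to `σ`. -/
noncomputable def logRateDeriv (G : ℂ × ℝ → ℂ) (μ₀ : ℝ) (k : ℕ) (A' ε θ σ : ℝ) : ℂ :=
  (sliceDeriv G (scaledPoint G μ₀ k A' ε θ σ, scaledParam k A' ε) (scaledPoint G μ₀ k A' ε θ σ) -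
    G (scaledPoint G μ₀ k A' ε θ σ, scaledParam k A' ε)) / scaledPoint G μ₀ k A' ε θ σ

/-- Small scales, uniformly in the angle and in `σ₁ ≤ σ ≤ σ₂`. -/
def smallScale (σ₁ σ₂ : ℝ) : Filter (ℝ × ℝ × ℝ) := 𝓝[>] 0 ×ˢ 𝓟 (univ ×ˢ Icc σ₁ σ₂)

theorem eventually_smallScale {σ₁ σ₂ : ℝ} {p : ℝ × ℝ × ℝ → Prop} :
    (∀ᶠ x in smallScale σ₁ σ₂, p x) ↔ ∀ᶠ ε in 𝓝[>] 0, ∀ θ, ∀ σ ∈ Icc σ₁ σ₂, p (ε, θ, σ) := by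
  rw [smallScale, eventually_prod_principal_iff]
  refine eventually_congr (Eventually.of_forall fun ε => ?_)
  exact ⟨fun H θ σ hσ => H (θ, σ) ⟨trivial, hσ⟩, fun H y hy => H y.1 y.2 hy.2⟩

variable (h : HopfNormalForm G μ₀ k C A A') {σ₁ σ₂ : ℝ}

theorem tendsto_scale : Tendsto (fun x : ℝ × ℝ × ℝ => x.1) (smallScale σ₁ σ₂) (𝓝[>] 0) :=
  tendsto_fst

theorem eventually_mem_strip : ∀ᶠ x : ℝ × ℝ × ℝ in smallScale σ₁ σ₂, 0 < x.1 ∧ x.2.2 ∈ Icc σ₁ σ₂ :=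
  eventually_smallScale.2 (by
    filter_upwards [self_mem_nhdsWithin] with ε hε θ σ hσ using ⟨hε, hσ⟩)

theorem tendsto_scaledParam (hk : 1 ≤ k) (A' : ℝ) :
    Tendsto (scaledParam k A') (𝓝[>] 0) (𝓝 0) := by
  refine tendsto_nhdsWithin_of_tendsto_nhds ?_
  have : Continuous (scaledParam k A') := by unfold scaledParam; fun_prop
  simpa [scaledParam, show k ≠ 0 by omega] using this.tendsto 0

theorem abs_scaledParam (h : A' ≠ 0) {ε : ℝ} (hε : 0 < ε) : |scaledParam k A' ε| = ε ^ (2 * k) := by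
  rw [scaledParam, abs_mul, abs_div, abs_abs, div_self (abs_ne_zero.2 h), one_mul,
    abs_of_pos (by positivity)]

include h in
theorem HopfNormalForm.continuousAt_sliceDeriv :
    ContinuousAt (fun α : ℝ => sliceDeriv G (0, α)) 0 :=
  (contDiffAt_sliceDeriv h.contDiffAt).continuousAt.comp (f := fun α : ℝ => ((0 : ℂ), α))
    (by fun_prop)

end Scaling

/-! ### Asymptotics of the polar equation as the scale tends to zero -/

section Limits

open Asymptotics

namespace HopfNormalForm

variable {G : ℂ × ℝ → ℂ} {μ₀ : ℝ} {k : ℕ} {C : ℕ → ℂ} {A : ℝ → ℝ} {A' : ℝ} {σ₁ σ₂ : ℝ}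

theorem sliceDeriv_zero (h : HopfNormalForm G μ₀ k C A A') (z : ℂ) :
    sliceDeriv G 0 z = Complex.I * μ₀ * z :=
  (exists_norm_sub_normalForm_le h.contDiffAt h.map_zero h.isBigO).1 z

theorem antiPart_zero (h : HopfNormalForm G μ₀ k C A A') : antiPart (sliceDeriv G 0) = 0 := by
  rw [antiPart, h.sliceDeriv_zero, h.sliceDeriv_zero]
  linear_combination (Complex.I * μ₀ / 2) * Complex.I_sq

theorem linPart_zero (h : HopfNormalForm G μ₀ k C A A') :
    linPart (sliceDeriv G 0) = Complex.I * μ₀ := by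
  rw [linPart, h.sliceDeriv_zero, h.sliceDeriv_zero]
  linear_combination (-Complex.I * μ₀ / 2) * Complex.I_sq

theorem map_A_zero (h : HopfNormalForm G μ₀ k C A A') : A 0 = 0 := by
  have h1 := h.trace.self_of_nhds
  rw [show ((0 : ℂ), (0 : ℝ)) = 0 from rfl, h.sliceDeriv_zero, h.sliceDeriv_zero] at h1
  simp at h1
  linarith

/-- The antilinear part is differentiable in the parameter and vanishes at `α = 0`, and `|α| = ε ^
(2k)`. -/
theorem exists_norm_scaledAnti_le (h : HopfNormalForm G μ₀ k C A A') :
    ∃ M, 0 ≤ M ∧ ∀ᶠ ε in 𝓝[>] 0, ‖scaledAnti G k A' ε‖ ≤ M * ε ^ (2 * k) := by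
  have hd : DifferentiableAt ℝ (fun α : ℝ => sliceDeriv G (0, α)) 0 :=
    ((contDiffAt_sliceDeriv h.contDiffAt).differentiableAt (by simp)).comp
      (f := fun α : ℝ => ((0 : ℂ), α)) 0 (by fun_prop)
  have hd2 : DifferentiableAt ℝ (fun α : ℝ => antiPart (sliceDeriv G (0, α))) 0 := by
    unfold antiPart
    fun_prop
  obtain ⟨M, hM, hb⟩ := hd2.isBigO_sub.exists_nonneg
  refine ⟨M, hM, ?_⟩
  filter_upwards [(tendsto_scaledParam h.one_le A').eventually hb.bound, self_mem_nhdsWithin]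
    with ε hε (hpos : 0 < ε)
  have h0 : antiPart (sliceDeriv G (0, 0)) = 0 := h.antiPart_zero
  rw [h0, sub_zero, sub_zero, Real.norm_eq_abs, abs_scaledParam h.ne_zero hpos] at hε
  exact hε

theorem tendsto_scaledAnti (h : HopfNormalForm G μ₀ k C A A') :
    Tendsto (scaledAnti G k A') (𝓝[>] 0) (𝓝 0) := by
  obtain ⟨M, -, hM⟩ := h.exists_norm_scaledAnti_le
  refine squeeze_zero_norm' hM (tendsto_nhdsWithin_of_tendsto_nhds ?_)
  have : Continuous fun ε : ℝ => M * ε ^ (2 * k) := by fun_prop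
  have hk := h.one_le
  simpa [show k ≠ 0 by omega] using this.tendsto 0

theorem tendsto_shear (h : HopfNormalForm G μ₀ k C A A') :
    Tendsto (fun x : ℝ × ℝ × ℝ => shear μ₀ (scaledAnti G k A' x.1) x.2.1) (smallScale σ₁ σ₂)
      (𝓝 0) := by
  refine squeeze_zero_norm (fun x => abs_shear_le h.μ₀_pos _ _) ?_
  simpa using (h.tendsto_scaledAnti.norm.comp (tendsto_scale (σ₁ := σ₁) (σ₂ := σ₂))).div_const
    (2 * μ₀)

theorem eventually_norm_scaledPoint (h : HopfNormalForm G μ₀ k C A A') :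
    ∀ᶠ x in smallScale σ₁ σ₂, ‖scaledPoint G μ₀ k A' x.1 x.2.1 x.2.2‖ =
        x.1 * Real.exp (x.2.2 + shear μ₀ (scaledAnti G k A' x.1) x.2.1) ∧
      ‖scaledPoint G μ₀ k A' x.1 x.2.1 x.2.2‖ ≤ Real.exp (σ₂ + 1) * x.1 := by
  filter_upwards [eventually_mem_strip, h.tendsto_shear.eventually (gt_mem_nhds one_pos)]
    with x hx hs
  have h1 := norm_polar μ₀ (scaledAnti G k A' x.1) hx.1 x.2.1 x.2.2
  refine ⟨h1, h1.trans_le ?_⟩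
  rw [mul_comm]
  refine mul_le_mul_of_nonneg_right (Real.exp_le_exp.2 ?_) hx.1.le
  linarith [hx.2.2]

theorem tendsto_norm_scaledPoint (h : HopfNormalForm G μ₀ k C A A') :
    Tendsto (fun x : ℝ × ℝ × ℝ => ‖scaledPoint G μ₀ k A' x.1 x.2.1 x.2.2‖) (smallScale σ₁ σ₂)
      (𝓝 0) := by
  refine squeeze_zero' (Eventually.of_forall fun _ => norm_nonneg _)
    (h.eventually_norm_scaledPoint.mono fun x hx => hx.2) ?_
  have := (tendsto_scale (σ₁ := σ₁) (σ₂ := σ₂)).mono_right nhdsWithin_le_nhds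
  simpa using this.const_mul (Real.exp (σ₂ + 1))

theorem tendsto_scaledPoint_param (h : HopfNormalForm G μ₀ k C A A') :
    Tendsto (fun x : ℝ × ℝ × ℝ => (scaledPoint G μ₀ k A' x.1 x.2.1 x.2.2, scaledParam k A' x.1))
      (smallScale σ₁ σ₂) (𝓝 0) :=
  (tendsto_zero_iff_norm_tendsto_zero.2 h.tendsto_norm_scaledPoint).prodMk_nhds
    ((tendsto_scaledParam h.one_le A').comp tendsto_scale)

theorem tendsto_norm_pow (h : HopfNormalForm G μ₀ k C A A') :
    Tendsto (fun x : ℝ × ℝ × ℝ => ‖scaledPoint G μ₀ k A' x.1 x.2.1 x.2.2‖ ^ (2 * k) /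
      x.1 ^ (2 * k) - Real.exp (2 * k * x.2.2)) (smallScale σ₁ σ₂) (𝓝 0) := by
  have h1 : Tendsto (fun x : ℝ × ℝ × ℝ => Real.exp (2 * k * σ₂) *
      |Real.exp (2 * k * shear μ₀ (scaledAnti G k A' x.1) x.2.1) - 1|) (smallScale σ₁ σ₂)
      (𝓝 0) := by
    have hc : Continuous fun t : ℝ => Real.exp (2 * k * σ₂) * |Real.exp (2 * k * t) - 1| := by
      fun_prop
    simpa [Function.comp_def] using (hc.tendsto 0).comp (h.tendsto_shear (σ₁ := σ₁) (σ₂ := σ₂))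
  refine squeeze_zero_norm' ?_ h1
  filter_upwards [eventually_mem_strip, h.eventually_norm_scaledPoint] with x hx hn
  have h2 : ‖scaledPoint G μ₀ k A' x.1 x.2.1 x.2.2‖ ^ (2 * k) / x.1 ^ (2 * k) =
      Real.exp (2 * k * x.2.2) *
        Real.exp (2 * k * shear μ₀ (scaledAnti G k A' x.1) x.2.1) := by
    rw [hn.1, mul_pow, mul_div_cancel_left₀ _ (pow_ne_zero _ hx.1.ne'), ← Real.exp_nat_mul,
      ← Real.exp_add]
    push_cast
    ring_nf
  rw [h2, ← mul_sub_one, norm_mul, Real.norm_eq_abs, Real.norm_eq_abs,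
    abs_of_pos (Real.exp_pos _)]
  refine mul_le_mul_of_nonneg_right (Real.exp_le_exp.2 ?_) (abs_nonneg _)
  exact mul_le_mul_of_nonneg_left hx.2.2 (by positivity)

/-- The remainders in the expansions of `ż / z` and of its `σ`-derivative. -/
theorem tendsto_remainders (h : HopfNormalForm G μ₀ k C A A') :
    Tendsto (fun x : ℝ × ℝ × ℝ => ‖logRate G μ₀ k A' x.1 x.2.1 x.2.2 -
      (linPart (sliceDeriv G (0, scaledParam k A' x.1)) +
        scaledAnti G k A' x.1 * Complex.exp (-(2 * x.2.1 * Complex.I)) +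
        ∑ j ∈ Finset.Icc 1 k, ((1 : ℕ → ℝ) j : ℂ) * C j *
          ((‖scaledPoint G μ₀ k A' x.1 x.2.1 x.2.2‖ ^ (2 * j) : ℝ) : ℂ))‖ / x.1 ^ (2 * k))
      (smallScale σ₁ σ₂) (𝓝 0) ∧
    Tendsto (fun x : ℝ × ℝ × ℝ => ‖logRateDeriv G μ₀ k A' x.1 x.2.1 x.2.2 -
        ∑ j ∈ Finset.Icc 1 k, (((fun j => 2 * j : ℕ → ℝ) j : ℝ) : ℂ) * C j *
          ((‖scaledPoint G μ₀ k A' x.1 x.2.1 x.2.2‖ ^ (2 * j) : ℝ) : ℂ)‖ / x.1 ^ (2 * k))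
      (smallScale σ₁ σ₂) (𝓝 0) := by
  obtain ⟨-, K, hK, hexp⟩ := exists_norm_sub_normalForm_le h.contDiffAt h.map_zero h.isBigO
  set M := Real.exp (σ₂ + 1)
  have hlim : Tendsto (fun x : ℝ × ℝ × ℝ => K * (M * x.1 + (M * x.1) ^ 2 * M ^ (2 * k)))
      (smallScale σ₁ σ₂) (𝓝 0) := by
    have hc : Continuous fun t : ℝ => K * (M * t + (M * t) ^ 2 * M ^ (2 * k)) := by fun_prop
    simpa [Function.comp_def] using (hc.tendsto 0).comp
      ((tendsto_scale (σ₁ := σ₁) (σ₂ := σ₂)).mono_right nhdsWithin_le_nhds)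
  have hM : 0 < M := Real.exp_pos _
  -- With `|z| ≤ M ε`, the error terms `|α||z|²` and `|z|^{2k+3}`, divided by `|z|`, have orders
  -- `ε^{2k+1}` and `ε^{2k+2}`; both are negligible against `ε^{2k}`.
  have hbound : ∀ᶠ x in smallScale σ₁ σ₂, ∀ e : ℂ,
      ‖e‖ ≤ K * (|scaledParam k A' x.1| * ‖scaledPoint G μ₀ k A' x.1 x.2.1 x.2.2‖ ^ 2 +
        ‖scaledPoint G μ₀ k A' x.1 x.2.1 x.2.2‖ ^ (2 * k + 3)) →
      ‖e / scaledPoint G μ₀ k A' x.1 x.2.1 x.2.2‖ / x.1 ^ (2 * k) ≤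
        K * (M * x.1 + (M * x.1) ^ 2 * M ^ (2 * k)) := by
    filter_upwards [eventually_mem_strip, h.eventually_norm_scaledPoint] with x hx hn e he
    rw [abs_scaledParam h.ne_zero hx.1] at he
    have hz : 0 < ‖scaledPoint G μ₀ k A' x.1 x.2.1 x.2.2‖ :=
      norm_pos_iff.2 (polar_ne_zero _ _ hx.1 _ _)
    set r := ‖scaledPoint G μ₀ k A' x.1 x.2.1 x.2.2‖
    have hD : 0 < x.1 ^ (2 * k) := pow_pos hx.1 _
    have hr : r ≤ M * x.1 := hn.2
    rw [norm_div, div_div, div_le_iff₀ (mul_pos hz hD)]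
    refine he.trans ?_
    rw [mul_assoc]
    refine mul_le_mul_of_nonneg_left ?_ hK
    have h1 : r ^ (2 * k) ≤ M ^ (2 * k) * x.1 ^ (2 * k) := by
      rw [← mul_pow]; exact pow_le_pow_left₀ hz.le hr _
    have h2 : r ^ 2 ≤ (M * x.1) ^ 2 := pow_le_pow_left₀ hz.le hr _
    calc x.1 ^ (2 * k) * r ^ 2 + r ^ (2 * k + 3)
        = r * (r * x.1 ^ (2 * k)) + r * (r ^ 2 * r ^ (2 * k)) := by ring
      _ ≤ r * (M * x.1 * x.1 ^ (2 * k)) +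
          r * ((M * x.1) ^ 2 * (M ^ (2 * k) * x.1 ^ (2 * k))) := by
        gcongr
      _ = _ := by ring
  constructor
  · refine squeeze_zero' (eventually_mem_strip.mono fun x hx =>
      div_nonneg (norm_nonneg _) (pow_pos hx.1 _).le) ?_ hlim
    filter_upwards [eventually_mem_strip, hbound, h.tendsto_scaledPoint_param.eventually hexp]
      with x hx hb he
    have hz := polar_ne_zero μ₀ (scaledAnti G k A' x.1) hx.1 x.2.1 x.2.2
    refine le_of_eq_of_le ?_ (hb _ he.1)
    congr 2
    rw [eq_div_iff (show scaledPoint G μ₀ k A' x.1 x.2.1 x.2.2 ≠ 0 from hz), sub_mul, logRate,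
      div_mul_cancel₀ _ (show scaledPoint G μ₀ k A' x.1 x.2.1 x.2.2 ≠ 0 from hz)]
    congr 1
    rw [apply_eq_linPart_add_antiPart, resonantSum_eq]
    have hc : starRingEnd ℂ (scaledPoint G μ₀ k A' x.1 x.2.1 x.2.2) = _ := conj_polar _ _ _ _ _
    simp only [hc, scaledAnti]
    rw [scaledPoint]
    simp only [scaledAnti]
    ring
  · refine squeeze_zero' (eventually_mem_strip.mono fun x hx =>
      div_nonneg (norm_nonneg _) (pow_pos hx.1 _).le) ?_ hlim
    filter_upwards [eventually_mem_strip, hbound, h.tendsto_scaledPoint_param.eventually hexp]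
      with x hx hb he
    have hz := polar_ne_zero μ₀ (scaledAnti G k A' x.1) hx.1 x.2.1 x.2.2
    refine le_of_eq_of_le ?_ (hb _ he.2)
    congr 2
    rw [eq_div_iff (show scaledPoint G μ₀ k A' x.1 x.2.1 x.2.2 ≠ 0 from hz), sub_mul, logRateDeriv,
      div_mul_cancel₀ _ (show scaledPoint G μ₀ k A' x.1 x.2.1 x.2.2 ≠ 0 from hz),
      resonantSum_eq]
    ring

theorem tendsto_pow_scale (h : HopfNormalForm G μ₀ k C A A') :
    Tendsto (fun x : ℝ × ℝ × ℝ => x.1 ^ (2 * k)) (smallScale σ₁ σ₂) (𝓝 0) := by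
  have hc : Continuous fun t : ℝ => t ^ (2 * k) := by fun_prop
  have hk := h.one_le
  simpa [Function.comp_def, show k ≠ 0 by omega] using (hc.tendsto 0).comp
    ((tendsto_scale (σ₁ := σ₁) (σ₂ := σ₂)).mono_right nhdsWithin_le_nhds)

/-- A complex function whose norm is `o(ε ^ 2k)` tends to zero. -/
theorem tendsto_of_norm_div (h : HopfNormalForm G μ₀ k C A A') {e : ℝ × ℝ × ℝ → ℂ}
    (he : Tendsto (fun x => ‖e x‖ / x.1 ^ (2 * k)) (smallScale σ₁ σ₂) (𝓝 0)) :
    Tendsto e (smallScale σ₁ σ₂) (𝓝 0) := by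
  have h1 := he.mul (h.tendsto_pow_scale (σ₁ := σ₁) (σ₂ := σ₂))
  rw [mul_zero] at h1
  refine tendsto_zero_iff_norm_tendsto_zero.2 (h1.congr' ?_)
  filter_upwards [eventually_mem_strip] with x hx
  rw [div_mul_cancel₀ _ (pow_pos hx.1 _).ne']

theorem tendsto_re_div {e : ℝ × ℝ × ℝ → ℂ}
    (he : Tendsto (fun x => ‖e x‖ / x.1 ^ (2 * k)) (smallScale σ₁ σ₂) (𝓝 0)) :
    Tendsto (fun x => (e x).re / x.1 ^ (2 * k)) (smallScale σ₁ σ₂) (𝓝 0) := by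
  refine squeeze_zero_norm' ?_ he
  filter_upwards [eventually_mem_strip] with x hx
  rw [norm_div, Real.norm_eq_abs, Real.norm_of_nonneg (pow_pos hx.1 _).le]
  exact div_le_div_of_nonneg_right (Complex.abs_re_le_norm _) (pow_pos hx.1 _).le

theorem tendsto_logRate_im (h : HopfNormalForm G μ₀ k C A A') :
    Tendsto (fun x : ℝ × ℝ × ℝ => (logRate G μ₀ k A' x.1 x.2.1 x.2.2).im) (smallScale σ₁ σ₂)
      (𝓝 μ₀) := by
  have h1 := h.tendsto_of_norm_div (σ₁ := σ₁) (σ₂ := σ₂) h.tendsto_remainders.1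
  have h2 : Tendsto (fun x : ℝ × ℝ × ℝ => linPart (sliceDeriv G (0, scaledParam k A' x.1)))
      (smallScale σ₁ σ₂) (𝓝 (Complex.I * μ₀)) := by
    have hc : ContinuousAt (fun α : ℝ => linPart (sliceDeriv G (0, α))) 0 := by
      have := h.continuousAt_sliceDeriv
      unfold linPart
      fun_prop
    have h3 := hc.tendsto.comp ((tendsto_scaledParam h.one_le A').comp
      (tendsto_scale (σ₁ := σ₁) (σ₂ := σ₂)))
    rwa [show ((0 : ℂ), (0 : ℝ)) = 0 from rfl, h.linPart_zero] at h3
  have h3 : Tendsto (fun x : ℝ × ℝ × ℝ => scaledAnti G k A' x.1 *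
      Complex.exp (-(2 * x.2.1 * Complex.I))) (smallScale σ₁ σ₂) (𝓝 0) := by
    refine tendsto_zero_iff_norm_tendsto_zero.2 ?_
    simp only [norm_mul, norm_exp_neg_two_mul, mul_one]
    simpa using (h.tendsto_scaledAnti.comp (tendsto_scale (σ₁ := σ₁) (σ₂ := σ₂))).norm
  have h4 := tendsto_sum (h.tendsto_norm_scaledPoint (σ₁ := σ₁) (σ₂ := σ₂)) k 1 C
  have h5 := h1.add ((h2.add h3).add h4)
  simp only [sub_add_cancel, add_zero, zero_add] at h5
  simpa [Function.comp_def] using (Complex.continuous_im.tendsto _).comp h5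

theorem tendsto_logRateDeriv_im (h : HopfNormalForm G μ₀ k C A A') :
    Tendsto (fun x : ℝ × ℝ × ℝ => (logRateDeriv G μ₀ k A' x.1 x.2.1 x.2.2).im) (smallScale σ₁ σ₂)
      (𝓝 0) := by
  have h1 := h.tendsto_of_norm_div (σ₁ := σ₁) (σ₂ := σ₂) h.tendsto_remainders.2
  have h5 := h1.add
    (tendsto_sum (h.tendsto_norm_scaledPoint (σ₁ := σ₁) (σ₂ := σ₂)) k (fun j => 2 * j) C)
  simp only [sub_add_cancel, add_zero] at h5
  simpa [Function.comp_def] using (Complex.continuous_im.tendsto _).comp h5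

theorem tendsto_logRateDeriv_re (h : HopfNormalForm G μ₀ k C A A') :
    Tendsto (fun x : ℝ × ℝ × ℝ => (logRateDeriv G μ₀ k A' x.1 x.2.1 x.2.2).re / x.1 ^ (2 * k) -
      2 * k * (C k).re * Real.exp (2 * k * x.2.2)) (smallScale σ₁ σ₂) (𝓝 0) := by
  have h1 := tendsto_re_div (σ₁ := σ₁) (σ₂ := σ₂) h.tendsto_remainders.2
  have h2 := (h.tendsto_norm_pow (σ₁ := σ₁) (σ₂ := σ₂)).const_mul (2 * k * (C k).re)
  have h3 := h1.add h2
  rw [mul_zero, add_zero] at h3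
  refine h3.congr fun x => ?_
  rw [Complex.sub_re, sum_re_eq h]
  ring

theorem exists_abs_oscillation_div_le (h : HopfNormalForm G μ₀ k C A A') :
    ∃ M, ∀ᶠ x in smallScale σ₁ σ₂,
      |oscillation (scaledAnti G k A' x.1) x.2.1 / x.1 ^ (2 * k)| ≤ M := by
  obtain ⟨M, -, hM⟩ := h.exists_norm_scaledAnti_le
  refine ⟨M, ?_⟩
  filter_upwards [eventually_mem_strip, tendsto_scale.eventually hM] with x hx hm
  rw [abs_div, abs_of_pos (pow_pos hx.1 _), div_le_iff₀ (pow_pos hx.1 _)]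
  exact (abs_oscillation_le _ _).trans hm

/-- The parameter `α` has the sign of `A'`, so `A' α = |A'| ε^{2k}`: the origin repels, to first
order, on the side considered. -/
theorem tendsto_A_div (h : HopfNormalForm G μ₀ k C A A') :
    Tendsto (fun x : ℝ × ℝ × ℝ => A (scaledParam k A' x.1) / x.1 ^ (2 * k)) (smallScale σ₁ σ₂)
      (𝓝 |A'|) := by
  have h1 := h.hasDerivAt.tendsto_slope
  have h2 : Tendsto (scaledParam k A') (𝓝[>] 0) (𝓝[≠] 0) := by
    refine tendsto_nhdsWithin_iff.2 ⟨tendsto_scaledParam h.one_le A', ?_⟩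
    filter_upwards [self_mem_nhdsWithin] with ε hε
    rw [mem_compl_singleton_iff, ← abs_pos, abs_scaledParam h.ne_zero hε]
    exact pow_pos hε _
  have h3 := ((h1.comp h2).comp (tendsto_scale (σ₁ := σ₁) (σ₂ := σ₂))).mul_const (A' / |A'|)
  have h4 : A' * (A' / |A'|) = |A'| := by
    rw [← mul_div_assoc, ← sq, ← sq_abs, sq, mul_div_assoc, div_self (abs_ne_zero.2 h.ne_zero),
      mul_one]
  rw [h4] at h3
  refine h3.congr' ?_
  filter_upwards [eventually_mem_strip] with x hx
  have h5 : (A' / |A'|) ^ 2 = 1 := by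
    rw [div_pow, sq_abs, div_self (pow_ne_zero _ h.ne_zero)]
  have h6 : A' / |A'| ≠ 0 := div_ne_zero h.ne_zero (abs_ne_zero.2 h.ne_zero)
  simp only [Function.comp_apply, slope_def_field, h.map_A_zero, sub_zero]
  rw [scaledParam, div_mul_eq_mul_div, mul_comm (A _), mul_div_mul_left _ _ h6]

/-- The subtracted term is the shear's contribution to the radial rate. It cancels the oscillation,
leaving the trace term and the first real resonant coefficient. -/
theorem tendsto_radial (h : HopfNormalForm G μ₀ k C A A') :
    Tendsto (fun x : ℝ × ℝ × ℝ => ((logRate G μ₀ k A' x.1 x.2.1 x.2.2).re -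
      (logRate G μ₀ k A' x.1 x.2.1 x.2.2).im *
        (oscillation (scaledAnti G k A' x.1) x.2.1 / μ₀)) / x.1 ^ (2 * k) -
      (|A'| + (C k).re * Real.exp (2 * k * x.2.2))) (smallScale σ₁ σ₂) (𝓝 0) := by
  have h1 := tendsto_re_div (σ₁ := σ₁) (σ₂ := σ₂) h.tendsto_remainders.1
  have h2 := (h.tendsto_norm_pow (σ₁ := σ₁) (σ₂ := σ₂)).const_mul (C k).re
  have h3 := (h.tendsto_A_div (σ₁ := σ₁) (σ₂ := σ₂)).sub_const |A'|
  obtain ⟨M, hM⟩ := h.exists_abs_oscillation_div_le (σ₁ := σ₁) (σ₂ := σ₂)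
  -- The shear is exact for the constant angular speed `μ₀`. What survives is the scaled
  -- oscillation, which is only bounded, times the relative deviation of the true speed from `μ₀`,
  -- which tends to 0.
  have h4 : Tendsto (fun x : ℝ × ℝ × ℝ => (1 - (logRate G μ₀ k A' x.1 x.2.1 x.2.2).im / μ₀) *
      (oscillation (scaledAnti G k A' x.1) x.2.1 / x.1 ^ (2 * k))) (smallScale σ₁ σ₂) (𝓝 0) := by
    have h5 := ((h.tendsto_logRate_im (σ₁ := σ₁) (σ₂ := σ₂)).div_const μ₀).const_sub 1
    rw [div_self h.μ₀_pos.ne', sub_self] at h5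
    refine h5.zero_mul_isBoundedUnder_le ⟨M, ?_⟩
    rw [eventually_map]
    exact hM
  have h5 := ((h1.add h2).add h3).add h4
  simp only [mul_zero, add_zero, sub_self] at h5
  refine h5.congr' ?_
  filter_upwards [eventually_mem_strip,
    ((tendsto_scaledParam h.one_le A').comp tendsto_scale).eventually h.trace] with x hx htr
  have hlin : (linPart (sliceDeriv G (0, scaledParam k A' x.1))).re = A (scaledParam k A' x.1) := by
    rw [linPart_re]
    simp only [Function.comp_apply] at htr
    rw [htr]
    ring
  rw [Complex.sub_re, Complex.add_re, Complex.add_re, sum_re_eq h, hlin, ← oscillation]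
  have := h.μ₀_pos.ne'
  have hD := (pow_pos hx.1 (2 * k)).ne'
  simp only [Pi.one_apply]
  field_simp
  ring

end HopfNormalForm

end Limits

/-! ### The scaled equation on the strip -/

/-- The slope `dσ/dθ` in the scaled polar coordinates. -/
noncomputable def slopeField (G : ℂ × ℝ → ℂ) (μ₀ : ℝ) (k : ℕ) (A' ε θ σ : ℝ) : ℝ :=
  (logRate G μ₀ k A' ε θ σ).re / (logRate G μ₀ k A' ε θ σ).im -
    oscillation (scaledAnti G k A' ε) θ / μ₀

/-- The `σ`-derivative of the slope. -/
noncomputable def slopeDeriv (G : ℂ × ℝ → ℂ) (μ₀ : ℝ) (k : ℕ) (A' ε θ σ : ℝ) : ℝ :=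
  ((logRateDeriv G μ₀ k A' ε θ σ).re * (logRate G μ₀ k A' ε θ σ).im -
    (logRate G μ₀ k A' ε θ σ).re * (logRateDeriv G μ₀ k A' ε θ σ).im) /
      (logRate G μ₀ k A' ε θ σ).im ^ 2

theorem abs_le_of_tendsto_sub {X : Type*} {l : Filter X} {u v : X → ℝ} {M : ℝ}
    (h : Tendsto (fun x => u x - v x) l (𝓝 0)) (hv : ∀ᶠ x in l, |v x| ≤ M) :
    ∀ᶠ x in l, |u x| ≤ M + 1 := by
  have h1 := (tendsto_zero_iff_abs_tendsto_zero _).1 h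
  filter_upwards [hv, h1.eventually (gt_mem_nhds one_pos)] with x hx hx1
  have := abs_sub_abs_le_abs_sub (u x) (v x)
  simp only [Function.comp_apply] at hx1
  linarith

namespace HopfNormalForm

variable {G : ℂ × ℝ → ℂ} {μ₀ : ℝ} {k : ℕ} {C : ℕ → ℂ} {A : ℝ → ℝ} {A' : ℝ} {σ₁ σ₂ : ℝ}

theorem eventually_exp_le (k : ℕ) (c : ℝ) : ∀ᶠ x : ℝ × ℝ × ℝ in smallScale σ₁ σ₂,
    |c * Real.exp (2 * k * x.2.2)| ≤ |c| * Real.exp (2 * k * σ₂) := by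
  filter_upwards [eventually_mem_strip] with x hx
  rw [abs_mul, abs_of_pos (Real.exp_pos _)]
  refine mul_le_mul_of_nonneg_left (Real.exp_le_exp.2 ?_) (abs_nonneg _)
  exact mul_le_mul_of_nonneg_left hx.2.2 (by positivity)

theorem exists_abs_radial_div_le (h : HopfNormalForm G μ₀ k C A A') :
    ∃ M, ∀ᶠ x in smallScale σ₁ σ₂, |((logRate G μ₀ k A' x.1 x.2.1 x.2.2).re -
      (logRate G μ₀ k A' x.1 x.2.1 x.2.2).im *
        (oscillation (scaledAnti G k A' x.1) x.2.1 / μ₀)) / x.1 ^ (2 * k)| ≤ M := by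
  refine ⟨_, abs_le_of_tendsto_sub (h.tendsto_radial (σ₁ := σ₁) (σ₂ := σ₂))
    (M := |A'| + |(C k).re| * Real.exp (2 * k * σ₂)) ?_⟩
  filter_upwards [eventually_exp_le k (C k).re] with x hx
  refine (abs_add_le _ _).trans ?_
  rw [abs_abs]
  linarith

/-- Before the shear correction only boundedness is established for the scaled radial rate. That is
enough where it multiplies the vanishing derivative of the angular speed. -/
theorem exists_abs_logRate_re_div_le (h : HopfNormalForm G μ₀ k C A A') :
    ∃ M, ∀ᶠ x in smallScale σ₁ σ₂,
      |(logRate G μ₀ k A' x.1 x.2.1 x.2.2).re / x.1 ^ (2 * k)| ≤ M := by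
  obtain ⟨M₁, h₁⟩ := h.exists_abs_radial_div_le (σ₁ := σ₁) (σ₂ := σ₂)
  obtain ⟨M₂, h₂⟩ := h.exists_abs_oscillation_div_le (σ₁ := σ₁) (σ₂ := σ₂)
  have h₃ := (h.tendsto_logRate_im (σ₁ := σ₁) (σ₂ := σ₂)).div_const μ₀
  rw [div_self h.μ₀_pos.ne'] at h₃
  refine ⟨M₁ + 2 * M₂, ?_⟩
  filter_upwards [h₁, h₂, h₃.abs.eventually (gt_mem_nhds (by norm_num : |(1 : ℝ)| < 2))]
    with x hx1 hx2 hx3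
  have he : (logRate G μ₀ k A' x.1 x.2.1 x.2.2).re / x.1 ^ (2 * k) =
      ((logRate G μ₀ k A' x.1 x.2.1 x.2.2).re - (logRate G μ₀ k A' x.1 x.2.1 x.2.2).im *
        (oscillation (scaledAnti G k A' x.1) x.2.1 / μ₀)) / x.1 ^ (2 * k) +
      (logRate G μ₀ k A' x.1 x.2.1 x.2.2).im / μ₀ *
        (oscillation (scaledAnti G k A' x.1) x.2.1 / x.1 ^ (2 * k)) := by ring
  rw [he]
  refine (abs_add_le _ _).trans (add_le_add hx1 ?_)
  rw [abs_mul]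
  exact mul_le_mul hx3.le hx2 (abs_nonneg _) two_pos.le

/-- In the quotient rule for `Re / Im`, the product `Re · Im'` is `o(ε^{2k})`, so the contraction
comes from the radial derivative of the `C_k` term alone. -/
theorem tendsto_slopeNumerator (h : HopfNormalForm G μ₀ k C A A') :
    Tendsto (fun x : ℝ × ℝ × ℝ =>
      ((logRateDeriv G μ₀ k A' x.1 x.2.1 x.2.2).re * (logRate G μ₀ k A' x.1 x.2.1 x.2.2).im -
        (logRate G μ₀ k A' x.1 x.2.1 x.2.2).re * (logRateDeriv G μ₀ k A' x.1 x.2.1 x.2.2).im) /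
        x.1 ^ (2 * k) - 2 * k * (C k).re * μ₀ * Real.exp (2 * k * x.2.2))
      (smallScale σ₁ σ₂) (𝓝 0) := by
  have h1 := (h.tendsto_logRateDeriv_re (σ₁ := σ₁) (σ₂ := σ₂)).mul h.tendsto_logRate_im
  have h2 : Tendsto (fun x : ℝ × ℝ × ℝ => ((logRate G μ₀ k A' x.1 x.2.1 x.2.2).im - μ₀) *
      (2 * k * (C k).re * Real.exp (2 * k * x.2.2))) (smallScale σ₁ σ₂) (𝓝 0) := by
    have h3 := (h.tendsto_logRate_im (σ₁ := σ₁) (σ₂ := σ₂)).sub_const μ₀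
    rw [sub_self] at h3
    refine h3.zero_mul_isBoundedUnder_le
      ⟨|2 * k * (C k).re| * Real.exp (2 * k * σ₂), ?_⟩
    rw [eventually_map]
    exact eventually_exp_le k (2 * k * (C k).re)
  obtain ⟨M, hM⟩ := h.exists_abs_logRate_re_div_le (σ₁ := σ₁) (σ₂ := σ₂)
  have h3 : Tendsto (fun x : ℝ × ℝ × ℝ => (logRateDeriv G μ₀ k A' x.1 x.2.1 x.2.2).im *
      ((logRate G μ₀ k A' x.1 x.2.1 x.2.2).re / x.1 ^ (2 * k))) (smallScale σ₁ σ₂) (𝓝 0) := by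
    refine h.tendsto_logRateDeriv_im.zero_mul_isBoundedUnder_le ⟨M, ?_⟩
    rw [eventually_map]
    exact hM
  have h4 := (h1.add h2).sub h3
  simp only [zero_mul, add_zero, sub_zero] at h4
  refine h4.congr fun x => ?_
  ring

theorem eventually_strip_estimates (h : HopfNormalForm G μ₀ k C A A') :
    ∃ m > 0, ∀ᶠ x in smallScale σ₁ σ₂,
      (μ₀ / 2 ≤ (logRate G μ₀ k A' x.1 x.2.1 x.2.2).im ∧
        (logRate G μ₀ k A' x.1 x.2.1 x.2.2).im ≤ 2 * μ₀) ∧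
      slopeDeriv G μ₀ k A' x.1 x.2.1 x.2.2 ≤ -(m * x.1 ^ (2 * k)) ∧
      |slopeDeriv G μ₀ k A' x.1 x.2.1 x.2.2| ≤ 1 ∧
      |(logRateDeriv G μ₀ k A' x.1 x.2.1 x.2.2).im| ≤ 1 ∧
      |slopeField G μ₀ k A' x.1 x.2.1 x.2.2| ≤ 1 := by
  have hμ := h.μ₀_pos
  have hk : (0 : ℝ) < k := by exact_mod_cast h.one_le
  have hc := h.re_neg
  -- The scaled numerator of the slope's derivative has limit at most `-2κ` on the strip, the worst
  -- case being `σ₁`. An error below `κ` leaves `-κ`, and the squared angular speed is at most `4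
  -- μ₀²`; hence the rate `κ / (4 μ₀²)`.
  set κ := -(k * (C k).re * μ₀ * Real.exp (2 * k * σ₁)) with hκdef
  have hκ : 0 < κ := by
    have : 0 < k * (-(C k).re) * μ₀ * Real.exp (2 * k * σ₁) := by
      have := neg_pos.2 hc
      positivity
    linarith
  obtain ⟨M₁, hM₁⟩ := h.exists_abs_radial_div_le (σ₁ := σ₁) (σ₂ := σ₂)
  have hM₂ := abs_le_of_tendsto_sub (h.tendsto_slopeNumerator (σ₁ := σ₁) (σ₂ := σ₂))
    (eventually_exp_le k (2 * k * (C k).re * μ₀))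
  set M₂ := |2 * k * (C k).re * μ₀| * Real.exp (2 * k * σ₂) + 1
  have hsm : ∀ c : ℝ, ∀ᶠ x : ℝ × ℝ × ℝ in smallScale σ₁ σ₂, c * x.1 ^ (2 * k) < 1 := fun c =>
    ((h.tendsto_pow_scale (σ₁ := σ₁) (σ₂ := σ₂)).const_mul c).eventually
      (gt_mem_nhds (by simp))
  refine ⟨κ / (4 * μ₀ ^ 2), by positivity, ?_⟩
  have him := h.tendsto_logRateDeriv_im (σ₁ := σ₁) (σ₂ := σ₂)
  filter_upwards [eventually_mem_strip,
    (h.tendsto_logRate_im (σ₁ := σ₁) (σ₂ := σ₂)).eventually (Icc_mem_nhds (a := μ₀ / 2)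
      (b := 2 * μ₀) (by linarith) (by linarith)),
    (h.tendsto_slopeNumerator (σ₁ := σ₁) (σ₂ := σ₂)).eventually (gt_mem_nhds hκ), hM₁, hM₂,
    hsm (M₁ * (2 / μ₀)), hsm (M₂ * (4 / μ₀ ^ 2)),
    him.eventually (Icc_mem_nhds (a := -1) (b := 1) (by norm_num) (by norm_num))]
    with x hx hI hN hR hB hs1 hs2 hd
  have hD : 0 < x.1 ^ (2 * k) := pow_pos hx.1 _
  have hIpos : 0 < (logRate G μ₀ k A' x.1 x.2.1 x.2.2).im := by linarith [hI.1]
  have hexp : Real.exp (2 * k * σ₁) ≤ Real.exp (2 * k * x.2.2) := Real.exp_le_exp.2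
    (mul_le_mul_of_nonneg_left hx.2.1 (by positivity))
  have hI2 : (logRate G μ₀ k A' x.1 x.2.1 x.2.2).im ^ 2 ≤ 4 * μ₀ ^ 2 := by nlinarith [hI.2]
  have hI3 : μ₀ ^ 2 / 4 ≤ (logRate G μ₀ k A' x.1 x.2.1 x.2.2).im ^ 2 := by nlinarith [hI.1]
  refine ⟨hI, ?_, ?_, abs_le.2 hd, ?_⟩
  · rw [slopeDeriv, div_le_iff₀ (pow_pos hIpos 2)]
    have h1 : 2 * k * (C k).re * μ₀ * Real.exp (2 * k * x.2.2) ≤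
        2 * k * (C k).re * μ₀ * Real.exp (2 * k * σ₁) :=
      mul_le_mul_of_nonpos_left hexp (by
        have : 0 ≤ 2 * k * (-(C k).re) * μ₀ := by
          have := neg_pos.2 hc
          positivity
        linarith)
    have h2 := hN
    rw [sub_lt_iff_lt_add, div_lt_iff₀ hD] at h2
    refine h2.le.trans ?_
    have h3 : κ + 2 * k * (C k).re * μ₀ * Real.exp (2 * k * x.2.2) ≤ -κ := by
      rw [hκdef] at *
      linarith
    have h4 : κ / (4 * μ₀ ^ 2) * (logRate G μ₀ k A' x.1 x.2.1 x.2.2).im ^ 2 ≤ κ := by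
      rw [div_mul_eq_mul_div, div_le_iff₀ (by positivity)]
      exact mul_le_mul_of_nonneg_left hI2 hκ.le
    calc _ ≤ -κ * x.1 ^ (2 * k) := mul_le_mul_of_nonneg_right h3 hD.le
      _ ≤ _ := by nlinarith
  · rw [abs_div, abs_of_pos hD, div_le_iff₀ hD] at hB
    rw [slopeDeriv, abs_div, abs_of_pos (pow_pos hIpos 2), div_le_one (pow_pos hIpos 2)]
    refine hB.trans (le_trans ?_ hI3)
    have h5 : M₂ * x.1 ^ (2 * k) = M₂ * (4 / μ₀ ^ 2) * x.1 ^ (2 * k) * (μ₀ ^ 2 / 4) := by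
      field_simp
    rw [h5]
    nlinarith [sq_nonneg μ₀, pow_pos hμ 2]
  · rw [abs_div, abs_of_pos hD, div_le_iff₀ hD] at hR
    have h6 : slopeField G μ₀ k A' x.1 x.2.1 x.2.2 =
        ((logRate G μ₀ k A' x.1 x.2.1 x.2.2).re - (logRate G μ₀ k A' x.1 x.2.1 x.2.2).im *
        (oscillation (scaledAnti G k A' x.1) x.2.1 / μ₀)) /
          (logRate G μ₀ k A' x.1 x.2.1 x.2.2).im := by
      rw [slopeField, sub_div, mul_div_cancel_left₀ _ hIpos.ne']
    rw [h6, abs_div, abs_of_pos hIpos, div_le_one hIpos]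
    refine hR.trans (le_trans ?_ hI.1)
    have h7 : M₁ * x.1 ^ (2 * k) = M₁ * (2 / μ₀) * x.1 ^ (2 * k) * (μ₀ / 2) := by
      field_simp
    rw [h7]
    nlinarith

/-- The sign of the slope is that of its limit, if this does not vanish at `σ`. -/
theorem eventually_slopeField_sign (h : HopfNormalForm G μ₀ k C A A') {σ : ℝ}
    (hσ : σ ∈ Icc σ₁ σ₂) :
    (0 < |A'| + (C k).re * Real.exp (2 * k * σ) →
      ∀ᶠ ε in 𝓝[>] 0, ∀ θ, 0 < slopeField G μ₀ k A' ε θ σ) ∧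
    (|A'| + (C k).re * Real.exp (2 * k * σ) < 0 →
      ∀ᶠ ε in 𝓝[>] 0, ∀ θ, slopeField G μ₀ k A' ε θ σ < 0) := by
  have key : ∀ ε θ, 0 < ε → 0 < (logRate G μ₀ k A' ε θ σ).im →
      slopeField G μ₀ k A' ε θ σ = ((logRate G μ₀ k A' ε θ σ).re -
        (logRate G μ₀ k A' ε θ σ).im * (oscillation (scaledAnti G k A' ε) θ / μ₀)) /
        ε ^ (2 * k) * (ε ^ (2 * k) / (logRate G μ₀ k A' ε θ σ).im) := fun ε θ hε hI => by
    have := (pow_pos hε (2 * k)).ne'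
    rw [div_mul_div_cancel₀ this, slopeField, sub_div, mul_div_cancel_left₀ _ hI.ne']
  have him := eventually_smallScale.1 ((h.tendsto_logRate_im (σ₁ := σ₁) (σ₂ := σ₂)).eventually
    (lt_mem_nhds h.μ₀_pos))
  have hrad := h.tendsto_radial (σ₁ := σ₁) (σ₂ := σ₂)
  constructor <;> intro hs
  · have h1 := eventually_smallScale.1 (hrad.eventually (lt_mem_nhds (neg_lt_zero.2 hs)))
    filter_upwards [him, h1, self_mem_nhdsWithin] with ε hI h1 (hε : 0 < ε) θ
    rw [key ε θ hε (hI θ σ hσ)]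
    refine mul_pos ?_ (div_pos (pow_pos hε _) (hI θ σ hσ))
    linarith [h1 θ σ hσ]
  · have h1 := eventually_smallScale.1 (hrad.eventually (gt_mem_nhds (neg_pos.2 hs)))
    filter_upwards [him, h1, self_mem_nhdsWithin] with ε hI h1 (hε : 0 < ε) θ
    rw [key ε θ hε (hI θ σ hσ)]
    refine mul_neg_of_neg_of_pos ?_ (div_pos (pow_pos hε _) (hI θ σ hσ))
    linarith [h1 θ σ hσ]

end HopfNormalForm

/-! ### Regularity in the scaled polar coordinates -/

section Regularity

variable {G : ℂ × ℝ → ℂ} {μ₀ : ℝ} {k : ℕ} {A' : ℝ}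

theorem polar_eq_exp (μ₀ : ℝ) (b : ℂ) (ε θ σ : ℝ) :
    polar μ₀ b ε θ σ = ε * Complex.exp ((σ + shear μ₀ b θ : ℝ) + θ * Complex.I) := by
  rw [polar, Complex.exp_add]
  push_cast
  ring

/-- The velocity of a curve in scaled polar coordinates. -/
theorem hasDerivAt_polar {μ₀ : ℝ} {b : ℂ} {ε : ℝ} {x y : ℝ → ℝ} {x' y' t : ℝ}
    (hx : HasDerivAt x x' t) (hy : HasDerivAt y y' t) :
    HasDerivAt (fun u => polar μ₀ b ε (x u) (y u)) (polar μ₀ b ε (x t) (y t) *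
      (((y' + oscillation b (x t) / μ₀ * x' : ℝ) : ℂ) + x' * Complex.I)) t := by
  simp only [polar_eq_exp]
  have h1 := ((hy.add ((hasDerivAt_shear μ₀ b (x t)).comp t hx)).ofReal_comp).add
    (hx.ofReal_comp.mul_const Complex.I)
  refine (h1.cexp.const_mul (ε : ℂ)).congr_deriv ?_
  simp only [Pi.add_apply, Function.comp_apply]
  ring

theorem hasDerivAt_scaledPoint (G : ℂ × ℝ → ℂ) (μ₀ : ℝ) (k : ℕ) (A' ε θ σ : ℝ) :
    HasDerivAt (fun σ => scaledPoint G μ₀ k A' ε θ σ) (scaledPoint G μ₀ k A' ε θ σ) σ := by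
  have := hasDerivAt_polar (μ₀ := μ₀) (b := scaledAnti G k A' ε) (ε := ε)
    (hasDerivAt_const σ θ) (hasDerivAt_id σ)
  simpa [scaledPoint] using this

/-- Since `dz/dσ = z`, differentiation in σ is radial differentiation in the plane. -/
theorem hasDerivAt_logRate {ε θ σ : ℝ} (hε : 0 < ε)
    (hG : DifferentiableAt ℝ G (scaledPoint G μ₀ k A' ε θ σ, scaledParam k A' ε)) :
    HasDerivAt (fun σ => logRate G μ₀ k A' ε θ σ) (logRateDeriv G μ₀ k A' ε θ σ) σ := by
  have hz : scaledPoint G μ₀ k A' ε θ σ ≠ 0 := polar_ne_zero _ _ hε _ _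
  have h1 := hasDerivAt_scaledPoint G μ₀ k A' ε θ σ
  have h2 := (hasFDerivAt_slice hG).comp_hasDerivAt σ h1
  refine (h2.div h1 hz).congr_deriv ?_
  rw [logRateDeriv]
  simp only [Function.comp_apply]
  field_simp

theorem hasDerivAt_slopeField {ε θ σ : ℝ} (hε : 0 < ε)
    (hG : DifferentiableAt ℝ G (scaledPoint G μ₀ k A' ε θ σ, scaledParam k A' ε))
    (him : (logRate G μ₀ k A' ε θ σ).im ≠ 0) :
    HasDerivAt (fun σ => slopeField G μ₀ k A' ε θ σ) (slopeDeriv G μ₀ k A' ε θ σ) σ := by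
  have h1 := hasDerivAt_logRate hε hG
  have hre := Complex.reCLM.hasFDerivAt.comp_hasDerivAt σ h1
  have hi := Complex.imCLM.hasFDerivAt.comp_hasDerivAt σ h1
  exact (hre.div hi him).sub_const _

theorem hasDerivAt_logRate_im {ε θ σ : ℝ} (hε : 0 < ε)
    (hG : DifferentiableAt ℝ G (scaledPoint G μ₀ k A' ε θ σ, scaledParam k A' ε)) :
    HasDerivAt (fun σ => (logRate G μ₀ k A' ε θ σ).im) (logRateDeriv G μ₀ k A' ε θ σ).im σ :=
  Complex.imCLM.hasFDerivAt.comp_hasDerivAt σ (hasDerivAt_logRate hε hG)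

theorem continuous_scaledParam (k : ℕ) (A' : ℝ) : Continuous (scaledParam k A') := by
  unfold scaledParam
  fun_prop

theorem continuousAt_scaledAnti {ε : ℝ} (hG : ContDiffAt ℝ 2 G (0, scaledParam k A' ε)) :
    ContinuousAt (scaledAnti G k A') ε := by
  have h1 : ContinuousAt (sliceDeriv G) (0, scaledParam k A' ε) :=
    (((hG.fderiv_right (m := 1) (by norm_num)).continuousAt)).clm_comp continuousAt_const
  have h2 : ContinuousAt (fun ε => sliceDeriv G (0, scaledParam k A' ε)) ε :=
    ContinuousAt.comp (f := fun ε => ((0 : ℂ), scaledParam k A' ε)) h1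
      (continuous_const.prodMk (continuous_scaledParam k A')).continuousAt
  unfold scaledAnti antiPart
  fun_prop

theorem continuousAt_shear {x : ℝ × ℝ × ℝ} (hb : ContinuousAt (scaledAnti G k A') x.1) :
    ContinuousAt (fun x : ℝ × ℝ × ℝ => shear μ₀ (scaledAnti G k A' x.1) x.2.1) x := by
  have h1 : ContinuousAt (fun x : ℝ × ℝ × ℝ => scaledAnti G k A' x.1) x :=
    ContinuousAt.comp (f := Prod.fst) hb continuousAt_fst
  have h2 : ContinuousAt (fun x : ℝ × ℝ × ℝ => scaledAnti G k A' x.1 *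
      Complex.exp (-(2 * x.2.1 * Complex.I)) * Complex.I) x := by fun_prop
  exact (Complex.continuous_re.continuousAt.comp h2).div_const _

theorem continuousAt_oscillation {x : ℝ × ℝ × ℝ} (hb : ContinuousAt (scaledAnti G k A') x.1) :
    ContinuousAt (fun x : ℝ × ℝ × ℝ => oscillation (scaledAnti G k A' x.1) x.2.1) x := by
  have h1 : ContinuousAt (fun x : ℝ × ℝ × ℝ => scaledAnti G k A' x.1) x :=
    ContinuousAt.comp (f := Prod.fst) hb continuousAt_fst
  have h2 : ContinuousAt (fun x : ℝ × ℝ × ℝ => scaledAnti G k A' x.1 *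
      Complex.exp (-(2 * x.2.1 * Complex.I))) x := by fun_prop
  exact Complex.continuous_re.continuousAt.comp h2

theorem continuousAt_scaledPoint {x : ℝ × ℝ × ℝ} (hb : ContinuousAt (scaledAnti G k A') x.1) :
    ContinuousAt (fun x : ℝ × ℝ × ℝ => scaledPoint G μ₀ k A' x.1 x.2.1 x.2.2) x := by
  have h1 := continuousAt_shear (μ₀ := μ₀) hb
  unfold scaledPoint polar
  fun_prop

theorem continuousAt_logRate {x : ℝ × ℝ × ℝ} (hε : 0 < x.1)
    (hb : ContinuousAt (scaledAnti G k A') x.1)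
    (hG : ContinuousAt G (scaledPoint G μ₀ k A' x.1 x.2.1 x.2.2, scaledParam k A' x.1)) :
    ContinuousAt (fun x : ℝ × ℝ × ℝ => logRate G μ₀ k A' x.1 x.2.1 x.2.2) x := by
  have h1 := continuousAt_scaledPoint (μ₀ := μ₀) hb
  have h2 : ContinuousAt (fun x : ℝ × ℝ × ℝ => scaledParam k A' x.1) x :=
    ((continuous_scaledParam k A').comp continuous_fst).continuousAt
  exact (ContinuousAt.comp (f := fun x : ℝ × ℝ × ℝ =>
    (scaledPoint G μ₀ k A' x.1 x.2.1 x.2.2, scaledParam k A' x.1)) hG (h1.prodMk h2)).div h1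
    (polar_ne_zero _ _ hε _ _)

theorem continuousAt_slopeField {x : ℝ × ℝ × ℝ} (hε : 0 < x.1)
    (hb : ContinuousAt (scaledAnti G k A') x.1)
    (hG : ContinuousAt G (scaledPoint G μ₀ k A' x.1 x.2.1 x.2.2, scaledParam k A' x.1))
    (him : (logRate G μ₀ k A' x.1 x.2.1 x.2.2).im ≠ 0) :
    ContinuousAt (fun x : ℝ × ℝ × ℝ => slopeField G μ₀ k A' x.1 x.2.1 x.2.2) x := by
  have h1 := continuousAt_logRate (μ₀ := μ₀) hε hb hG
  exact ((Complex.continuous_re.continuousAt.comp h1).div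
    (Complex.continuous_im.continuousAt.comp h1) him).sub
    ((continuousAt_oscillation hb).div_const _)

theorem scaledPoint_add_two_pi (G : ℂ × ℝ → ℂ) (μ₀ : ℝ) (k : ℕ) (A' ε θ σ : ℝ) :
    scaledPoint G μ₀ k A' ε (θ + 2 * Real.pi) σ = scaledPoint G μ₀ k A' ε θ σ :=
  polar_add_two_pi _ _ _ _ _

theorem logRate_add_two_pi (G : ℂ × ℝ → ℂ) (μ₀ : ℝ) (k : ℕ) (A' ε θ σ : ℝ) :
    logRate G μ₀ k A' ε (θ + 2 * Real.pi) σ = logRate G μ₀ k A' ε θ σ := by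
  rw [logRate, logRate, scaledPoint_add_two_pi]

theorem slopeField_add_two_pi (G : ℂ × ℝ → ℂ) (μ₀ : ℝ) (k : ℕ) (A' ε θ σ : ℝ) :
    slopeField G μ₀ k A' ε (θ + 2 * Real.pi) σ = slopeField G μ₀ k A' ε θ σ := by
  rw [slopeField, slopeField, logRate_add_two_pi, oscillation_add_two_pi]

end Regularity

/-! ### The clamped equation -/

/-- A function of `(θ, σ)` on the strip, extended to all `σ` by clamping. -/
noncomputable def clamp {σ₁ σ₂ : ℝ} (hσ : σ₁ ≤ σ₂) (q : ℝ → ℝ → ℝ) (θ σ : ℝ) : ℝ :=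
  q θ (projIcc σ₁ σ₂ hσ σ)

theorem clamp_of_mem {σ₁ σ₂ : ℝ} (hσ : σ₁ ≤ σ₂) (q : ℝ → ℝ → ℝ) (θ : ℝ) {σ : ℝ}
    (h : σ ∈ Icc σ₁ σ₂) : clamp hσ q θ σ = q θ σ := by
  rw [clamp, projIcc_of_mem hσ h]

theorem clamp_lipschitz {σ₁ σ₂ : ℝ} (hσ : σ₁ ≤ σ₂) {q q' : ℝ → ℝ → ℝ} {L : ℝ} (hL : 0 ≤ L)
    (hd : ∀ θ, ∀ σ ∈ Icc σ₁ σ₂, HasDerivAt (q θ) (q' θ σ) σ)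
    (hb : ∀ θ, ∀ σ ∈ Icc σ₁ σ₂, |q' θ σ| ≤ L) (θ x y : ℝ) :
    |clamp hσ q θ x - clamp hσ q θ y| ≤ L * |x - y| := by
  have h1 := (convex_Icc σ₁ σ₂).norm_image_sub_le_of_norm_hasDerivWithin_le
    (fun σ h => (hd θ σ h).hasDerivWithinAt) (fun σ h => hb θ σ h)
    (projIcc σ₁ σ₂ hσ y).2 (projIcc σ₁ σ₂ hσ x).2
  exact h1.trans (mul_le_mul_of_nonneg_left (abs_projIcc_sub_projIcc hσ) hL)

/-- Estimates are available on the strip only. Clamping makes them global, so that solutions exist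
for all angles; by forward invariance, solutions starting in the strip still solve the original
equation for larger angles. -/
theorem isCylinderField_clamp {q q' Ω Ω' : ℝ → ℝ → ℝ} {σ₁ σ₂ m w₀ w₁ : ℝ} (hσ : σ₁ < σ₂)
    (hm : 0 < m) (hw : 0 < w₀)
    (hqc : ContinuousOn (fun x : ℝ × ℝ => q x.1 x.2) (univ ×ˢ Icc σ₁ σ₂))
    (hΩc : ContinuousOn (fun x : ℝ × ℝ => Ω x.1 x.2) (univ ×ˢ Icc σ₁ σ₂))
    (hqp : ∀ θ σ, q (θ + 2 * Real.pi) σ = q θ σ) (hΩp : ∀ θ σ, Ω (θ + 2 * Real.pi) σ = Ω θ σ)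
    (hqd : ∀ θ, ∀ σ ∈ Icc σ₁ σ₂, HasDerivAt (q θ) (q' θ σ) σ)
    (hΩd : ∀ θ, ∀ σ ∈ Icc σ₁ σ₂, HasDerivAt (Ω θ) (Ω' θ σ) σ)
    (hqb : ∀ θ, ∀ σ ∈ Icc σ₁ σ₂, |q' θ σ| ≤ 1) (hΩb : ∀ θ, ∀ σ ∈ Icc σ₁ σ₂, |Ω' θ σ| ≤ 1)
    (hb : ∀ θ, ∀ σ ∈ Icc σ₁ σ₂, |q θ σ| ≤ 1)
    (hΩ : ∀ θ, ∀ σ ∈ Icc σ₁ σ₂, w₀ ≤ Ω θ σ ∧ Ω θ σ ≤ w₁)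
    (hl : ∀ θ, 0 < q θ σ₁) (hr : ∀ θ, q θ σ₂ < 0)
    (hcon : ∀ θ, ∀ σ ∈ Icc σ₁ σ₂, q' θ σ ≤ -m) :
    IsCylinderField (clamp hσ.le q) (clamp hσ.le Ω) σ₁ σ₂ m 1 w₀ w₁ := by
  have hproj : Continuous fun x : ℝ × ℝ => (x.1, (projIcc σ₁ σ₂ hσ.le x.2 : ℝ)) :=
    continuous_fst.prodMk (continuous_subtype_val.comp (continuous_projIcc.comp continuous_snd))
  have hmem : ∀ x : ℝ × ℝ, (x.1, (projIcc σ₁ σ₂ hσ.le x.2 : ℝ)) ∈ univ ×ˢ Icc σ₁ σ₂ := fun x =>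
    ⟨trivial, (projIcc σ₁ σ₂ hσ.le x.2).2⟩
  exact
  { lt := hσ
    m_pos := hm
    L_nonneg := zero_le_one
    w₀_pos := hw
    q_continuous := hqc.comp_continuous hproj hmem
    Ω_continuous := hΩc.comp_continuous hproj hmem
    q_periodic := fun θ σ => hqp _ _
    Ω_periodic := fun θ σ => hΩp _ _
    q_lipschitz := clamp_lipschitz hσ.le zero_le_one hqd hqb
    Ω_lipschitz := clamp_lipschitz hσ.le zero_le_one hΩd hΩb
    q_bounded := fun θ x => hb _ _ (projIcc σ₁ σ₂ hσ.le x).2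
    Ω_bounds := fun θ x => hΩ _ _ (projIcc σ₁ σ₂ hσ.le x).2
    q_left := fun θ => by
      rw [clamp_of_mem _ _ _ (left_mem_Icc.2 hσ.le)]
      exact hl θ
    q_right := fun θ => by
      rw [clamp_of_mem _ _ _ (right_mem_Icc.2 hσ.le)]
      exact hr θ
    q_contract := fun θ x y hy hyx hx => by
      have hx' : x ∈ Icc σ₁ σ₂ := ⟨hy.trans hyx, hx⟩
      have hy' : y ∈ Icc σ₁ σ₂ := ⟨hy, hyx.trans hx⟩
      rw [clamp_of_mem _ _ _ hx', clamp_of_mem _ _ _ hy']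
      refine (convex_Icc σ₁ σ₂).image_sub_le_mul_sub_of_deriv_le
        (fun σ h => (hqd θ σ h).continuousAt.continuousWithinAt) (fun σ h =>
          (hqd θ σ (interior_subset h)).differentiableAt.differentiableWithinAt) (fun σ h => ?_)
        y hy' x hx' hyx
      rw [(hqd θ σ (interior_subset h)).deriv]
      exact hcon θ σ (interior_subset h) }

/-! ### The branch of periodic solutions -/

section Branch

variable {E : Type*} [NormedAddCommGroup E] [NormedSpace ℝ E]

/-- At the point `z`, the inverse chart `e.symm` maps the vector field `G (·, α)` to `F α`. -/
def IsTransportedAt (e : OpenPartialHomeomorph E ℂ) (F : ℝ → E → E) (G : ℂ × ℝ → ℂ)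
    (p : ℂ × ℝ) : Prop :=
  p.1 ∈ e.target ∧ ∃ l : ℂ →L[ℝ] E, HasFDerivAt e.symm l p.1 ∧ l (G p) = F p.2 (e.symm p.1)

theorem continuous_shear (μ₀ : ℝ) (b : ℂ) : Continuous (shear μ₀ b) :=
  continuous_iff_continuousAt.2 fun θ => (hasDerivAt_shear μ₀ b θ).continuousAt

theorem continuous_polar (μ₀ : ℝ) (b : ℂ) (ε : ℝ) :
    Continuous fun x : ℝ × ℝ => polar μ₀ b ε x.1 x.2 := by
  have := continuous_shear μ₀ b
  unfold polar
  fun_prop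

/-- Logarithmic coordinates on the cylinder. -/
noncomputable def logCoord (μ₀ : ℝ) (b : ℂ) : ℝ × ℝ ≃ₜ ℂ where
  toFun x := (x.2 + shear μ₀ b x.1 : ℝ) + x.1 * Complex.I
  invFun w := (w.im, w.re - shear μ₀ b w.im)
  left_inv x := by simp
  right_inv w := by simp [Complex.re_add_im]
  continuous_toFun := by
    have := continuous_shear μ₀ b
    fun_prop
  continuous_invFun := by
    have h1 : Continuous fun w : ℂ => shear μ₀ b w.im :=
      (continuous_shear μ₀ b).comp Complex.continuous_im
    exact Complex.continuous_im.prodMk (Complex.continuous_re.sub h1)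

theorem isOpenMap_polar (μ₀ : ℝ) (b : ℂ) {ε : ℝ} (hε : 0 < ε) :
    IsOpenMap fun x : ℝ × ℝ => polar μ₀ b ε x.1 x.2 := by
  have hne : (ε : ℂ) ≠ 0 := by exact_mod_cast hε.ne'
  have h := (Homeomorph.mulLeft₀ (ε : ℂ) hne).isOpenMap.comp (Complex.isOpenMap_exp.comp (logCoord μ₀ b).isOpenMap)
  convert h using 1
  funext x
  exact polar_eq_exp _ _ _ _ _

theorem polar_angle (μ₀ : ℝ) (b : ℂ) {ε : ℝ} (hε : 0 < ε) {θ θ' σ σ' : ℝ}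
    (h : polar μ₀ b ε θ σ = polar μ₀ b ε θ' σ') : ∃ n : ℤ, θ - θ' = n * (2 * Real.pi) := by
  rw [polar_eq_exp, polar_eq_exp] at h
  have hne : (ε : ℂ) ≠ 0 := by exact_mod_cast hε.ne'
  obtain ⟨n, hn⟩ := Complex.exp_eq_exp_iff_exists_int.1 (mul_left_cancel₀ hne h)
  have him := congrArg Complex.im hn
  refine ⟨n, ?_⟩
  simp at him
  linarith

theorem isCylinderChart_scaledPoint {e : OpenPartialHomeomorph E ℂ} {F : ℝ → E → E}
    {G : ℂ × ℝ → ℂ} {μ₀ : ℝ} {k : ℕ} {A' ε σ₁ σ₂ : ℝ} (hε : 0 < ε) (hσ : σ₁ < σ₂)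
    (hF : ∀ θ, ∀ σ ∈ Icc σ₁ σ₂,
      IsTransportedAt e F G (scaledPoint G μ₀ k A' ε θ σ, scaledParam k A' ε))
    (him : ∀ θ, ∀ σ ∈ Icc σ₁ σ₂, (logRate G μ₀ k A' ε θ σ).im ≠ 0) :
    IsCylinderChart (F (scaledParam k A' ε))
      (fun x => e.symm (scaledPoint G μ₀ k A' ε x.1 x.2))
      (clamp hσ.le (slopeField G μ₀ k A' ε)) (clamp hσ.le fun θ σ => (logRate G μ₀ k A' ε θ σ).im)
      σ₁ σ₂ where
  continuousOn := e.symm.continuousOn.comp (continuous_polar _ _ _).continuousOn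
    fun x hx => (hF x.1 x.2 hx.2).1
  periodic θ σ := by simp only [scaledPoint_add_two_pi]
  nhds_le θ σ hσ' := by
    have h1 := (hF θ σ (Ioo_subset_Icc_self hσ')).1
    have h2 := e.symm.map_nhds_eq h1
    rw [← h2]
    exact (map_mono ((isOpenMap_polar μ₀ (scaledAnti G k A' ε) hε).nhds_le (θ, σ))).trans
      (map_map (f := 𝓝 (θ, σ)) (m := fun x : ℝ × ℝ => scaledPoint G μ₀ k A' ε x.1 x.2)
        (m' := e.symm)).le
  hasDerivAt x y t hx hy hmem := by
    rw [clamp_of_mem _ _ _ hmem] at hx hy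
    rw [clamp_of_mem _ _ _ hmem] at hy
    obtain ⟨-, l, hl, hlG⟩ := hF (x t) (y t) hmem
    have hz : scaledPoint G μ₀ k A' ε (x t) (y t) ≠ 0 := polar_ne_zero _ _ hε _ _
    have h1 : HasDerivAt (fun u => scaledPoint G μ₀ k A' ε (x u) (y u))
        (G (scaledPoint G μ₀ k A' ε (x t) (y t), scaledParam k A' ε)) t := by
      -- The oscillation term subtracted in `slopeField` is the one that differentiating the shear
      -- adds back, so the velocity is `z` times the full `ż / z`.
      refine (hasDerivAt_polar hx hy).congr_deriv ?_
      have h2 : G (scaledPoint G μ₀ k A' ε (x t) (y t), scaledParam k A' ε) =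
          scaledPoint G μ₀ k A' ε (x t) (y t) * logRate G μ₀ k A' ε (x t) (y t) := by
        rw [logRate, mul_div_cancel₀ _ hz]
      rw [h2]
      refine congrArg (scaledPoint G μ₀ k A' ε (x t) (y t) * ·) ?_
      have h3 := him (x t) (y t) hmem
      conv_rhs => rw [← Complex.re_add_im (logRate G μ₀ k A' ε (x t) (y t))]
      congr 2
      rw [slopeField]
      field_simp
      ring
    have h4 := hl.comp_hasDerivAt t h1
    rw [hlG] at h4
    exact h4
  angle θ θ' σ σ' hs hs' heq :=
    polar_angle _ _ hε (e.symm.injOn (hF θ σ hs).1 (hF θ' σ' hs').1 heq)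

/-- The scale of the periodic orbit for the parameter `α`. -/
noncomputable def orbitScale (k : ℕ) (α : ℝ) : ℝ := |α| ^ (((2 * k : ℕ) : ℝ)⁻¹)

theorem orbitScale_pow {k : ℕ} (hk : 1 ≤ k) (α : ℝ) : orbitScale k α ^ (2 * k) = |α| :=
  Real.rpow_inv_natCast_pow (abs_nonneg _) (by omega)

theorem scaledParam_orbitScale {k : ℕ} (hk : 1 ≤ k) {α A' : ℝ} (h : 0 < α * A') :
    scaledParam k A' (orbitScale k α) = α := by
  rw [scaledParam, orbitScale_pow hk]
  rcases pos_and_pos_or_neg_and_neg_of_mul_pos h with ⟨h1, h2⟩ | ⟨h1, h2⟩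
  · rw [abs_of_pos h1, abs_of_pos h2, div_self h2.ne', one_mul]
  · rw [abs_of_neg h1, abs_of_neg h2, div_neg, div_self h2.ne, neg_one_mul, neg_neg]

theorem continuous_orbitScale (k : ℕ) : Continuous (orbitScale k) :=
  Real.continuous_rpow_const (by positivity) |>.comp continuous_abs

/-- The family of vector fields `F α` has a branch of stable periodic solutions, if in the chart `e`
it is a perturbed normal form. -/
theorem HopfNormalForm.exists_stable_branch {e : OpenPartialHomeomorph E ℂ} {F : ℝ → E → E}
    {G : ℂ × ℝ → ℂ} {μ₀ : ℝ} {k : ℕ} {C : ℕ → ℂ} {A : ℝ → ℝ} {A' : ℝ}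
    (h : HopfNormalForm G μ₀ k C A A') (hF : ∀ α, LocallyLipschitz (F α))
    (he : ∀ᶠ p in 𝓝 (0 : ℂ × ℝ), IsTransportedAt e F G p) (he0 : e.symm 0 = 0) :
    ∃ α₀ > 0, ∃ ψ : ℝ → ℝ → E,
      (∀ α, |α| < α₀ → 0 < α * A' → IsStablePeriodicSolution (F α) (ψ α)) ∧
      BifurcatesFromOrigin {α | |α| < α₀ ∧ 0 < α * A'} ψ := by
  have hk := h.one_le
  have hA' : 0 < |A'| := abs_pos.2 h.ne_zero
  have hc := h.re_neg
  have hk0 : (0 : ℝ) < k := by exact_mod_cast hk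
  -- The limit slope is positive far to the left and negative far to the right. The choice `σ₁ < 0 <
  -- σ₂` secures the order of the edges.
  obtain ⟨σ₁, σ₂, hσ, hσ₁, hσ₂⟩ : ∃ σ₁ σ₂ : ℝ, σ₁ < σ₂ ∧
      0 < |A'| + (C k).re * Real.exp (2 * k * σ₁) ∧
      |A'| + (C k).re * Real.exp (2 * k * σ₂) < 0 := by
    have hlim1 : Tendsto (fun σ : ℝ => |A'| + (C k).re * Real.exp (2 * k * σ)) atBot
        (𝓝 (|A'| + (C k).re * 0)) :=
      ((Real.tendsto_exp_atBot.comp (tendsto_id.const_mul_atBot (by positivity))).const_mul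
        _).const_add _
    have hlim2 : Tendsto (fun σ : ℝ => |A'| + (C k).re * Real.exp (2 * k * σ)) atTop atBot :=
      tendsto_atBot_add_const_left _ _ ((Real.tendsto_exp_atTop.comp
        (tendsto_id.const_mul_atTop (by positivity))).const_mul_atTop_of_neg hc)
    obtain ⟨σ₁, h1, h1'⟩ := ((hlim1.eventually (lt_mem_nhds (a := 0) (by simpa using hA'))).and
      (eventually_lt_atBot 0)).exists
    obtain ⟨σ₂, h2, h2'⟩ := ((hlim2.eventually (eventually_lt_atBot 0)).and
      (eventually_gt_atTop 0)).exists
    exact ⟨σ₁, σ₂, h1'.trans h2', h1, h2⟩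
  obtain ⟨m, hm, hest⟩ := h.eventually_strip_estimates (σ₁ := σ₁) (σ₂ := σ₂)
  have hsm : ∀ᶠ p in 𝓝 (0 : ℂ × ℝ), ContDiffAt ℝ 2 G p :=
    (h.contDiffAt.of_le (m := 2) ENat.LEInfty.out).eventually (by simp)
  have hanti : ∀ᶠ ε in 𝓝[>] 0, ContDiffAt ℝ 2 G (0, scaledParam k A' ε) := by
    have : Tendsto (fun ε => ((0 : ℂ), scaledParam k A' ε)) (𝓝[>] 0) (𝓝 0) :=
      tendsto_const_nhds.prodMk_nhds (tendsto_scaledParam hk A')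
    exact this.eventually hsm
  have hpt := h.tendsto_scaledPoint_param (σ₁ := σ₁) (σ₂ := σ₂)
  obtain ⟨ε₀, hε₀, hall⟩ := (nhdsGT_basis (0 : ℝ)).eventually_iff.1
    (((eventually_smallScale.1 (hest.and (hpt.eventually (he.and hsm)))).and hanti).and
      (((h.eventually_slopeField_sign (left_mem_Icc.2 hσ.le)).1 hσ₁).and
        ((h.eventually_slopeField_sign (right_mem_Icc.2 hσ.le)).2 hσ₂)))
  have hμ := h.μ₀_pos
  set q : Ioo 0 ε₀ → ℝ → ℝ → ℝ := fun p => clamp hσ.le (slopeField G μ₀ k A' p) with hq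
  set Ω : Ioo 0 ε₀ → ℝ → ℝ → ℝ := fun p => clamp hσ.le fun θ σ => (logRate G μ₀ k A' p θ σ).im
    with hΩ
  have hbc : ∀ p : Ioo 0 ε₀, ContinuousAt (scaledAnti G k A') p := fun p =>
    continuousAt_scaledAnti (hall p.2).1.2
  have himpos : ∀ p : Ioo 0 ε₀, ∀ θ, ∀ σ ∈ Icc σ₁ σ₂, 0 < (logRate G μ₀ k A' p θ σ).im :=
    fun p θ σ hs => by linarith [((hall p.2).1.1 θ σ hs).1.1.1]
  have hκc : ∀ p : Ioo 0 ε₀, ∀ θ, ∀ σ ∈ Icc σ₁ σ₂,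
      ContinuousAt (fun x : ℝ × ℝ × ℝ => logRate G μ₀ k A' x.1 x.2.1 x.2.2) (p, θ, σ) :=
    fun p θ σ hs => continuousAt_logRate p.2.1 (hbc p)
      ((hall p.2).1.1 θ σ hs).2.2.continuousAt
  have hΩc : ∀ p : Ioo 0 ε₀, ∀ θ, ∀ σ ∈ Icc σ₁ σ₂,
      ContinuousAt (fun x : ℝ × ℝ × ℝ => (logRate G μ₀ k A' x.1 x.2.1 x.2.2).im) (p, θ, σ) :=
    fun p θ σ hs => Complex.continuous_im.continuousAt.comp (hκc p θ σ hs)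
  have hqc : ∀ p : Ioo 0 ε₀, ∀ θ, ∀ σ ∈ Icc σ₁ σ₂,
      ContinuousAt (fun x : ℝ × ℝ × ℝ => slopeField G μ₀ k A' x.1 x.2.1 x.2.2) (p, θ, σ) :=
    fun p θ σ hs => continuousAt_slopeField p.2.1 (hbc p)
      ((hall p.2).1.1 θ σ hs).2.2.continuousAt (himpos p θ σ hs).ne'
  have hpair : ∀ (p : Ioo 0 ε₀) (x : ℝ × ℝ),
      ContinuousAt (fun x : ℝ × ℝ => ((p : ℝ), x.1, x.2)) x := fun p x => by fun_prop
  have hfield : ∀ p : Ioo 0 ε₀, IsCylinderField (q p) (Ω p) σ₁ σ₂ (m * (p : ℝ) ^ (2 * k)) 1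
      (μ₀ / 2) (2 * μ₀) := by
    intro p
    have hp := hall p.2
    have hG : ∀ θ, ∀ σ ∈ Icc σ₁ σ₂,
        DifferentiableAt ℝ G (scaledPoint G μ₀ k A' p θ σ, scaledParam k A' p) := fun θ σ hs =>
      ((hp.1.1 θ σ hs).2.2).differentiableAt (by simp)
    refine isCylinderField_clamp (q' := slopeDeriv G μ₀ k A' p)
      (Ω' := fun θ σ => (logRateDeriv G μ₀ k A' p θ σ).im) hσ (mul_pos hm (pow_pos p.2.1 _))
      (by linarith)
      (fun x hx => ((hqc p x.1 x.2 hx.2).comp (f := fun x : ℝ × ℝ => ((p : ℝ), x.1, x.2))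
        (hpair p x)).continuousWithinAt)
      (fun x hx => ((hΩc p x.1 x.2 hx.2).comp (f := fun x : ℝ × ℝ => ((p : ℝ), x.1, x.2))
        (hpair p x)).continuousWithinAt)
      (fun θ σ => slopeField_add_two_pi _ _ _ _ _ _ _)
      (fun θ σ => by rw [logRate_add_two_pi])
      (fun θ σ hs => hasDerivAt_slopeField p.2.1 (hG θ σ hs) (himpos p θ σ hs).ne')
      (fun θ σ hs => hasDerivAt_logRate_im p.2.1 (hG θ σ hs))
      (fun θ σ hs => (hp.1.1 θ σ hs).1.2.2.1) (fun θ σ hs => (hp.1.1 θ σ hs).1.2.2.2.1)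
      (fun θ σ hs => (hp.1.1 θ σ hs).1.2.2.2.2) (fun θ σ hs => (hp.1.1 θ σ hs).1.1)
      hp.2.1 hp.2.2 (fun θ σ hs => (hp.1.1 θ σ hs).1.2.1)
  have hproj : Continuous fun x : Ioo 0 ε₀ × ℝ × ℝ =>
      ((x.1 : ℝ), x.2.1, (projIcc σ₁ σ₂ hσ.le x.2.2 : ℝ)) :=
    (continuous_subtype_val.comp continuous_fst).prodMk ((continuous_fst.comp
      continuous_snd).prodMk (continuous_subtype_val.comp (continuous_projIcc.comp
        (continuous_snd.comp continuous_snd))))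
  have hqj : Continuous fun x : Ioo 0 ε₀ × ℝ × ℝ => q x.1 x.2.1 x.2.2 :=
    continuous_iff_continuousAt.2 fun x => ContinuousAt.comp
      (f := fun x : Ioo 0 ε₀ × ℝ × ℝ => ((x.1 : ℝ), x.2.1, (projIcc σ₁ σ₂ hσ.le x.2.2 : ℝ)))
      (hqc x.1 x.2.1 _ (projIcc σ₁ σ₂ hσ.le x.2.2).2) hproj.continuousAt
  have hΩj : Continuous fun x : Ioo 0 ε₀ × ℝ × ℝ => Ω x.1 x.2.1 x.2.2 :=
    continuous_iff_continuousAt.2 fun x => ContinuousAt.comp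
      (f := fun x : Ioo 0 ε₀ × ℝ × ℝ => ((x.1 : ℝ), x.2.1, (projIcc σ₁ σ₂ hσ.le x.2.2 : ℝ)))
      (hΩc x.1 x.2.1 _ (projIcc σ₁ σ₂ hσ.le x.2.2).2) hproj.continuousAt
  obtain ⟨s, Θ, hs, hsp, hmem, hΘ₁, hΘ₂, hΘ₃, hΘ₄, hΘc⟩ :=
    exists_continuous_periodic hfield hqj hΩj
  have hchart : ∀ p : Ioo 0 ε₀, IsCylinderChart (F (scaledParam k A' p))
      (fun x => e.symm (scaledPoint G μ₀ k A' p x.1 x.2)) (q p) (Ω p) σ₁ σ₂ := fun p =>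
    isCylinderChart_scaledPoint p.2.1 hσ (fun θ σ hs => ((hall p.2).1.1 θ σ hs).2.1)
      (fun θ σ hs => (himpos p θ σ hs).ne')
  let φ : Ioo 0 ε₀ → ℝ → E := fun p t => e.symm (scaledPoint G μ₀ k A' p (Θ p t) (s p (Θ p t)))
  have hstable : ∀ p : Ioo 0 ε₀, IsStablePeriodicSolution (F (scaledParam k A' p)) (φ p) :=
    fun p => (hfield p).isStablePeriodicSolution (hchart p) (hF _) (hs p) (hsp p) (hmem p)
      (hΘ₁ p) (hΘ₂ p) (hΘ₃ p) (hΘ₄ p)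
  have hφc : Continuous fun x : Ioo 0 ε₀ × ℝ => φ x.1 x.2 := by
    refine continuous_iff_continuousAt.2 fun x => ?_
    have hIcc := Ioo_subset_Icc_self (hmem x.1 (Θ x.1 x.2))
    have h1 := ((hall x.1.2).1.1 (Θ x.1 x.2) _ hIcc).2.1.1
    have h2 : ContinuousAt (fun y : Ioo 0 ε₀ × ℝ =>
        ((y.1 : ℝ), Θ y.1 y.2, s y.1 (Θ y.1 y.2))) x :=
      ((continuous_subtype_val.comp continuous_fst).prodMk hΘc).continuousAt
    have h3 := ContinuousAt.comp
      (f := fun y : Ioo 0 ε₀ × ℝ => ((y.1 : ℝ), Θ y.1 y.2, s y.1 (Θ y.1 y.2)))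
      (continuousAt_scaledPoint (μ₀ := μ₀) (hbc x.1)) h2
    exact ContinuousAt.comp (f := fun y : Ioo 0 ε₀ × ℝ =>
      scaledPoint G μ₀ k A' y.1 (Θ y.1 y.2) (s y.1 (Θ y.1 y.2))) (e.symm.continuousAt h1) h3
  have hscale : ∀ α, |α| < ε₀ ^ (2 * k) → 0 < α * A' → orbitScale k α ∈ Ioo 0 ε₀ := by
    intro α hα hpos
    have hα0 : 0 < |α| := abs_pos.2 (left_ne_zero_of_mul hpos.ne')
    refine ⟨Real.rpow_pos_of_pos hα0 _, lt_of_pow_lt_pow_left₀ (2 * k) hε₀.le ?_⟩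
    rwa [orbitScale_pow hk]
  classical
  let ψ : ℝ → ℝ → E := fun α => if hα : orbitScale k α ∈ Ioo 0 ε₀ then φ ⟨_, hα⟩ else 0
  have hψ : ∀ α (hα : orbitScale k α ∈ Ioo 0 ε₀), ψ α = φ ⟨_, hα⟩ := fun α hα => dif_pos hα
  refine ⟨ε₀ ^ (2 * k), pow_pos hε₀ _, ψ, fun α hα hpos => ?_, ?_, ?_⟩
  · have h1 := hstable ⟨_, hscale α hα hpos⟩
    rw [scaledParam_orbitScale hk hpos] at h1
    rwa [hψ α (hscale α hα hpos)]
  · rw [continuousOn_iff_continuous_domRestrict]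
    let S : Set ℝ := {α | |α| < ε₀ ^ (2 * k) ∧ 0 < α * A'}
    let g : ↥(S ×ˢ (univ : Set ℝ)) → Ioo 0 ε₀ × ℝ := fun x =>
      (⟨orbitScale k x.1.1, hscale _ x.2.1.1 x.2.1.2⟩, x.1.2)
    have hg : Continuous g :=
      (Continuous.subtype_mk ((continuous_orbitScale k).comp (continuous_fst.comp
        continuous_subtype_val)) _).prodMk (continuous_snd.comp continuous_subtype_val)
    refine (hφc.comp hg).congr fun x => ?_
    simp only [domRestrict_apply, Function.comp_apply]
    rw [hψ x.1.1 (hscale _ x.2.1.1 x.2.1.2)]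
  · rw [Metric.tendstoUniformly_iff]
    intro δ hδ
    have h0 : (0 : ℂ) ∈ e.target := he.self_of_nhds.1
    have hcont : Tendsto e.symm (𝓝 0) (𝓝 0) := by
      have := (e.symm.continuousAt h0).tendsto
      rwa [he0] at this
    -- The whole strip, at all angles, shrinks to the origin with the scale; this makes the
    -- convergence uniform in time.
    have h1 := eventually_smallScale.1 (((hcont.comp (continuous_fst.tendsto (0 : ℂ × ℝ))).comp
      hpt).eventually (Metric.ball_mem_nhds (0 : E) hδ))
    have h2 : Tendsto (orbitScale k) (𝓝[{α | |α| < ε₀ ^ (2 * k) ∧ 0 < α * A'}] 0) (𝓝[>] 0) := by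
      refine tendsto_nhdsWithin_iff.2 ⟨tendsto_nhdsWithin_of_tendsto_nhds ?_, ?_⟩
      · have := (continuous_orbitScale k).tendsto 0
        have h3 : orbitScale k 0 = 0 := by
          rw [orbitScale, abs_zero, Real.zero_rpow (inv_ne_zero (by positivity))]
        rwa [h3] at this
      · filter_upwards [self_mem_nhdsWithin] with α hα using (hscale α hα.1 hα.2).1
    filter_upwards [h2.eventually h1, self_mem_nhdsWithin] with α hα hαS t
    have h4 := hscale α hαS.1 hαS.2
    rw [hψ α h4, dist_comm]
    exact hα (Θ ⟨_, h4⟩ t) _ (Ioo_subset_Icc_self (hmem _ _))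

end Branch

/-! ### Transport of vector fields to a chart -/

theorem symm_zero_of_zero {X Y : Type*} [TopologicalSpace X] [TopologicalSpace Y] [Zero X] [Zero Y]
    {e : OpenPartialHomeomorph X Y} (hs : 0 ∈ e.source) (h0 : e 0 = 0) : e.symm 0 = 0 := by
  simpa [h0] using e.left_inv hs

theorem zero_mem_target {X Y : Type*} [TopologicalSpace X] [TopologicalSpace Y] [Zero X] [Zero Y]
    {e : OpenPartialHomeomorph X Y} (hs : 0 ∈ e.source) (h0 : e 0 = 0) : 0 ∈ e.target := by
  simpa [h0] using e.map_source hs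

section Chart

variable {E : Type*} [NormedAddCommGroup E] [NormedSpace ℝ E]

theorem exists_chart [CompleteSpace E] {Φ : E → ℂ} (hΦ : ContDiffAt ℝ ∞ Φ 0) (hΦ0 : Φ 0 = 0)
    (hbij : Function.Bijective (fderiv ℝ Φ 0)) :
    ∃ e : OpenPartialHomeomorph E ℂ, ⇑e = Φ ∧ (0 : E) ∈ e.source ∧
      ContDiffAt ℝ ∞ e.symm 0 := by
  let L : E ≃L[ℝ] ℂ := ContinuousLinearEquiv.ofBijective (fderiv ℝ Φ 0)
    (LinearMap.ker_eq_bot.2 hbij.1) (LinearMap.range_eq_top.2 hbij.2)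
  have hL : HasFDerivAt Φ (L : E →L[ℝ] ℂ) 0 := by
    have h1 : (L : E →L[ℝ] ℂ) = fderiv ℝ Φ 0 := by ext; rfl
    rw [h1]
    exact (hΦ.differentiableAt (by simp)).hasFDerivAt
  let e := hΦ.toOpenPartialHomeomorph Φ hL (by simp)
  have he : (0 : E) ∈ e.source := hΦ.mem_toOpenPartialHomeomorph_source hL (by simp)
  have h0 : e.symm 0 = 0 := by
    have h1 := e.left_inv he
    have h2 : e 0 = 0 := hΦ0
    rwa [h2] at h1
  have ht : (0 : ℂ) ∈ e.target := by
    have h1 := e.map_source he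
    have h2 : e 0 = 0 := hΦ0
    rwa [h2] at h1
  refine ⟨e, rfl, he, e.contDiffAt_symm (f₀' := L) ht ?_ ?_⟩
  · rw [h0]; exact hL
  · rw [h0]; exact hΦ

/-- The vector field `F` in the chart `e`. -/
noncomputable def chartField (e : OpenPartialHomeomorph E ℂ) (F : ℝ → E → E) (p : ℂ × ℝ) : ℂ :=
  fderiv ℝ e (e.symm p.1) (F p.2 (e.symm p.1))

variable {e : OpenPartialHomeomorph E ℂ} {F : ℝ → E → E}

theorem contDiffAt_chartField (hs : (0 : E) ∈ e.source) (h0 : e 0 = 0)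
    (he : ContDiffAt ℝ ∞ e 0) (he' : ContDiffAt ℝ ∞ e.symm 0)
    (hF : ContDiff ℝ ∞ fun p : ℝ × E => F p.1 p.2) :
    ContDiffAt ℝ ∞ (chartField e F) 0 := by
  have h1 : ContDiffAt ℝ ∞ (fun p : ℂ × ℝ => e.symm p.1) 0 :=
    ContDiffAt.comp (0 : ℂ × ℝ) (g := e.symm) (f := Prod.fst) he' contDiffAt_fst
  have h2 : ContDiffAt ℝ ∞ (fderiv ℝ e) (e.symm ((0 : ℂ × ℝ).1)) := by
    rw [Prod.fst_zero, symm_zero_of_zero hs h0]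
    exact he.fderiv_right (m := ∞) (by simp)
  have h3 : ContDiffAt ℝ ∞ (fun p : ℂ × ℝ => fderiv ℝ e (e.symm p.1)) 0 :=
    ContDiffAt.comp (0 : ℂ × ℝ) h2 h1
  have h4 : ContDiffAt ℝ ∞ (fun p : ℂ × ℝ => F p.2 (e.symm p.1)) 0 :=
    hF.contDiffAt.comp (0 : ℂ × ℝ) (contDiffAt_snd.prodMk h1)
  exact h3.clm_apply h4

/-- By the chain rule for `e.symm ∘ e = id`, the derivative of the inverse chart undoes the
derivative used in `chartField`. -/
theorem eventually_isTransportedAt (hs : (0 : E) ∈ e.source) (h0 : e 0 = 0)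
    (he : ContDiffAt ℝ ∞ e 0) (he' : ContDiffAt ℝ ∞ e.symm 0) :
    ∀ᶠ p in 𝓝 (0 : ℂ × ℝ), IsTransportedAt e F (chartField e F) p := by
  have ht := zero_mem_target hs h0
  have h1 : ∀ᶠ z in 𝓝 (0 : ℂ), z ∈ e.target ∧ DifferentiableAt ℝ e.symm z ∧
      DifferentiableAt ℝ e (e.symm z) := by
    have h2 : ∀ᶠ z in 𝓝 (0 : ℂ), DifferentiableAt ℝ e.symm z :=
      ((he'.of_le (by simp : (1 : WithTop ℕ∞) ≤ ∞)).eventually (by simp)).mono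
        fun z hz => hz.differentiableAt (by simp)
    have h3 : ∀ᶠ x in 𝓝 (0 : E), DifferentiableAt ℝ e x :=
      ((he.of_le (by simp : (1 : WithTop ℕ∞) ≤ ∞)).eventually (by simp)).mono
        fun z hz => hz.differentiableAt (by simp)
    have h4 : Tendsto e.symm (𝓝 0) (𝓝 0) := by
      have := he'.continuousAt
      rwa [ContinuousAt, symm_zero_of_zero hs h0] at this
    have h5 : ∀ᶠ z in 𝓝 (0 : ℂ), z ∈ e.target := e.open_target.mem_nhds ht
    exact h5.and (h2.and (h4.eventually h3))
  have h5 : Tendsto (Prod.fst : ℂ × ℝ → ℂ) (𝓝 0) (𝓝 0) := continuous_fst.tendsto 0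
  filter_upwards [h5.eventually h1] with p hp
  obtain ⟨hp1, hp2, hp3⟩ := hp
  refine ⟨hp1, _, hp2.hasFDerivAt, ?_⟩
  have h6 : HasFDerivAt (fun x => e.symm (e x)) ((fderiv ℝ e.symm p.1).comp
      (fderiv ℝ e (e.symm p.1))) (e.symm p.1) := by
    refine HasFDerivAt.comp (e.symm p.1) ?_ hp3.hasFDerivAt
    rw [e.right_inv hp1]
    exact hp2.hasFDerivAt
  have h7 : HasFDerivAt (fun x => e.symm (e x)) (ContinuousLinearMap.id ℝ E) (e.symm p.1) :=
    (hasFDerivAt_id _).congr_of_eventuallyEq (e.eventually_left_inverse (e.map_target hp1))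
  exact congrArg (fun l : E →L[ℝ] E => l (F p.2 (e.symm p.1))) (h6.unique h7)

theorem trace_complex (l : ℂ →ₗ[ℝ] ℂ) :
    LinearMap.trace ℝ ℂ l = (l 1).re + (l Complex.I).im := by
  rw [LinearMap.trace_eq_matrix_trace ℝ Complex.basisOneI, Matrix.trace_fin_two]
  simp [LinearMap.toMatrix_apply]

/-- A change of coordinates does not change the trace of the linear part at an equilibrium. -/
theorem trace_sliceDeriv_chartField [FiniteDimensional ℝ E]
    (hs : (0 : E) ∈ e.source) (h0 : e 0 = 0)
    (he : ContDiffAt ℝ ∞ e 0) (he' : ContDiffAt ℝ ∞ e.symm 0)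
    (hF : ContDiff ℝ ∞ fun p : ℝ × E => F p.1 p.2) (hF0 : ∀ α, F α 0 = 0) :
    ∀ᶠ α in 𝓝 (0 : ℝ), (sliceDeriv (chartField e F) (0, α) 1).re +
      (sliceDeriv (chartField e F) (0, α) Complex.I).im =
        LinearMap.trace ℝ E (fderiv ℝ (F α) 0 : E →ₗ[ℝ] E) := by
  have hG := contDiffAt_chartField hs h0 he he' hF
  have hs0 := symm_zero_of_zero hs h0
  have h1 : ∀ᶠ p in 𝓝 (0 : ℂ × ℝ), DifferentiableAt ℝ (chartField e F) p :=
    ((hG.of_le (by simp : (1 : WithTop ℕ∞) ≤ ∞)).eventually (by simp)).mono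
      fun z hz => hz.differentiableAt (by simp)
  have h2 : Tendsto (fun α : ℝ => ((0 : ℂ), α)) (𝓝 0) (𝓝 0) :=
    (Continuous.prodMk_right (0 : ℂ)).tendsto 0
  have hd : HasFDerivAt e (fderiv ℝ e 0) 0 := (he.differentiableAt (by simp)).hasFDerivAt
  have hd' : HasFDerivAt e.symm (fderiv ℝ e.symm 0) 0 :=
    (he'.differentiableAt (by simp)).hasFDerivAt
  have hinv : (fderiv ℝ e.symm 0).comp (fderiv ℝ e 0) = ContinuousLinearMap.id ℝ E := by
    have h6 : HasFDerivAt (fun x => e.symm (e x)) ((fderiv ℝ e.symm 0).comp (fderiv ℝ e 0)) 0 := by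
      refine HasFDerivAt.comp 0 ?_ hd
      rw [h0]; exact hd'
    exact h6.unique ((hasFDerivAt_id _).congr_of_eventuallyEq (e.eventually_left_inverse hs))
  filter_upwards [h2.eventually h1] with α hα
  have h3 : HasFDerivAt (fun z => chartField e F (z, α)) (sliceDeriv (chartField e F) (0, α)) 0 :=
    HasFDerivAt.comp (0 : ℂ) (g := chartField e F) (f := fun z => (z, α))
      hα.hasFDerivAt (hasFDerivAt_prodMk_left 0 α)
  have h4 : HasFDerivAt (fun z => F α (e.symm z)) ((fderiv ℝ (F α) 0).comp (fderiv ℝ e.symm 0)) 0 := by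
    refine HasFDerivAt.comp 0 ?_ hd'
    rw [hs0]
    have h5 : ContDiff ℝ ∞ (F α) := hF.comp (contDiff_const.prodMk contDiff_id)
    exact (h5.differentiable (by simp) 0).hasFDerivAt
  have h7 : DifferentiableAt ℝ (fun z => fderiv ℝ e (e.symm z)) 0 := by
    refine DifferentiableAt.comp 0 ?_ hd'.differentiableAt
    rw [hs0]
    exact (he.fderiv_right (m := ∞) (by simp)).differentiableAt (by simp)
  -- In the product rule, the term that differentiates `fderiv ℝ e` is applied to `F α 0 = 0`. What
  -- remains is a conjugate of the linear part of `F α`, and the trace is cyclic.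
  have h8 := h7.hasFDerivAt.clm_apply h4
  have h9 : sliceDeriv (chartField e F) (0, α) =
      (fderiv ℝ e 0).comp ((fderiv ℝ (F α) 0).comp (fderiv ℝ e.symm 0)) := by
    rw [h3.unique h8, hs0, hF0]
    ext z
    simp
  refine (trace_complex (sliceDeriv (chartField e F) (0, α) : ℂ →ₗ[ℝ] ℂ)).symm.trans ?_
  rw [h9]
  change LinearMap.trace ℝ ℂ ((fderiv ℝ e 0 : E →ₗ[ℝ] ℂ) ∘ₗ
    ((fderiv ℝ (F α) 0 : E →ₗ[ℝ] E) ∘ₗ (fderiv ℝ e.symm 0 : ℂ →ₗ[ℝ] E))) = _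
  rw [LinearMap.trace_comp_comm', LinearMap.comp_assoc]
  have h10 : (fderiv ℝ e.symm 0 : ℂ →ₗ[ℝ] E) ∘ₗ (fderiv ℝ e 0 : E →ₗ[ℝ] ℂ) = LinearMap.id :=
    congrArg (fun l : E →L[ℝ] E => (l : E →ₗ[ℝ] E)) hinv
  rw [h10, LinearMap.comp_id]

end Chart

/-! ### The kinetic system -/

section Kinetic

variable {f g : ℝ → ℝ → ℝ → ℝ}

theorem contDiff_kineticField (hf : ContDiff ℝ ∞ fun p : ℝ × ℝ × ℝ => f p.1 p.2.1 p.2.2)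
    (hg : ContDiff ℝ ∞ fun p : ℝ × ℝ × ℝ => g p.1 p.2.1 p.2.2) :
    ContDiff ℝ ∞ fun p : ℝ × (ℝ × ℝ) => kineticField f g p.1 p.2 := by
  have h : ContDiff ℝ ∞ fun p : ℝ × (ℝ × ℝ) => (p.2.1, p.2.2, p.1) := by fun_prop
  exact (hf.comp h).prodMk (hg.comp h)

theorem trace_fderiv_kineticField {α : ℝ} (h : DifferentiableAt ℝ (kineticField f g α) 0) :
    LinearMap.trace ℝ (ℝ × ℝ) (fderiv ℝ (kineticField f g α) 0 : ℝ × ℝ →ₗ[ℝ] ℝ × ℝ) =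
      (jacobianAtOrigin f g α).trace := by
  have h1 : HasDerivAt (fun u => kineticField f g α (u, 0))
      (fderiv ℝ (kineticField f g α) 0 (1, 0)) 0 :=
    HasFDerivAt.comp_hasDerivAt (0 : ℝ) (f := fun u : ℝ => (u, (0 : ℝ))) h.hasFDerivAt
      ((hasDerivAt_id 0).prodMk (hasDerivAt_const 0 0))
  have h2 : HasDerivAt (fun v => kineticField f g α (0, v))
      (fderiv ℝ (kineticField f g α) 0 (0, 1)) 0 :=
    HasFDerivAt.comp_hasDerivAt (0 : ℝ) (f := fun v : ℝ => ((0 : ℝ), v)) h.hasFDerivAt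
      ((hasDerivAt_const 0 0).prodMk (hasDerivAt_id 0))
  have h3 : deriv (fun u => f u 0 α) 0 = (fderiv ℝ (kineticField f g α) 0 (1, 0)).1 :=
    (HasFDerivAt.comp_hasDerivAt (0 : ℝ) (l := Prod.fst)
      (l' := .fst ℝ ℝ ℝ) hasFDerivAt_fst h1).deriv
  have h4 : deriv (fun v => g 0 v α) 0 = (fderiv ℝ (kineticField f g α) 0 (0, 1)).2 :=
    (HasFDerivAt.comp_hasDerivAt (0 : ℝ) (l := Prod.snd)
      (l' := .snd ℝ ℝ ℝ) hasFDerivAt_snd h2).deriv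
  rw [LinearMap.trace_eq_matrix_trace ℝ (Module.Basis.finTwoProd ℝ), Matrix.trace_fin_two,
    jacobianAtOrigin, Matrix.trace_fin_two_of, h3, h4]
  simp [LinearMap.toMatrix_apply]

theorem HasEigenvaluePair.trace_eq {M : Matrix (Fin 2) (Fin 2) ℝ} {a b : ℝ}
    (h : HasEigenvaluePair M a b) : M.trace = 2 * a := by
  have h1 := Matrix.trace_eq_sum_roots_charpoly (M.map (algebraMap ℝ ℂ))
  rw [h, Matrix.trace_fin_two] at h1
  rw [Matrix.trace_fin_two]
  have h2 := congrArg Complex.re h1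
  simp at h2
  linarith

/-- The chart is fixed and normalizes the field at `α = 0` only. For other α, `A(α)` is recovered
from the trace, which a change of coordinates preserves at an equilibrium. Differentiability of `A`
at 0 is implied by its nonzero `deriv`. -/
theorem hopfNormalForm_kineticField {μ₀ : ℝ} {k : ℕ} {C : ℕ → ℂ} {A B : ℝ → ℝ}
    {e : OpenPartialHomeomorph (ℝ × ℝ) ℂ}
    (hf : ContDiff ℝ ∞ fun p : ℝ × ℝ × ℝ => f p.1 p.2.1 p.2.2)
    (hg : ContDiff ℝ ∞ fun p : ℝ × ℝ × ℝ => g p.1 p.2.1 p.2.2)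
    (hf0 : ∀ α, f 0 0 α = 0) (hg0 : ∀ α, g 0 0 α = 0) (hμ₀ : 0 < μ₀)
    (hAB : ∀ᶠ α in 𝓝 0, HasEigenvaluePair (jacobianAtOrigin f g α) (A α) (B α))
    (hA : deriv A 0 ≠ 0) (hfocus : IsWeakFocusOfOrder (kineticField f g 0) μ₀ k C)
    (hCk : (C k).re < 0) (hs : (0 : ℝ × ℝ) ∈ e.source) (h0 : e 0 = 0)
    (he : ContDiffAt ℝ ∞ e 0) (he' : ContDiffAt ℝ ∞ e.symm 0)
    (hO : (fun x => fderiv ℝ e x (kineticField f g 0 x) - normalFormField μ₀ k C (e x))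
      =O[𝓝 0] (fun x => ‖e x‖ ^ (2 * k + 3))) :
    HopfNormalForm (chartField e (kineticField f g)) μ₀ k C A (deriv A 0) where
  contDiffAt := contDiffAt_chartField hs h0 he he' (contDiff_kineticField hf hg)
  map_zero := Eventually.of_forall fun α => by
    have h1 : kineticField f g α 0 = 0 := Prod.ext (hf0 α) (hg0 α)
    simp only [chartField]
    rw [symm_zero_of_zero hs h0, h1, map_zero]
  isBigO := by
    have h1 : Tendsto e.symm (𝓝 0) (𝓝 0) := by
      have := he'.continuousAt
      rwa [ContinuousAt, symm_zero_of_zero hs h0] at this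
    have h2 := e.eventually_right_inverse (zero_mem_target hs h0)
    refine (hO.comp_tendsto h1).congr' ?_ ?_
    · filter_upwards [h2] with z hz
      simp only [Function.comp_apply, chartField, hz]
    · filter_upwards [h2] with z hz
      simp only [Function.comp_apply, hz]
  μ₀_pos := hμ₀
  one_le := hfocus.one_le
  re_eq_zero := hfocus.re_eq_zero
  re_neg := hCk
  trace := by
    have hF := contDiff_kineticField hf hg
    filter_upwards [hAB, trace_sliceDeriv_chartField hs h0 he he' hF
      fun α => Prod.ext (hf0 α) (hg0 α)] with α h1 h2
    have h3 : ContDiff ℝ ∞ (kineticField f g α) := hF.comp (contDiff_const.prodMk contDiff_id)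
    rw [h2, trace_fderiv_kineticField (h3.differentiable (by simp) 0), h1.trace_eq]
  hasDerivAt := (differentiableAt_of_deriv_ne_zero hA).hasDerivAt
  ne_zero := hA

/-- The coupling vanishes on synchronous states. -/
theorem patchField_const {n : ℕ} (δ : ℝ) (D : Matrix (Fin 2) (Fin 2) ℝ) (F : ℝ × ℝ → ℝ × ℝ)
    (x : ℝ × ℝ) : patchField (n := n) δ D F (fun _ => x) = fun _ => F x := by
  funext j
  simp [patchField]

theorem IsPeriodicSolution.isSynchronousPeriodicSolution {F : ℝ × ℝ → ℝ × ℝ} {φ : ℝ → ℝ × ℝ}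
    (h : IsPeriodicSolution F φ) (n : ℕ) (δ : ℝ) (D : Matrix (Fin 2) (Fin 2) ℝ) :
    IsSynchronousPeriodicSolution (n := n) (patchField δ D F) fun t _ => φ t := by
  refine ⟨fun t => ?_, φ, fun _ _ => rfl, h.2⟩
  have h1 : HasDerivAt (fun t (_ : Fin n) => φ t) (fun _ => F (φ t)) t :=
    hasDerivAt_pi.2 fun _ => h.1 t
  exact h1.congr_deriv (patchField_const δ D F (φ t)).symm

end Kinetic

end PatchHopf

theorem proposition3p5
    (f g : ℝ → ℝ → ℝ → ℝ)
    (hf : ContDiff ℝ ∞ (fun p : ℝ × ℝ × ℝ => f p.1 p.2.1 p.2.2))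
    (hg : ContDiff ℝ ∞ (fun p : ℝ × ℝ × ℝ => g p.1 p.2.1 p.2.2))
    (hf0 : ∀ α, f 0 0 α = 0) (hg0 : ∀ α, g 0 0 α = 0)
    -- the origin is a center-type equilibrium for `α = 0`
    (μ₀ : ℝ) (hμ₀ : 0 < μ₀) (hcenter : HasEigenvaluePair (jacobianAtOrigin f g 0) 0 μ₀)
    -- near `α = 0`, the eigenvalues of `J(α)` are `A(α) ± i B(α)`
    (A B : ℝ → ℝ)
    (hAB : ∀ᶠ α in 𝓝 0, HasEigenvaluePair (jacobianAtOrigin f g α) (A α) (B α))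
    (hA : deriv A 0 ≠ 0)
    (k : ℕ) (C : ℕ → ℂ)
    (hfocus : IsWeakFocusOfOrder (kineticField f g 0) μ₀ k C)
    (hCk : (C k).re < 0) :
    ∃ α₀ > 0, ∃ ψ : ℝ → ℝ → ℝ × ℝ,
      ((∀ α, |α| < α₀ → 0 < α * deriv A 0 →
          IsStablePeriodicSolution (kineticField f g α) (ψ α)) ∧
        BifurcatesFromOrigin {α | |α| < α₀ ∧ 0 < α * deriv A 0} ψ) ∧
      (∀ α, |α| < α₀ → 0 < α * deriv A 0 →
        ∀ n : ℕ, 2 ≤ n → ∀ δ : ℝ, 0 < δ → ∀ D : Matrix (Fin 2) (Fin 2) ℝ,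
          IsSynchronousPeriodicSolution (n := n) (patchField δ D (kineticField f g α))
            (fun t _ => ψ α t)) := by
  obtain ⟨Φ, hΦ, hΦ0, hbij, hO⟩ := hfocus.coefficients
  obtain ⟨e, rfl, hs, he'⟩ := exists_chart hΦ hΦ0 hbij
  have hF := contDiff_kineticField hf hg
  have hlip : ∀ α, LocallyLipschitz (kineticField f g α) := fun α =>
    ((hF.comp (contDiff_const.prodMk contDiff_id) : ContDiff ℝ ∞ (kineticField f g α)).of_le
      (by simp)).locallyLipschitz
  obtain ⟨α₀, hα₀, ψ, hψ, hbif⟩ :=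
    (hopfNormalForm_kineticField hf hg hf0 hg0 hμ₀ hAB hA hfocus hCk hs hΦ0 hΦ he'
      hO).exists_stable_branch hlip (eventually_isTransportedAt hs hΦ0 hΦ he')
      (symm_zero_of_zero hs hΦ0)
  -- The bound `α₀` comes from the kinetic system alone, so it serves every number of patches and
  -- every coupling.
  exact ⟨α₀, hα₀, ψ, ⟨hψ, hbif⟩, fun α h1 h2 n _ δ _ D =>
    (hψ α h1 h2).periodic.isSynchronousPeriodicSolution n δ D⟩
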